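/- Let $X=(\Gamma\backslash\mathbb H_3(\mathbb R))\times\mathbb R/\mathbb Z$ be the Kodaira--Thurston manifold, where $\mathbb H_3(\mathbb R)$ is the Heisenberg group of upper triangular matrices $\begin{pmatrix}1&x_1&x_3\\0&1&x_2\\0&0&1\end{pmatrix}$ and $\Gamma$ is its subgroup of matrices with integral entries, and let $x_4$ be the coordinate on $\mathbb R/\mathbb Z$. Let $e^1=dx_1$, $e^2=dx_2$, $e^3=dx_3-x_1dx_2$, $e^4=dx_4$ be the global left-invariant coframe, and write $e^{ij}=e^i\wedge e^j$, and so on. Let $J$ be the almost-complex structure on $X$ with $(1,0)$-coframe $\varphi^1=e^1+ie^3$, $\varphi^2=e^2+ie^4$, and write $\varphi^{i\bar j}=\varphi^i\wedge\overline{\varphi^j}$, and so on. For an almost-Hermitian metric with fundamental form $\omega$ and complex-linear Hodge operator $*$ (for the orientation given by $J$), let $\bar\partial$ and $\partial$ be the components of $d$ of bidegree $(0,1)$ and $(1,0)$, let $\bar\partial^*=-*\partial*$ and $\Delta_{\bar\partial}=\bar\partial\bar\partial^*+\bar\partial^*\bar\partial$, and let $\mathcal H^{1,1}_{\bar\partial,\omega}$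 be the kernel of $\Delta_{\bar\partial}$ on smooth $(1,1)$-forms on $X$, with $h^{1,1}_{\bar\partial,\omega}=\dim_{\mathbb C}\mathcal H^{1,1}_{\bar\partial,\omega}$. Let $b_-$ be the dimension of the space of real anti-self-dual harmonic $2$-forms (harmonic for the Hodge Laplacian $dd^*+d^*d$) on $X$. Then $J$ is left-invariant, satisfies $$d\varphi^1=-\tfrac i4\varphi^{12}-\tfrac i4\varphi^{1\bar2}+\tfrac i4\varphi^{2\bar1}-\tfrac i4\varphi^{\bar1\bar2},\qquad d\varphi^2=0,$$ and is not integrable. Let $f:\mathbb R\to\mathbb R$ be a smooth function of period $1$ whose derivative is not identically zero; it induces the smooth function $f(x_2)$ on $X$. For every $t\in\mathbb R$ the form $$\omega_{tf}=e^{2tf(x_2)}e^{13}+e^{24}$$ is the fundamental form of a Hermitian metric on $(X,J)$, and: \begin{enumerate} \item $\omega_{tf}$ is left-invariant if and only if $t=0$, and it is almost-K\"ahler (that is, $d\omega_{tf}=0$) if and only if $t=0$; \item $d\omega_{tf}=-2te^{2tf(x_2)}f'(x_2)\,e^{123}=2t\,df\wedge\omega_{tf}$; so $\omega_{tf}$ is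 globally conformally K\"ahler (that is, $d\omega_{tf}=dh\wedge\omega_{tf}$ for a smooth function $h$ on $X$), and $e^{-2tf(x_2)}\omega_{tf}$ is an almost-K\"ahler metric on $(X,J)$; \item $b_-=2$ with respect to the metric $\omega_{tf}$, and $h^{1,1}_{\bar\partial,\omega_{tf}}=b_-+1=3$; \item the forms $\varphi^{1\bar1}$, $\varphi^{1\bar2}+\varphi^{2\bar1}$, $e^{-2tf(x_2)}\varphi^{2\bar2}$ are a basis of the complex vector space $\mathcal H^{1,1}_{\bar\partial,\omega_{tf}}$. \end{enumerate} -/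

import Mathlib

open scoped ContDiff Matrix

noncomputable section

namespace KodairaThurston

/-! ### The group, the lattice and the manifold -/

/-- The Lie group `ℍ₃(ℝ) × ℝ` in its global coordinates `(x₁, x₂, x₃, x₄)`; the coordinate `xᵢ` is
`x (i - 1)`. The point `(x₁, x₂, x₃)` stands for the upper triangular matrix `heisenberg x`. -/
abbrev G : Type := Fin 4 → ℝ

/-- The matrix in the Heisenberg group `ℍ₃(ℝ)` with coordinates `(x₁, x₂, x₃)`. -/
def heisenberg (x : G) : Matrix (Fin 3) (Fin 3) ℝ :=
  !![1, x 0, x 2; 0, 1, x 1; 0, 0, 1]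

/-- Multiplication of the group `ℍ₃(ℝ) × ℝ` (see `heisenberg_mul`). For fixed `a` it is the left
translation by `a`. -/
def mul (a x : G) : G := ![a 0 + x 0, a 1 + x 1, a 2 + x 2 + a 0 * x 1, a 3 + x 3]

theorem heisenberg_mul (a x : G) : heisenberg (mul a x) = heisenberg a * heisenberg x := by
  ext i j
  fin_cases i <;> fin_cases j <;> simp [heisenberg, mul, Matrix.mul_apply, Fin.sum_univ_three] <;>
    ring

/-- The lattice `Γ × ℤ`: matrices with integral entries, and integers in the last factor. -/
def lattice : Set G := {γ | ∀ i, ∃ n : ℤ, γ i = n}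

/-- Two points are identified when they differ by left multiplication by an element of the
lattice. -/
def orbitSetoid : Setoid G where
  r x y := ∃ γ ∈ lattice, mul γ x = y
  iseqv := by
    refine ⟨fun x => ⟨0, fun i => ⟨0, by simp⟩, ?_⟩, ?_, ?_⟩
    · ext i; fin_cases i <;> simp [mul]
    · rintro x y ⟨γ, hγ, rfl⟩
      obtain ⟨a, ha⟩ := hγ 0
      obtain ⟨b, hb⟩ := hγ 1
      obtain ⟨c, hc⟩ := hγ 2
      obtain ⟨d, hd⟩ := hγ 3
      refine ⟨![-γ 0, -γ 1, -γ 2 + γ 0 * γ 1, -γ 3], ?_, ?_⟩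
      · intro i
        fin_cases i
        · exact ⟨-a, by simp [ha]⟩
        · exact ⟨-b, by simp [hb]⟩
        · exact ⟨-c + a * b, by simp [ha, hb, hc]⟩
        · exact ⟨-d, by simp [hd]⟩
      · ext i; fin_cases i <;> simp [mul]
        ring
    · rintro x y z ⟨γ, hγ, rfl⟩ ⟨δ, hδ, rfl⟩
      obtain ⟨a, ha⟩ := hγ 0
      obtain ⟨b, hb⟩ := hγ 1
      obtain ⟨c, hc⟩ := hγ 2
      obtain ⟨d, hd⟩ := hγ 3
      obtain ⟨a', ha'⟩ := hδ 0
      obtain ⟨b', hb'⟩ := hδ 1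
      obtain ⟨c', hc'⟩ := hδ 2
      obtain ⟨d', hd'⟩ := hδ 3
      refine ⟨mul δ γ, ?_, ?_⟩
      · intro i
        fin_cases i
        · exact ⟨a' + a, by simp [mul, ha, ha']⟩
        · exact ⟨b' + b, by simp [mul, hb, hb']⟩
        · exact ⟨c' + c + a' * b, by simp [mul, hc, hc', ha', hb]⟩
        · exact ⟨d' + d, by simp [mul, hd, hd']⟩
      · ext i; fin_cases i <;> simp [mul] <;> ring

/-- The Kodaira–Thurston manifold `X = (Γ \ ℍ₃(ℝ)) × ℝ/ℤ`. The projection `G → X` is its universal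
covering, with the lattice as group of deck transformations. -/
def X : Type := Quotient orbitSetoid

/-- The covering projection `G → X`. -/
def proj (x : G) : X := Quotient.mk orbitSetoid x

/-! ### Tensors on the manifold

A tensor field on `X` is given by its pull-back to `G`, which is any tensor field on `G` that is
invariant under left translation by the lattice. Left-invariant tensor fields are those which are
invariant under all left translations. -/

/-- Differential `k`-forms on `G` with values in `F`. -/
abbrev Form (k : ℕ) (F : Type) [NormedAddCommGroup F] [NormedSpace ℝ F] : Type :=
  G → G [⋀^Fin k]→L[ℝ] F

section Generic

variable {k m : ℕ} {F : Type} [NormedAddCommGroup F] [NormedSpace ℝ F]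

/-- The form `α` is invariant under left translation by every element of `S`: `L_a^* α = α`. -/
def InvariantForm (S : Set G) (α : Form k F) : Prop :=
  ∀ a ∈ S, ∀ x, (α (mul a x)).compContinuousLinearMap (fderiv ℝ (mul a) x) = α x

/-- The endomorphism field `J` of the tangent bundle is invariant under left translation by every
element of `S`. -/
def InvariantEndo (S : Set G) (J : G → G →L[ℝ] G) : Prop :=
  ∀ a ∈ S, ∀ x, (fderiv ℝ (mul a) x) ∘L (J x) = (J (mul a x)) ∘L (fderiv ℝ (mul a) x)

/-- `α` is (the pull-back to `G` of) a smooth differential form on `X`. -/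
def IsFormOnX (α : Form k F) : Prop :=
  ContDiff ℝ ∞ α ∧ InvariantForm lattice α

/-- `θ ∧ β` for a covector `θ` and an alternating form `β`:
`(θ ∧ β)(v₀, …, v_k) = ∑ i, (-1)ⁱ θ(vᵢ) β(v₀, …, v̂ᵢ, …, v_k)`. -/
def wedge {A : Type} [RCLike A] (θ : G →L[ℝ] A) (β : G [⋀^Fin k]→L[ℝ] A) :
    G [⋀^Fin (k + 1)]→L[ℝ] A :=
  ContinuousAlternatingMap.alternatizeUncurryFin (θ.smulRight β)

/-- `θ ∧ η` for two covectors. -/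
def wedge₁₁ {A : Type} [RCLike A] (θ η : G →L[ℝ] A) : G [⋀^Fin 2]→L[ℝ] A :=
  wedge θ (ContinuousAlternatingMap.ofSubsingleton ℝ G A (0 : Fin 1) η)

/-- `θ ∧ η ∧ ζ` for three covectors. -/
def wedge₁₁₁ {A : Type} [RCLike A] (θ η ζ : G →L[ℝ] A) : G [⋀^Fin 3]→L[ℝ] A :=
  wedge θ (wedge₁₁ η ζ)

/-- Contraction with `k` vectors: `(contract v η)(w) = η(v₀, …, v_{k-1}, w)`. -/
def contract : {k : ℕ} → (Fin k → G) → G [⋀^Fin (m + k)]→L[ℝ] F → G [⋀^Fin m]→L[ℝ] F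
  | 0, _, η => η
  | _ + 1, v, η => contract (Fin.tail v) (η.curryLeft (v 0))

/-! ### Linear algebra of a Hermitian structure at one point -/

/-- Standard basis vectors of the coordinate space. -/
def stdVec (i : Fin 4) : G := Pi.single i 1

/-- The matrix of the metric `g(u, v) = Ω(u, J v)` in the standard basis. -/
def metricMatrix (J : G →L[ℝ] G) (Ω : G [⋀^Fin 2]→L[ℝ] ℝ) : Matrix (Fin 4) (Fin 4) ℝ :=
  Matrix.of fun i j => Ω ![stdVec i, J (stdVec j)]

/-- The Pfaffian of a `2`-form: `Ω ∧ Ω / 2 = pfaffian Ω • dx¹ ∧ dx² ∧ dx³ ∧ dx⁴`. -/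
def pfaffian (Ω : G [⋀^Fin 2]→L[ℝ] ℝ) : ℝ :=
  Ω ![stdVec 0, stdVec 1] * Ω ![stdVec 2, stdVec 3]
    - Ω ![stdVec 0, stdVec 2] * Ω ![stdVec 1, stdVec 3]
    + Ω ![stdVec 0, stdVec 3] * Ω ![stdVec 1, stdVec 2]

/-- The form `dx¹ ∧ dx² ∧ dx³ ∧ dx⁴`, that is, the determinant. -/
def detForm : G [⋀^Fin 4]→L[ℝ] ℝ :=
  { (Matrix.detRowAlternating : (Fin 4 → ℝ) [⋀^Fin 4]→ₗ[ℝ] ℝ) with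
    cont := (continuous_id : Continuous fun M : Matrix (Fin 4) (Fin 4) ℝ => M).matrix_det }

/-- The Riemannian volume form `Ω ∧ Ω / 2` of a Hermitian structure in real dimension four, for the
orientation given by the almost-complex structure. -/
def volumeForm (Ω : G [⋀^Fin 2]→L[ℝ] ℝ) : G [⋀^Fin 4]→L[ℝ] ℝ := pfaffian Ω • detForm

/-- The Hodge star from `k`-forms to `m`-forms for the metric with inverse matrix `B` and the volume
form `vol` (with `m + k = 4`):
`⋆α = (1 / k!) ∑ α(∂_{a₁}, …, ∂_{a_k}) vol(♯dx^{a₁}, …, ♯dx^{a_k}, ·)`,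
where `♯dxᵃ` is the `a`-th row of `B`. So `β ∧ ⋆α = ⟨β, α⟩ vol`, extended linearly to forms with
values in `F`; for `F = ℂ` this is the complex-linear Hodge star. -/
def hodgeStar (B : Matrix (Fin 4) (Fin 4) ℝ) (vol : G [⋀^Fin (m + k)]→L[ℝ] ℝ)
    (α : G [⋀^Fin k]→L[ℝ] F) : G [⋀^Fin m]→L[ℝ] F :=
  ((Nat.factorial k : ℝ)⁻¹) • ∑ a : Fin k → Fin 4,
    (contract (fun i => B (a i)) vol).smulRight (α fun i => stdVec (a i))

/-- The Hodge star on `2`-forms of the Hermitian structure `(J, Ω)` at one point. -/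
def star₂ (J : G →L[ℝ] G) (Ω : G [⋀^Fin 2]→L[ℝ] ℝ) (α : G [⋀^Fin 2]→L[ℝ] F) :
    G [⋀^Fin 2]→L[ℝ] F :=
  hodgeStar (m := 2) (metricMatrix J Ω)⁻¹ (volumeForm Ω) α

/-- The Hodge star on `3`-forms of the Hermitian structure `(J, Ω)` at one point. -/
def star₃ (J : G →L[ℝ] G) (Ω : G [⋀^Fin 2]→L[ℝ] ℝ) (α : G [⋀^Fin 3]→L[ℝ] F) :
    G [⋀^Fin 1]→L[ℝ] F :=
  hodgeStar (m := 1) (metricMatrix J Ω)⁻¹ (volumeForm Ω) α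

end Generic

/-- The derivation of the algebra of complex forms that extends the action `α ↦ α ∘ J` on `1`-forms:
`(𝒥α)(v₁, …, v_k) = ∑ i, α(v₁, …, J vᵢ, …, v_k)`. -/
def jDer (J : G →L[ℝ] G) : (k : ℕ) → Module.End ℂ (G [⋀^Fin k]→L[ℝ] ℂ)
  | 0 => 0
  | k + 1 =>
    { toFun := fun α => ContinuousAlternatingMap.alternatizeUncurryFin (α.curryLeft ∘L J)
      map_add' := fun α β => by
        rw [ContinuousAlternatingMap.curryLeft_add, ContinuousLinearMap.add_comp,
          ContinuousAlternatingMap.alternatizeUncurryFin_add]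
      map_smul' := fun c α => by
        rw [RingHom.id_apply, ← ContinuousAlternatingMap.alternatizeUncurryFin_smul]
        rfl }

theorem jDer_apply (J : G →L[ℝ] G) (k : ℕ) (α : G [⋀^Fin k]→L[ℝ] ℂ) (v : Fin k → G) :
    jDer J k α v = ∑ i, α (Function.update v i (J (v i))) := by
  cases k with
  | zero => simp [jDer]
  | succ k =>
    change ContinuousAlternatingMap.alternatizeUncurryFin (α.curryLeft ∘L J) v = _
    rw [ContinuousAlternatingMap.alternatizeUncurryFin_apply]
    refine Finset.sum_congr rfl fun i _ => ?_
    rw [← Fin.insertNth_removeNth, ContinuousAlternatingMap.map_insertNth]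
    rfl

/-- The eigenvalue `i (p - q)` of `𝒥` on forms of type `(p, q)` with `p + q = k`. -/
def typeEigenvalue (k p : ℕ) : ℂ := (2 * (p : ℂ) - k) * Complex.I

/-- `α` is of type `(p, k - p)` for the complex structure `J`. -/
def HasType {k : ℕ} (J : G →L[ℝ] G) (p : ℕ) (α : G [⋀^Fin k]→L[ℝ] ℂ) : Prop :=
  jDer J k α = typeEigenvalue k p • α

/-- The projection of `k`-forms onto forms of type `(p, k - p)`, `p ≤ k`, along the other types:
the spectral projection of `𝒥` for the eigenvalue `i (2 p - k)`. -/
def typeProj (J : G →L[ℝ] G) (k p : ℕ) : Module.End ℂ (G [⋀^Fin k]→L[ℝ] ℂ) :=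
  Polynomial.aeval (jDer J k) (Lagrange.basis (Finset.range (k + 1)) (typeEigenvalue k) p)

/-! ### Almost-Hermitian structures on the manifold -/

/-- An almost-Hermitian structure on `X`: a smooth almost-complex structure `J`, and a Hermitian
metric given by its fundamental form `Ω`; the Riemannian metric is `g(u, v) = Ω(u, J v)`. -/
structure AlmostHermitian where
  J : G → G →L[ℝ] G
  J_smooth : ContDiff ℝ ∞ J
  J_sq : ∀ x v, J x (J x v) = -v
  J_inv : InvariantEndo lattice J
  Ω : Form 2 ℝ
  Ω_form : IsFormOnX Ω
  Ω_compat : ∀ x u v, Ω x ![J x u, J x v] = Ω x ![u, v]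
  Ω_pos : ∀ x u, u ≠ 0 → 0 < Ω x ![u, J x u]

/-- The Nijenhuis tensor `[JU, JV] - J[JU, V] - J[U, JV] - [U, V]`. -/
def nijenhuis (J : G → G →L[ℝ] G) (U V : G → G) (x : G) : G :=
  VectorField.lieBracket ℝ (fun y => J y (U y)) (fun y => J y (V y)) x
    - J x (VectorField.lieBracket ℝ (fun y => J y (U y)) V x)
    - J x (VectorField.lieBracket ℝ U (fun y => J y (V y)) x)
    - VectorField.lieBracket ℝ U V x

/-- Integrability: the Nijenhuis tensor vanishes. -/
def IsIntegrable (J : G → G →L[ℝ] G) : Prop :=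
  ∀ U V : G → G, ContDiff ℝ ∞ U → ContDiff ℝ ∞ V → ∀ x, nijenhuis J U V x = 0

/-- `∂̄ : A^{p,k-p} → A^{p,k-p+1}`, the component of type `(p, k + 1 - p)` of `d`. -/
def dbar {k : ℕ} (J : G → G →L[ℝ] G) (p : ℕ) (α : Form k ℂ) : Form (k + 1) ℂ :=
  fun x => typeProj (J x) (k + 1) p (extDeriv α x)

/-- `∂ : A^{p,k-p} → A^{p+1,k-p}`, the component of type `(p + 1, k - p)` of `d`. -/
def del {k : ℕ} (J : G → G →L[ℝ] G) (p : ℕ) (α : Form k ℂ) : Form (k + 1) ℂ :=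
  fun x => typeProj (J x) (k + 1) (p + 1) (extDeriv α x)

namespace AlmostHermitian

variable {A : Type} [RCLike A] (S : AlmostHermitian)

/-- The Hodge star on `2`-forms. -/
def star2 (α : Form 2 A) : Form 2 A := fun x => star₂ (S.J x) (S.Ω x) (α x)

/-- The Hodge star from `3`-forms to `1`-forms. -/
def star3 (α : Form 3 A) : Form 1 A := fun x => star₃ (S.J x) (S.Ω x) (α x)

/-- `∂̄^* = -⋆∂⋆ : A^{1,1} → A^{1,0}`. Here `⋆ : A^{1,1} → A^{1,1}`, `∂ : A^{1,1} → A^{2,1}` and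
`⋆ : A^{2,1} → A^{1,0}`. -/
def dbarStar11 (α : Form 2 ℂ) : Form 1 ℂ := -S.star3 (del S.J 1 (S.star2 α))

/-- `∂̄^* = -⋆∂⋆ : A^{1,2} → A^{1,1}`. Here `⋆ : A^{1,2} → A^{0,1}`, `∂ : A^{0,1} → A^{1,1}` and
`⋆ : A^{1,1} → A^{1,1}`. -/
def dbarStar12 (α : Form 3 ℂ) : Form 2 ℂ := -S.star2 (del S.J 0 (S.star3 α))

/-- The Laplacian `Δ = ∂̄ ∂̄^* + ∂̄^* ∂̄` on `A^{1,1}`. -/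
def dbarLaplacian11 (α : Form 2 ℂ) : Form 2 ℂ :=
  dbar S.J 1 (S.dbarStar11 α) + S.dbarStar12 (dbar S.J 1 α)

/-- The Hodge Laplacian `d d^* + d^* d` on real `2`-forms, where `d^* = -⋆d⋆`. -/
def hodgeLaplacian2 (α : Form 2 ℝ) : Form 2 ℝ :=
  extDeriv (-S.star3 (extDeriv (S.star2 α))) + (-S.star2 (extDeriv (S.star3 (extDeriv α))))

/-- The metric is almost-Kähler: the fundamental form is closed. -/
def IsAlmostKahler : Prop := extDeriv S.Ω = 0

/-- The metric is globally conformally Kähler: `dΩ = dh ∧ Ω` for a smooth function `h` on `X`. -/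
def IsGloballyConformallyKahler : Prop :=
  ∃ h : X → ℝ, ContDiff ℝ ∞ (fun x => h (proj x)) ∧
    ∀ x, extDeriv S.Ω x = wedge (fderiv ℝ (fun y => h (proj y)) x) (S.Ω x)

end AlmostHermitian

/-! ### Smoothness and linearity of the operators -/

section Smooth

variable {k m : ℕ} {A : Type} [RCLike A]

theorem contDiff_alternatize {β : G → G →L[ℝ] G [⋀^Fin k]→L[ℝ] A} (h : ContDiff ℝ ∞ β) :
    ContDiff ℝ ∞ (fun x => ContinuousAlternatingMap.alternatizeUncurryFin (β x)) := by
  have hb : IsBoundedLinearMap ℝ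
      (fun b : G →L[ℝ] G [⋀^Fin k]→L[ℝ] A => ContinuousAlternatingMap.alternatizeUncurryFin b) :=
    { map_add := ContinuousAlternatingMap.alternatizeUncurryFin_add
      map_smul := fun c b => ContinuousAlternatingMap.alternatizeUncurryFin_smul c b
      bound := ⟨k + 1, by positivity, ContinuousAlternatingMap.norm_alternatizeUncurryFin_le⟩ }
  exact hb.contDiff.comp h

theorem contDiff_extDeriv {α : Form k A} (h : ContDiff ℝ ∞ α) : ContDiff ℝ ∞ (extDeriv α) :=
  contDiff_alternatize (h.fderiv_right (m := ∞) (by simp))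

theorem contDiff_curryLeft {α : Form (k + 1) A} (h : ContDiff ℝ ∞ α) :
    ContDiff ℝ ∞ (fun x => (α x).curryLeft) := by
  have hb : IsBoundedLinearMap ℝ (fun b : G [⋀^Fin (k + 1)]→L[ℝ] A => b.curryLeft) :=
    { map_add := ContinuousAlternatingMap.curryLeft_add
      map_smul := ContinuousAlternatingMap.curryLeft_smul
      bound := ⟨1, one_pos, fun b => by simp⟩ }
  exact (IsBoundedLinearMap.contDiff (F := G →L[ℝ] G [⋀^Fin k]→L[ℝ] A) hb).comp h

theorem extDeriv_add' {α β : Form k A} (hα : ContDiff ℝ ∞ α) (hβ : ContDiff ℝ ∞ β) :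
    extDeriv (α + β) = extDeriv α + extDeriv β := by
  funext x
  exact extDeriv_add (hα.differentiable (by simp) x) (hβ.differentiable (by simp) x)

theorem extDeriv_smul' {α : Form k A} (hα : ContDiff ℝ ∞ α) (c : A) :
    extDeriv (c • α) = c • extDeriv α := by
  funext x
  simp only [extDeriv, Pi.smul_apply]
  rw [fderiv_const_smul (hα.differentiable (by simp) x),
    ContinuousAlternatingMap.alternatizeUncurryFin_smul]

theorem neg_smul_form (c : A) (α : Form k A) : -(c • α) = c • (-α) := by
  funext x; ext v; simp

theorem contDiff_neg {α : Form k A} (h : ContDiff ℝ ∞ α) : ContDiff ℝ ∞ (-α) := h.neg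

theorem contDiff_jDer {J : G → G →L[ℝ] G} (hJ : ContDiff ℝ ∞ J) {α : Form k ℂ}
    (h : ContDiff ℝ ∞ α) : ContDiff ℝ ∞ (fun x => jDer (J x) k (α x)) := by
  cases k with
  | zero => exact contDiff_const
  | succ k =>
    exact contDiff_alternatize ((contDiff_curryLeft h).clm_comp hJ)

theorem contDiff_typeProj {J : G → G →L[ℝ] G} (hJ : ContDiff ℝ ∞ J) {α : Form k ℂ}
    (h : ContDiff ℝ ∞ α) (p : ℕ) : ContDiff ℝ ∞ (fun x => typeProj (J x) k p (α x)) := by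
  unfold typeProj
  generalize Lagrange.basis (Finset.range (k + 1)) (typeEigenvalue k) p = P
  induction P using Polynomial.induction_on' with
  | add P Q hP hQ => simpa using hP.add hQ
  | monomial n a =>
    simp only [Polynomial.aeval_monomial, Module.End.mul_apply, Module.algebraMap_end_apply]
    refine ContDiff.const_smul a ?_
    induction n with
    | zero => simpa using h
    | succ n ih =>
      simp only [pow_succ', Module.End.mul_apply]
      exact contDiff_jDer hJ ih

theorem contDiff_dbar {J : G → G →L[ℝ] G} (hJ : ContDiff ℝ ∞ J) {α : Form k ℂ}
    (h : ContDiff ℝ ∞ α) (p : ℕ) : ContDiff ℝ ∞ (dbar J p α) :=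
  contDiff_typeProj hJ (contDiff_extDeriv h) p

theorem contDiff_del {J : G → G →L[ℝ] G} (hJ : ContDiff ℝ ∞ J) {α : Form k ℂ}
    (h : ContDiff ℝ ∞ α) (p : ℕ) : ContDiff ℝ ∞ (del J p α) :=
  contDiff_typeProj hJ (contDiff_extDeriv h) (p + 1)

theorem dbar_add (J : G → G →L[ℝ] G) (p : ℕ) {α β : Form k ℂ} (hα : ContDiff ℝ ∞ α)
    (hβ : ContDiff ℝ ∞ β) : dbar J p (α + β) = dbar J p α + dbar J p β := by
  funext x; simp [dbar, extDeriv_add' hα hβ]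

theorem dbar_smul (J : G → G →L[ℝ] G) (p : ℕ) {α : Form k ℂ} (hα : ContDiff ℝ ∞ α) (c : ℂ) :
    dbar J p (c • α) = c • dbar J p α := by
  funext x; simp [dbar, extDeriv_smul' hα]

theorem del_add (J : G → G →L[ℝ] G) (p : ℕ) {α β : Form k ℂ} (hα : ContDiff ℝ ∞ α)
    (hβ : ContDiff ℝ ∞ β) : del J p (α + β) = del J p α + del J p β := by
  funext x; simp [del, extDeriv_add' hα hβ]

theorem del_smul (J : G → G →L[ℝ] G) (p : ℕ) {α : Form k ℂ} (hα : ContDiff ℝ ∞ α) (c : ℂ) :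
    del J p (c • α) = c • del J p α := by
  funext x; simp [del, extDeriv_smul' hα]

theorem contDiff_contract {η : Form (m + k) A} (h : ContDiff ℝ ∞ η) {v : G → Fin k → G}
    (hv : ∀ i, ContDiff ℝ ∞ (fun x => v x i)) :
    ContDiff ℝ ∞ (fun x => contract (v x) (η x)) := by
  induction k with
  | zero => exact h
  | succ k ih =>
    exact ih (v := fun x => Fin.tail (v x)) ((contDiff_curryLeft h).clm_apply (hv 0))
      (fun i => hv i.succ)

theorem contDiff_eval {α : Form k A} (h : ContDiff ℝ ∞ α) (v : Fin k → G) :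
    ContDiff ℝ ∞ (fun x => α x v) :=
  (ContinuousAlternatingMap.apply ℝ G A v).contDiff.comp h

theorem contDiff_eval₂ {α : Form 2 ℝ} (h : ContDiff ℝ ∞ α) (u : G) {w : G → G}
    (hw : ContDiff ℝ ∞ w) : ContDiff ℝ ∞ (fun x => α x ![u, w x]) := by
  have h1 := contDiff_contract (m := 0) (k := 2) (η := α) h (v := fun x => ![u, w x]) (by
    intro i; fin_cases i
    · exact contDiff_const
    · exact hw)
  have h2 := contDiff_eval h1 ![]
  have h3 : (fun x => α x ![u, w x]) = fun x => contract (m := 0) (k := 2) ![u, w x] (α x) ![] :=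
    funext fun x => congrArg (α x) (by ext i : 1; fin_cases i <;> rfl)
  rw [h3]
  exact h2

theorem contDiff_smulRight {η : Form k ℝ} {c : G → A} (hη : ContDiff ℝ ∞ η)
    (hc : ContDiff ℝ ∞ c) : ContDiff ℝ ∞ (fun x => (η x).smulRight (c x)) := by
  have hb : IsBoundedBilinearMap ℝ
      (fun p : (G [⋀^Fin k]→L[ℝ] ℝ) × A => p.1.smulRight p.2) :=
    { add_left := fun a b z => by ext w; simp [add_smul]
      smul_left := fun r a z => by ext w; simp [mul_smul]
      add_right := fun a y z => by ext w; simp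
      smul_right := fun r a z => by ext w; exact smul_comm _ _ _
      bound := ⟨1, one_pos, fun a z => by
        refine ContinuousAlternatingMap.opNorm_le_bound _ (by positivity) fun w => ?_
        simp only [ContinuousAlternatingMap.smulRight_apply, norm_smul, one_mul]
        calc ‖a w‖ * ‖z‖ ≤ (‖a‖ * ∏ i, ‖w i‖) * ‖z‖ := by
              gcongr; exact a.le_opNorm w
          _ = _ := by ring⟩ }
  exact hb.contDiff.comp (hη.prodMk hc)

theorem hodgeStar_add (B : Matrix (Fin 4) (Fin 4) ℝ) (vol : G [⋀^Fin (m + k)]→L[ℝ] ℝ)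
    (α β : G [⋀^Fin k]→L[ℝ] A) :
    hodgeStar B vol (α + β) = hodgeStar B vol α + hodgeStar B vol β := by
  ext w
  simp [hodgeStar, ContinuousAlternatingMap.sum_apply, Finset.sum_add_distrib]

theorem hodgeStar_smul (B : Matrix (Fin 4) (Fin 4) ℝ) (vol : G [⋀^Fin (m + k)]→L[ℝ] ℝ)
    (c : A) (α : G [⋀^Fin k]→L[ℝ] A) :
    hodgeStar B vol (c • α) = c • hodgeStar B vol α := by
  ext w
  simp [hodgeStar, ContinuousAlternatingMap.sum_apply, Finset.mul_sum]

end Smooth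

namespace AlmostHermitian

variable {A : Type} [RCLike A] (S : AlmostHermitian)

theorem contDiff_metricMatrix (i j : Fin 4) :
    ContDiff ℝ ∞ (fun x => metricMatrix (S.J x) (S.Ω x) i j) :=
  contDiff_eval₂ S.Ω_form.1 (stdVec i) (S.J_smooth.clm_apply contDiff_const)

theorem det_metricMatrix_ne_zero (x : G) : (metricMatrix (S.J x) (S.Ω x)).det ≠ 0 := by
  intro h
  obtain ⟨v, hv, h0⟩ := Matrix.exists_mulVec_eq_zero_iff.2 h
  have hpos := S.Ω_pos x v hv
  have key : ∀ u w : G, S.Ω x ![u, S.J x w] = u ⬝ᵥ (metricMatrix (S.J x) (S.Ω x) *ᵥ w) := by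
    intro u w
    have hu : ∀ z : G, (S.Ω x ![u, z]) = ∑ i, u i * S.Ω x ![stdVec i, z] := by
      intro z
      have h1 : (S.Ω x ![u, z]) = (S.Ω x).curryLeft u ![z] := rfl
      have h2 : u = ∑ i, u i • stdVec i := by
        ext j; simp [stdVec, Finset.sum_apply, Pi.single_apply]
      rw [h1]
      conv_lhs => rw [h2]
      simp [ContinuousAlternatingMap.sum_apply]
    have hw : ∀ i, (S.Ω x ![stdVec i, S.J x w]) =
        ∑ j, w j * S.Ω x ![stdVec i, S.J x (stdVec j)] := by
      intro i
      let L := (ContinuousAlternatingMap.ofSubsingleton ℝ G ℝ (0 : Fin 1)).symm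
          ((S.Ω x).curryLeft (stdVec i))
      have h1 : ∀ z : G, (S.Ω x ![stdVec i, z]) = L z := fun z =>
        congrArg (S.Ω x) (by ext j : 1; fin_cases j <;> rfl)
      have h2 : w = ∑ i, w i • stdVec i := by
        ext j; simp [stdVec, Finset.sum_apply, Pi.single_apply]
      simp only [h1]
      conv_lhs => rw [h2]
      simp
    rw [hu]
    simp only [hw, dotProduct, Matrix.mulVec, metricMatrix, Matrix.of_apply]
    exact Finset.sum_congr rfl fun i _ => by
      congr 1; exact Finset.sum_congr rfl fun j _ => mul_comm _ _
  rw [key v v, h0] at hpos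
  simp at hpos

theorem contDiff_inv_metricMatrix (i : Fin 4) :
    ContDiff ℝ ∞ (fun x => (metricMatrix (S.J x) (S.Ω x))⁻¹ i) := by
  have hdet : ∀ M : G → Matrix (Fin 4) (Fin 4) ℝ, (∀ i j, ContDiff ℝ ∞ fun x => M x i j) →
      ContDiff ℝ ∞ fun x => (M x).det := by
    intro M hM
    simp only [Matrix.det_apply]
    exact ContDiff.sum fun σ _ => ContDiff.const_smul _ (contDiff_prod fun i _ => hM _ _)
  rw [contDiff_pi]
  intro j
  simp only [Matrix.inv_def, Ring.inverse_eq_inv', Matrix.smul_apply, smul_eq_mul]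
  refine ((hdet _ S.contDiff_metricMatrix).inv S.det_metricMatrix_ne_zero).mul ?_
  simp only [Matrix.adjugate_apply]
  refine hdet _ fun a b => ?_
  by_cases hab : a = j
  · subst hab
    simpa using contDiff_const
  · simpa [Matrix.updateRow_ne hab] using S.contDiff_metricMatrix a b

theorem contDiff_volumeForm : ContDiff ℝ ∞ (fun x => volumeForm (S.Ω x)) := by
  have h := fun v => contDiff_eval S.Ω_form.1 v
  unfold volumeForm pfaffian
  exact ((((h _).mul (h _)).sub ((h _).mul (h _))).add ((h _).mul (h _))).smul contDiff_const

theorem contDiff_star2 {α : Form 2 A} (h : ContDiff ℝ ∞ α) : ContDiff ℝ ∞ (S.star2 α) := by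
  unfold star2 star₂ hodgeStar
  exact ContDiff.const_smul _ (ContDiff.sum fun a _ => contDiff_smulRight
    (contDiff_contract (m := 2) (k := 2) S.contDiff_volumeForm
      fun i => S.contDiff_inv_metricMatrix _) (contDiff_eval h _))

theorem contDiff_star3 {α : Form 3 A} (h : ContDiff ℝ ∞ α) : ContDiff ℝ ∞ (S.star3 α) := by
  unfold star3 star₃ hodgeStar
  exact ContDiff.const_smul _ (ContDiff.sum fun a _ => contDiff_smulRight
    (contDiff_contract (m := 1) (k := 3) S.contDiff_volumeForm
      fun i => S.contDiff_inv_metricMatrix _) (contDiff_eval h _))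

theorem star2_add (α β : Form 2 A) : S.star2 (α + β) = S.star2 α + S.star2 β :=
  funext fun _ => hodgeStar_add _ _ _ _

theorem star2_smul (c : A) (α : Form 2 A) : S.star2 (c • α) = c • S.star2 α :=
  funext fun _ => hodgeStar_smul _ _ _ _

theorem star3_add (α β : Form 3 A) : S.star3 (α + β) = S.star3 α + S.star3 β :=
  funext fun _ => hodgeStar_add _ _ _ _

theorem star3_smul (c : A) (α : Form 3 A) : S.star3 (c • α) = c • S.star3 α :=
  funext fun _ => hodgeStar_smul _ _ _ _

theorem dbarLaplacian11_add {α β : Form 2 ℂ} (hα : ContDiff ℝ ∞ α) (hβ : ContDiff ℝ ∞ β) :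
    S.dbarLaplacian11 (α + β) = S.dbarLaplacian11 α + S.dbarLaplacian11 β := by
  have sα := S.contDiff_star2 hα
  have sβ := S.contDiff_star2 hβ
  have tα := S.contDiff_star3 (contDiff_del S.J_smooth sα 1)
  have tβ := S.contDiff_star3 (contDiff_del S.J_smooth sβ 1)
  have uα := S.contDiff_star3 (contDiff_dbar S.J_smooth hα 1)
  have uβ := S.contDiff_star3 (contDiff_dbar S.J_smooth hβ 1)
  simp only [dbarLaplacian11, dbarStar11, dbarStar12]
  rw [S.star2_add, del_add _ _ sα sβ, S.star3_add, neg_add, dbar_add _ _ (contDiff_neg tα) (contDiff_neg tβ),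
    dbar_add _ _ hα hβ, S.star3_add, del_add _ _ uα uβ, S.star2_add]
  abel

theorem dbarLaplacian11_smul {α : Form 2 ℂ} (hα : ContDiff ℝ ∞ α) (c : ℂ) :
    S.dbarLaplacian11 (c • α) = c • S.dbarLaplacian11 α := by
  have sα := S.contDiff_star2 hα
  have tα := S.contDiff_star3 (contDiff_del S.J_smooth sα 1)
  have uα := S.contDiff_star3 (contDiff_dbar S.J_smooth hα 1)
  simp only [dbarLaplacian11, dbarStar11, dbarStar12]
  rw [S.star2_smul, del_smul _ _ sα, S.star3_smul, neg_smul_form, dbar_smul _ _ (contDiff_neg tα),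
    dbar_smul _ _ hα, S.star3_smul, del_smul _ _ uα, S.star2_smul, neg_smul_form, smul_add]

theorem hodgeLaplacian2_add {α β : Form 2 ℝ} (hα : ContDiff ℝ ∞ α) (hβ : ContDiff ℝ ∞ β) :
    S.hodgeLaplacian2 (α + β) = S.hodgeLaplacian2 α + S.hodgeLaplacian2 β := by
  have sα := S.contDiff_star2 hα
  have sβ := S.contDiff_star2 hβ
  have tα := S.contDiff_star3 (contDiff_extDeriv sα)
  have tβ := S.contDiff_star3 (contDiff_extDeriv sβ)
  have uα := S.contDiff_star3 (contDiff_extDeriv hα)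
  have uβ := S.contDiff_star3 (contDiff_extDeriv hβ)
  simp only [hodgeLaplacian2]
  rw [S.star2_add, extDeriv_add' sα sβ, S.star3_add, neg_add, extDeriv_add' (contDiff_neg tα) (contDiff_neg tβ),
    extDeriv_add' hα hβ, S.star3_add, extDeriv_add' uα uβ, S.star2_add]
  abel

theorem hodgeLaplacian2_smul {α : Form 2 ℝ} (hα : ContDiff ℝ ∞ α) (c : ℝ) :
    S.hodgeLaplacian2 (c • α) = c • S.hodgeLaplacian2 α := by
  have sα := S.contDiff_star2 hα
  have tα := S.contDiff_star3 (contDiff_extDeriv sα)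
  have uα := S.contDiff_star3 (contDiff_extDeriv hα)
  simp only [hodgeLaplacian2]
  rw [S.star2_smul, extDeriv_smul' sα, S.star3_smul, neg_smul_form, extDeriv_smul' (contDiff_neg tα),
    extDeriv_smul' hα, S.star3_smul, extDeriv_smul' uα, S.star2_smul, neg_smul_form, smul_add]

/-- The space of `∂̄`-harmonic `(1, 1)`-forms on `X`. -/
def harmonic11 : Submodule ℂ (Form 2 ℂ) where
  carrier := {ψ | IsFormOnX ψ ∧ (∀ x, HasType (S.J x) 1 (ψ x)) ∧ S.dbarLaplacian11 ψ = 0}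
  zero_mem' := by
    refine ⟨⟨contDiff_const, fun _ _ _ => rfl⟩, fun x => by simp [HasType], ?_⟩
    simpa using S.dbarLaplacian11_smul (α := 0) contDiff_const 0
  add_mem' := by
    rintro α β ⟨⟨hα, iα⟩, tα, lα⟩ ⟨⟨hβ, iβ⟩, tβ, lβ⟩
    refine ⟨⟨hα.add hβ, fun a ha x => ?_⟩, fun x => ?_, ?_⟩
    · rw [Pi.add_apply, Pi.add_apply, ← iα a ha x, ← iβ a ha x]; rfl
    · have h1 := tα x
      have h2 := tβ x
      simp only [HasType] at h1 h2 ⊢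
      rw [Pi.add_apply, map_add, h1, h2, smul_add]
    · rw [S.dbarLaplacian11_add hα hβ, lα, lβ, add_zero]
  smul_mem' := by
    rintro c α ⟨⟨hα, iα⟩, tα, lα⟩
    refine ⟨⟨hα.const_smul c, fun a ha x => ?_⟩, fun x => ?_, ?_⟩
    · rw [Pi.smul_apply, Pi.smul_apply, ← iα a ha x]; rfl
    · have h1 := tα x
      simp only [HasType] at h1 ⊢
      rw [Pi.smul_apply, map_smul, h1, smul_comm]
    · rw [S.dbarLaplacian11_smul hα, lα, smul_zero]

/-- The Hodge number `h^{1,1}_{∂̄}`. -/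
def h11 : ℕ := Module.finrank ℂ S.harmonic11

/-- The space of real anti-self-dual harmonic `2`-forms on `X`. -/
def antiSelfDualHarmonic : Submodule ℝ (Form 2 ℝ) where
  carrier := {γ | IsFormOnX γ ∧ S.star2 γ = -γ ∧ S.hodgeLaplacian2 γ = 0}
  zero_mem' := by
    refine ⟨⟨contDiff_const, fun _ _ _ => rfl⟩, ?_, ?_⟩
    · simpa using S.star2_smul (0 : ℝ) 0
    · simpa using S.hodgeLaplacian2_smul (α := 0) contDiff_const 0
  add_mem' := by
    rintro α β ⟨⟨hα, iα⟩, tα, lα⟩ ⟨⟨hβ, iβ⟩, tβ, lβ⟩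
    refine ⟨⟨hα.add hβ, fun a ha x => ?_⟩, ?_, ?_⟩
    · rw [Pi.add_apply, Pi.add_apply, ← iα a ha x, ← iβ a ha x]; rfl
    · rw [S.star2_add, tα, tβ, neg_add]
    · rw [S.hodgeLaplacian2_add hα hβ, lα, lβ, add_zero]
  smul_mem' := by
    rintro c α ⟨⟨hα, iα⟩, tα, lα⟩
    refine ⟨⟨hα.const_smul c, fun a ha x => ?_⟩, ?_, ?_⟩
    · rw [Pi.smul_apply, Pi.smul_apply, ← iα a ha x]; rfl
    · rw [S.star2_smul, tα, smul_neg]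
    · rw [S.hodgeLaplacian2_smul hα, lα, smul_zero]

/-- `b₋`, the dimension of the space of anti-self-dual harmonic `2`-forms. -/
def bMinus : ℕ := Module.finrank ℝ S.antiSelfDualHarmonic

end AlmostHermitian

/-! ### The invariant coframe, the almost-complex structure and the metrics -/

/-- The coordinate covector `dx^{i+1}`. -/
def dx (i : Fin 4) : G →L[ℝ] ℝ := ContinuousLinearMap.proj i

/-- `e¹ = dx₁`. -/
def e₁ (_ : G) : G →L[ℝ] ℝ := dx 0

/-- `e² = dx₂`. -/
def e₂ (_ : G) : G →L[ℝ] ℝ := dx 1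

/-- `e³ = dx₃ - x₁ dx₂`. -/
def e₃ (x : G) : G →L[ℝ] ℝ := dx 2 - x 0 • dx 1

/-- `e⁴ = dx₄`. -/
def e₄ (_ : G) : G →L[ℝ] ℝ := dx 3

/-- The dual frame: the vector field `∂₁`. -/
def E₁ (_ : G) : G := stdVec 0

/-- The dual frame: the vector field `∂₂ + x₁ ∂₃`. -/
def E₂ (x : G) : G := stdVec 1 + x 0 • stdVec 2

/-- The dual frame: the vector field `∂₃`. -/
def E₃ (_ : G) : G := stdVec 2

/-- The dual frame: the vector field `∂₄`. -/
def E₄ (_ : G) : G := stdVec 3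

/-- The almost-complex structure with `J E₁ = E₃`, `J E₃ = -E₁`, `J E₂ = E₄`, `J E₄ = -E₂`. -/
def ktJ (x : G) : G →L[ℝ] G :=
  (e₁ x).smulRight (E₃ x) - (e₃ x).smulRight (E₁ x)
    + (e₂ x).smulRight (E₄ x) - (e₄ x).smulRight (E₂ x)

/-- The complex `1`-form `φ¹ = e¹ + i e³`. -/
def φ₁ (x : G) : G →L[ℝ] ℂ :=
  Complex.ofRealCLM ∘L e₁ x + Complex.I • (Complex.ofRealCLM ∘L e₃ x)

/-- The complex `1`-form `φ² = e² + i e⁴`. -/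
def φ₂ (x : G) : G →L[ℝ] ℂ :=
  Complex.ofRealCLM ∘L e₂ x + Complex.I • (Complex.ofRealCLM ∘L e₄ x)

/-- The complex conjugate of a complex covector. -/
def conj (θ : G →L[ℝ] ℂ) : G →L[ℝ] ℂ := (Complex.conjCLE : ℂ →L[ℝ] ℂ) ∘L θ

/-- A field of complex covectors, seen as a differential `1`-form. -/
def oneForm (θ : G → G →L[ℝ] ℂ) : Form 1 ℂ :=
  fun x => ContinuousAlternatingMap.ofSubsingleton ℝ G ℂ (0 : Fin 1) (θ x)

/-- The `2`-form `e^{2 t f(x₂)} e¹ ∧ e³ + e² ∧ e⁴`. -/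
def ktΩ (f : ℝ → ℝ) (t : ℝ) : Form 2 ℝ := fun x =>
  Real.exp (2 * t * f (x 1)) • wedge₁₁ (e₁ x) (e₃ x) + wedge₁₁ (e₂ x) (e₄ x)

theorem wedge₁₁_apply {A : Type} [RCLike A] (θ η : G →L[ℝ] A) (v : Fin 2 → G) :
    wedge₁₁ θ η v = θ (v 0) * η (v 1) - θ (v 1) * η (v 0) := by
  simp only [wedge₁₁, wedge, ContinuousAlternatingMap.alternatizeUncurryFin_apply]
  simp [Fin.removeNth, sub_eq_add_neg]

theorem ktJ_apply (x v : G) : ktJ x v =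
    ![-(v 2 - x 0 * v 1), -v 3, v 0 - x 0 * v 3, v 1] := by
  ext i
  fin_cases i <;>
    simp [ktJ, e₁, e₂, e₃, e₄, E₁, E₂, E₃, E₄, dx, stdVec]
  ring

theorem ktΩ_apply (f : ℝ → ℝ) (t : ℝ) (x : G) (v : Fin 2 → G) : ktΩ f t x v =
    Real.exp (2 * t * f (x 1)) * (v 0 0 * (v 1 2 - x 0 * v 1 1) - v 1 0 * (v 0 2 - x 0 * v 0 1))
      + (v 0 1 * v 1 3 - v 1 1 * v 0 3) := by
  simp [ktΩ, wedge₁₁_apply, e₁, e₂, e₃, e₄, dx]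

theorem fderiv_mul (a x v : G) : fderiv ℝ (mul a) x v = ![v 0, v 1, v 2 + a 0 * v 1, v 3] := by
  have h : HasFDerivAt (mul a)
      (ContinuousLinearMap.pi ![dx 0, dx 1, dx 2 + a 0 • dx 1, dx 3]) x := by
    rw [hasFDerivAt_pi']
    intro i
    have hp : ∀ j : Fin 4, HasFDerivAt (fun y : G => y j) (dx j) x := fun j =>
      (ContinuousLinearMap.proj (R := ℝ) (φ := fun _ : Fin 4 => ℝ) j).hasFDerivAt
    fin_cases i
    · exact (hp 0).const_add _
    · exact (hp 1).const_add _
    · exact ((hp 2).const_add _).add ((hp 1).const_mul _)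
    · exact (hp 3).const_add _
  rw [h.fderiv]
  ext i
  fin_cases i <;> simp [dx]

theorem contDiff_coord (i : Fin 4) : ContDiff ℝ ∞ (fun x : G => x i) := contDiff_apply ℝ ℝ i

theorem contDiff_wedge₁₁ {θ η : G → G →L[ℝ] ℝ} (hθ : ContDiff ℝ ∞ θ) (hη : ContDiff ℝ ∞ η) :
    ContDiff ℝ ∞ (fun x => wedge₁₁ (θ x) (η x)) :=
  contDiff_alternatize (hθ.smulRight
    ((ContinuousAlternatingMap.ofSubsingletonLIE (𝕜 := ℝ) (E := G) (F := ℝ) (0 : Fin 1)).contDiff.comp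
      hη))

theorem contDiff_e₃ : ContDiff ℝ ∞ e₃ :=
  contDiff_const.sub ((contDiff_coord 0).smul contDiff_const)

theorem contDiff_ktJ : ContDiff ℝ ∞ ktJ := by
  have h3 := contDiff_e₃
  have h2 : ContDiff ℝ ∞ E₂ := contDiff_const.add ((contDiff_coord 0).smul contDiff_const)
  exact (((contDiff_const.smulRight contDiff_const).sub (h3.smulRight contDiff_const)).add
    (contDiff_const.smulRight contDiff_const)).sub (contDiff_const.smulRight h2)

theorem invariant_ktJ (T : Set G) : InvariantEndo T ktJ := by
  intro a _ x
  ext v i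
  simp only [ContinuousLinearMap.comp_apply, fderiv_mul, ktJ_apply]
  fin_cases i <;> simp [mul] <;> ring

/-- The almost-Hermitian structure `(J, ω_{tf})` on the Kodaira–Thurston manifold, for a smooth
function `f` of period one. -/
def ktStructure (f : ℝ → ℝ) (hf : ContDiff ℝ ∞ f) (hper : ∀ s, f (s + 1) = f s) (t : ℝ) :
    AlmostHermitian where
  J := ktJ
  J_smooth := contDiff_ktJ
  J_sq x v := by
    rw [ktJ_apply, ktJ_apply]
    ext i; fin_cases i <;> simp
  J_inv := invariant_ktJ lattice
  Ω := ktΩ f t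
  Ω_form := by
    refine ⟨?_, ?_⟩
    · have h1 : ContDiff ℝ ∞ (fun x : G => Real.exp (2 * t * f (x 1))) :=
        (contDiff_const.mul (hf.comp (contDiff_coord 1))).exp
      have h2 : ContDiff ℝ ∞ (fun x => wedge₁₁ (e₁ x) (e₃ x)) :=
        contDiff_wedge₁₁ contDiff_const contDiff_e₃
      have h3 : ContDiff ℝ ∞ (fun x => wedge₁₁ (e₂ x) (e₄ x)) :=
        contDiff_wedge₁₁ contDiff_const contDiff_const
      exact (h1.smul h2).add h3
    · intro a ha x
      obtain ⟨n, hn⟩ := ha 1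
      have hfn : f (a 1 + x 1) = f (x 1) := by
        have hP : Function.Periodic f 1 := hper
        rw [hn, add_comm]
        simpa using hP.int_mul n (x 1)
      ext v
      simp only [ContinuousAlternatingMap.compContinuousLinearMap_apply, ktΩ_apply,
        Function.comp_apply, fderiv_mul]
      simp [mul, hfn]
      ring
  Ω_compat x u v := by
    simp only [ktΩ_apply, ktJ_apply]
    simp
    ring
  Ω_pos x u hu := by
    simp only [ktΩ_apply, ktJ_apply]
    simp
    have hE := Real.exp_pos (2 * t * f (x 1))
    set E := Real.exp (2 * t * f (x 1))
    have key : 0 < E * ((u 0) ^ 2 + (u 2 - x 0 * u 1) ^ 2) + ((u 1) ^ 2 + (u 3) ^ 2) := by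
      by_contra hcon
      apply hu
      have a0 : 0 ≤ (u 0) ^ 2 + (u 2 - x 0 * u 1) ^ 2 := by positivity
      have a1 : 0 ≤ E * ((u 0) ^ 2 + (u 2 - x 0 * u 1) ^ 2) := by positivity
      have b1 : (u 1) ^ 2 + (u 3) ^ 2 = 0 := by nlinarith [sq_nonneg (u 1), sq_nonneg (u 3)]
      have c1 : E * ((u 0) ^ 2 + (u 2 - x 0 * u 1) ^ 2) = 0 := by
        nlinarith [sq_nonneg (u 1), sq_nonneg (u 3)]
      have d1 : (u 0) ^ 2 + (u 2 - x 0 * u 1) ^ 2 = 0 := by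
        rcases mul_eq_zero.1 c1 with h | h
        · exact absurd h hE.ne'
        · exact h
      have u1 : u 1 = 0 := by nlinarith [sq_nonneg (u 1), sq_nonneg (u 3)]
      have u3 : u 3 = 0 := by nlinarith [sq_nonneg (u 1), sq_nonneg (u 3)]
      have u0 : u 0 = 0 := by nlinarith [sq_nonneg (u 0), sq_nonneg (u 2 - x 0 * u 1)]
      have u2 : u 2 = 0 := by
        have : u 2 - x 0 * u 1 = 0 := by
          nlinarith [sq_nonneg (u 0), sq_nonneg (u 2 - x 0 * u 1)]
        simpa [u1] using this
      ext i; fin_cases i <;> simp [u0, u1, u2, u3]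
    nlinarith [key]

end KodairaThurston

end

open KodairaThurston

/-!
# `∂̄`-harmonic `(1, 1)`-forms on the Kodaira–Thurston manifold

Forms on `X` are expanded in the left-invariant frame `E₁, …, E₄`, so that they become tuples of
smooth functions on `X`. Three facts turn every question into algebra with such functions: the only
bracket of the frame is `[E₁, E₂] = E₃`, which gives the exterior derivative (`extDeriv_one`,
`extDeriv_two`); the fields of the frame are divergence-free (`SmoothFun.integral_lieD`), which
gives Stokes' theorem (`integral_dOne_wedge`); and for the metric `ω_{tf}` the frame is orthogonal,
with lengths `1` and `e^{tf(x₂)}` (`star₂_frame`, `star₃_frame`). Below, `F = e^{-2tf(x₂)}`, which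
is constant along `E₁, E₃, E₄`.

*Anti-self-dual harmonic forms.* If `γ` is anti-self-dual and `Δγ = 0`, then pairing with `γ` gives
`dγ = 0` (`hodge_energy`). Write `γ = a (e¹³ - F e²⁴) + b (e¹⁴ + e²³) + c (e¹² + e³⁴)`. The equation
`dγ = 0` is a first-order system for `a, b, c`. Integrals of Jacobians such as
`E₃ u E₄ v - E₄ u E₃ v` vanish, and combining them with the system makes the weighted `L²`-norms of
the derivatives along `E₃`, then along `E₄`, vanish; the system then says that `c` is constant and a
divergence, so `c = 0`, and a last Jacobian gives that `a` and `b` are constant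
(`closed_antiSelfDual`). So the space is spanned by `e¹³ - F e²⁴` and `e¹⁴ + e²³`, and `b₋ = 2`.

*`∂̄`-harmonic forms.* If `ψ` is a `(1, 1)`-form in the kernel of `Δ_{∂̄}`, then pairing with `ψ`
gives `∂̄ψ = 0` and `∂⋆ψ = 0` (`dbar_energy`). Up to a factor `2`, `ψ = u (e¹³ + F e²⁴) + γ` for a
function `u` and an anti-self-dual form `γ`. The form `e¹³ + F e²⁴ = F ω_{tf}` is closed and
self-dual, so the two equations combine into an expression of `dγ` by the derivatives of `u`, and
`ddγ = 0` becomes an elliptic equation for `u` without term of order zero. So `u` is constant,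
`dγ = 0`, and the previous step applies to `γ` (`dbar_coclosed`). Hence the space is spanned by
`e¹³`, `e¹⁴ + e²³` and `F e²⁴`, which are multiples of the forms `φ^{1\bar 1}`,
`φ^{1\bar 2} + φ^{2\bar 1}` and `F φ^{2\bar 2}`; conversely these forms and their Hodge duals are
closed.
-/

namespace KodairaThurston

/-! ### The left-invariant frame -/

/-- The global left-invariant frame `E₁, E₂, E₃, E₄`, indexed from `0`. -/
def frame (i : Fin 4) : G → G := ![E₁, E₂, E₃, E₄] i

theorem frame_zero (x : G) : frame 0 x = ![1, 0, 0, 0] := by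
  ext i; fin_cases i <;> simp [frame, E₁, stdVec]

theorem frame_one (x : G) : frame 1 x = ![0, 1, x 0, 0] := by
  ext i; fin_cases i <;> simp [frame, E₂, stdVec]

theorem frame_two (x : G) : frame 2 x = ![0, 0, 1, 0] := by
  ext i; fin_cases i <;> simp [frame, E₃, stdVec]

theorem frame_three (x : G) : frame 3 x = ![0, 0, 0, 1] := by
  ext i; fin_cases i <;> simp [frame, E₄, stdVec]

theorem fderiv_mul_frame (a x : G) (i : Fin 4) :
    fderiv ℝ (mul a) x (frame i x) = frame i (mul a x) := by
  rw [fderiv_mul]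
  fin_cases i <;> ext j <;> fin_cases j <;>
    simp [frame_zero, frame_one, frame_two, frame_three, mul, add_comm]

theorem contDiff_frame (i : Fin 4) : ContDiff ℝ ∞ (frame i) := by
  fin_cases i
  · exact contDiff_const
  · exact contDiff_const.add ((contDiff_coord 0).smul contDiff_const)
  · exact contDiff_const
  · exact contDiff_const

theorem contDiff_mul (a : G) : ContDiff ℝ ∞ (mul a) := by
  rw [contDiff_pi]
  have h := contDiff_coord
  intro i
  fin_cases i
  · exact contDiff_const.add (h 0)
  · exact contDiff_const.add (h 1)
  · exact (contDiff_const.add (h 2)).add (contDiff_const.mul (h 1))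
  · exact contDiff_const.add (h 3)

/-- The structure constants of the frame: `[Eᵢ, Eⱼ] = brk i j • E₃`. -/
def brk (i j : Fin 4) : ℤ :=
  if i = 0 ∧ j = 1 then 1 else if i = 1 ∧ j = 0 then -1 else 0

theorem fderiv_frame (i : Fin 4) (x v : G) :
    fderiv ℝ (frame i) x v = if i = 1 then v 0 • stdVec 2 else 0 := by
  by_cases h : i = 1
  · subst h
    have h0 : HasFDerivAt (fun y : G => y 0) (dx 0) x :=
      (ContinuousLinearMap.proj (R := ℝ) (φ := fun _ : Fin 4 => ℝ) 0).hasFDerivAt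
    have : HasFDerivAt (frame 1) ((dx 0).smulRight (stdVec 2)) x :=
      (h0.smul_const (stdVec 2)).const_add _
    rw [this.fderiv]
    simp [dx]
  · have : frame i = fun _ => frame i 0 := by
      fin_cases i
      · rfl
      · simp at h
      · rfl
      · rfl
    rw [this, if_neg h]
    simp

theorem lieBracket_frame (i j : Fin 4) (x : G) :
    VectorField.lieBracket ℝ (frame i) (frame j) x = (brk i j : ℝ) • frame 2 x := by
  rw [VectorField.lieBracket, fderiv_frame, fderiv_frame]
  fin_cases i <;> fin_cases j <;>
    simp [brk, frame_zero, frame_one, frame_two, frame_three] <;>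
    (ext k; fin_cases k <;> simp [stdVec])

/-! ### Smooth functions on the manifold -/

section Functions

variable (𝕜 : Type) [RCLike 𝕜]

/-- The algebra of smooth functions on `X`, seen as smooth functions on `G` that are invariant
under the lattice. -/
def smoothFun : Subalgebra 𝕜 (G → 𝕜) where
  carrier := {u | ContDiff ℝ ∞ u ∧ ∀ a ∈ lattice, ∀ x, u (mul a x) = u x}
  mul_mem' := fun hu hv => ⟨hu.1.mul hv.1, fun a ha x => by simp [hu.2 a ha, hv.2 a ha]⟩
  add_mem' := fun hu hv => ⟨hu.1.add hv.1, fun a ha x => by simp [hu.2 a ha, hv.2 a ha]⟩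
  algebraMap_mem' := fun _ => ⟨contDiff_const, fun _ _ _ => rfl⟩

/-- The type of smooth functions on `X` with values in `𝕜`. -/
abbrev SmoothFun : Type := smoothFun 𝕜

variable {𝕜}

namespace SmoothFun

theorem contDiff (u : SmoothFun 𝕜) : ContDiff ℝ ∞ (u : G → 𝕜) := u.2.1

theorem differentiable (u : SmoothFun 𝕜) : Differentiable ℝ (u : G → 𝕜) :=
  u.contDiff.differentiable (by simp)

theorem invariant (u : SmoothFun 𝕜) {a : G} (ha : a ∈ lattice) (x : G) :
    (u : G → 𝕜) (mul a x) = (u : G → 𝕜) x := u.2.2 a ha x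

theorem ext {u v : SmoothFun 𝕜} (h : ∀ x, (u : G → 𝕜) x = (v : G → 𝕜) x) : u = v :=
  Subtype.ext (funext h)

/-- The derivative of a function along a vector field of the frame; it descends to `X` because the
frame is left-invariant. -/
noncomputable def lieD (i : Fin 4) (u : SmoothFun 𝕜) : SmoothFun 𝕜 :=
  ⟨fun x => fderiv ℝ (u : G → 𝕜) x (frame i x),
    (u.contDiff.fderiv_right (m := ∞) (by simp)).clm_apply (contDiff_frame i), by
      intro a ha x
      have h : (u : G → 𝕜) ∘ mul a = u := funext fun y => u.invariant ha y
      have h2 := fderiv_comp x (u.differentiable (mul a x))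
        ((contDiff_mul a).differentiable (by simp) x)
      rw [h] at h2
      change fderiv ℝ (u : G → 𝕜) (mul a x) (frame i (mul a x)) =
        fderiv ℝ (u : G → 𝕜) x (frame i x)
      rw [h2, ContinuousLinearMap.comp_apply, fderiv_mul_frame]⟩

theorem lieD_apply (i : Fin 4) (u : SmoothFun 𝕜) (x : G) :
    (lieD i u : G → 𝕜) x = fderiv ℝ (u : G → 𝕜) x (frame i x) := rfl

@[simp] theorem lieD_add (i : Fin 4) (u v : SmoothFun 𝕜) :
    lieD i (u + v) = lieD i u + lieD i v := ext fun x => by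
  simp [lieD_apply, fderiv_add (u.differentiable x) (v.differentiable x)]

@[simp] theorem lieD_mul (i : Fin 4) (u v : SmoothFun 𝕜) :
    lieD i (u * v) = u * lieD i v + v * lieD i u := ext fun x => by
  have h := (u.differentiable x).hasFDerivAt.mul (v.differentiable x).hasFDerivAt
  change fderiv ℝ ((u : G → 𝕜) * (v : G → 𝕜)) x (frame i x) = _
  rw [h.fderiv]
  simp [lieD_apply]

@[simp] theorem lieD_algebraMap (i : Fin 4) (c : 𝕜) :
    lieD i (algebraMap 𝕜 (SmoothFun 𝕜) c) = 0 := ext fun x => by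
  change fderiv ℝ (fun _ : G => c) x (frame i x) = 0
  simp

@[simp] theorem lieD_neg (i : Fin 4) (u : SmoothFun 𝕜) : lieD i (-u) = -lieD i u :=
  ext fun x => by simp [lieD_apply, fderiv_neg]

@[simp] theorem lieD_sub (i : Fin 4) (u v : SmoothFun 𝕜) :
    lieD i (u - v) = lieD i u - lieD i v := by simp [sub_eq_add_neg]

@[simp] theorem lieD_smul_one (i : Fin 4) (c : 𝕜) : lieD i (c • 1 : SmoothFun 𝕜) = 0 := by
  rw [← Algebra.algebraMap_eq_smul_one, lieD_algebraMap]

@[simp] theorem lieD_one (i : Fin 4) : lieD i (1 : SmoothFun 𝕜) = 0 := by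
  simpa using lieD_algebraMap i (1 : 𝕜)

@[simp] theorem lieD_zero (i : Fin 4) : lieD i (0 : SmoothFun 𝕜) = 0 := by
  simpa using lieD_algebraMap i (0 : 𝕜)

/-- The commutators of the frame, acting on functions. -/
theorem lieD_comm (i j : Fin 4) (u : SmoothFun 𝕜) :
    lieD i (lieD j u) = lieD j (lieD i u) + brk i j • lieD 2 u := by
  refine ext fun x => ?_
  have hd : ∀ k l : Fin 4, (lieD k (lieD l u) : G → 𝕜) x =
      fderiv ℝ (fderiv ℝ (u : G → 𝕜)) x (frame k x) (frame l x) +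
        fderiv ℝ (u : G → 𝕜) x (fderiv ℝ (frame l) x (frame k x)) := by
    intro k l
    rw [lieD_apply]
    change fderiv ℝ (fun y => fderiv ℝ (u : G → 𝕜) y (frame l y)) x (frame k x) = _
    rw [fderiv_clm_apply ((u.contDiff.fderiv_right (m := ∞) (by simp)).differentiable (by simp) x)
      ((contDiff_frame l).differentiable (by simp) x)]
    simp [add_comm]
  have hs : IsSymmSndFDerivAt ℝ (u : G → 𝕜) x :=
    u.contDiff.contDiffAt.isSymmSndFDerivAt (by
      simpa using WithTop.coe_le_coe.2 (le_top : (2 : ℕ∞) ≤ ⊤))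
  have hb := lieBracket_frame i j x
  rw [VectorField.lieBracket] at hb
  rw [zsmul_eq_mul]
  simp only [AddMemClass.coe_add, MulMemClass.coe_mul, Pi.add_apply, Pi.mul_apply, hd,
    hs (frame i x) (frame j x)]
  rw [sub_eq_iff_eq_add.1 hb, map_add, map_smul, RCLike.real_smul_eq_coe_mul]
  have hc : ((brk i j : SmoothFun 𝕜) : G → 𝕜) x = (brk i j : 𝕜) := by simp
  rw [hc, lieD_apply]
  push_cast
  ring

/-- Pointwise complex conjugation of functions. -/
noncomputable def conjFun : SmoothFun 𝕜 →+* SmoothFun 𝕜 where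
  toFun u := ⟨fun x => starRingEnd 𝕜 ((u : G → 𝕜) x),
    (RCLike.conjCLE (K := 𝕜)).contDiff.comp u.contDiff,
    fun a ha x => congrArg _ (u.invariant ha x)⟩
  map_one' := ext fun x => by simp
  map_mul' u v := ext fun x => by simp
  map_zero' := ext fun x => by simp
  map_add' u v := ext fun x => by simp

theorem conjFun_apply (u : SmoothFun 𝕜) (x : G) :
    (conjFun u : G → 𝕜) x = starRingEnd 𝕜 ((u : G → 𝕜) x) := rfl

@[simp] theorem lieD_conjFun (i : Fin 4) (u : SmoothFun 𝕜) :
    lieD i (conjFun u) = conjFun (lieD i u) := by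
  refine ext fun x => ?_
  rw [conjFun_apply, lieD_apply, lieD_apply]
  have h : HasFDerivAt (conjFun u : G → 𝕜)
      ((RCLike.conjCLE (K := 𝕜) : 𝕜 →L[ℝ] 𝕜) ∘L fderiv ℝ (u : G → 𝕜) x) x :=
    (RCLike.conjCLE (K := 𝕜) : 𝕜 →L[ℝ] 𝕜).hasFDerivAt.comp x (u.differentiable x).hasFDerivAt
  rw [h.fderiv]
  rfl

/-! ### Integration over the manifold -/

/-- The integral over `X`, computed on the unit cube, which is a fundamental domain of the
lattice. The Lebesgue measure of the coordinates is the bi-invariant measure of the group. -/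
noncomputable def integral (u : SmoothFun 𝕜) : 𝕜 := ∫ x in Set.Icc (0 : G) 1, (u : G → 𝕜) x

theorem integrableOn (u : SmoothFun 𝕜) :
    MeasureTheory.IntegrableOn (u : G → 𝕜) (Set.Icc (0 : G) 1) :=
  u.contDiff.continuous.continuousOn.integrableOn_compact isCompact_Icc

theorem integral_add (u v : SmoothFun 𝕜) : integral (u + v) = integral u + integral v :=
  MeasureTheory.integral_add u.integrableOn v.integrableOn

theorem integral_smul (c : 𝕜) (u : SmoothFun 𝕜) : integral (c • u) = c * integral u :=
  MeasureTheory.integral_const_mul c _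

@[simp] theorem integral_zero : integral (0 : SmoothFun 𝕜) = 0 :=
  MeasureTheory.integral_zero _ _

theorem integral_neg (u : SmoothFun 𝕜) : integral (-u) = -integral u :=
  MeasureTheory.integral_neg _

theorem integral_sub (u v : SmoothFun 𝕜) : integral (u - v) = integral u - integral v :=
  MeasureTheory.integral_sub u.integrableOn v.integrableOn

/-- A function with non-negative real part and vanishing integral has vanishing real part. -/
theorem re_eq_zero_of_integral_eq_zero (u : SmoothFun 𝕜)
    (h0 : ∀ x, 0 ≤ RCLike.re ((u : G → 𝕜) x)) (h : integral u = 0) (x : G) :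
    RCLike.re ((u : G → 𝕜) x) = 0 := by
  have hc : Continuous fun x => RCLike.re ((u : G → 𝕜) x) :=
    RCLike.continuous_re.comp u.contDiff.continuous
  have hI : ∫ x in Set.Icc (0 : G) 1, RCLike.re ((u : G → 𝕜) x) = 0 := by
    rw [integral_re u.integrableOn]
    change RCLike.re (integral u) = 0
    rw [h, map_zero]
  have hae := (MeasureTheory.integral_eq_zero_iff_of_nonneg (fun x => h0 x)
    (hc.continuousOn.integrableOn_compact isCompact_Icc)).1 hI
  have hon := MeasureTheory.Measure.eqOn_of_ae_eq hae hc.continuousOn continuousOn_const (by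
    rw [← Set.pi_univ_Icc, interior_pi_set Set.finite_univ]
    simp [closure_pi_set])
  -- Move `x` into the unit cube by an element of the lattice.
  let a : G := ![-⌊x 0⌋, -⌊x 1⌋, -⌊x 2 - ⌊x 0⌋ * x 1⌋, -⌊x 3⌋]
  have ha : a ∈ lattice := by
    intro i
    fin_cases i
    · exact ⟨-⌊x 0⌋, by simp [a]⟩
    · exact ⟨-⌊x 1⌋, by simp [a]⟩
    · exact ⟨-⌊x 2 - ⌊x 0⌋ * x 1⌋, by simp [a]⟩
    · exact ⟨-⌊x 3⌋, by simp [a]⟩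
  rw [← u.invariant ha x]
  have hf := fun r : ℝ => (Int.fract_nonneg r)
  have hf1 := fun r : ℝ => (Int.fract_lt_one r).le
  have hm : mul a x = ![Int.fract (x 0), Int.fract (x 1), Int.fract (x 2 - ⌊x 0⌋ * x 1),
      Int.fract (x 3)] := by
    ext i
    fin_cases i <;> simp [mul, a] <;>
      linarith [Int.self_sub_floor (x 0), Int.self_sub_floor (x 1), Int.self_sub_floor (x 3),
        Int.self_sub_floor (x 2 - ⌊x 0⌋ * x 1)]
  refine hon ?_
  rw [hm]
  constructor <;> intro i <;> fin_cases i <;> simp [hf, hf1]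

/-- Invariance under the lattice is periodicity in the coordinates `x₂, x₃, x₄`; in the coordinate
`x₁` there is a twist, as left translation by `(1, 0, 0, 0)` also changes `x₃`. -/
theorem periodic (u : SmoothFun 𝕜) (x : G) (i : Fin 4) (hi : i ≠ 0) :
    (u : G → 𝕜) (Function.update x i (x i + 1)) = (u : G → 𝕜) x := by
  have ha : Pi.single i 1 ∈ lattice := by
    intro j
    by_cases h : j = i
    · subst h; exact ⟨1, by simp⟩
    · exact ⟨0, by simp [h]⟩
  rw [← u.invariant ha x]
  refine congrArg (u : G → 𝕜) (funext fun j => ?_)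
  fin_cases i <;> fin_cases j <;> simp [mul, add_comm] at hi ⊢

/-- The shear `(y₂, y₃, y₄) ↦ (y₂, y₃ - y₂, y₄)` does not map the unit cube to itself, but it keeps
the integral of a function of period one in `y₃`. -/
theorem integral_shear (h : (Fin 3 → ℝ) → 𝕜) (hc : Continuous h)
    (hp : ∀ y, h ![y 0, y 1 + 1, y 2] = h y) :
    ∫ y in Set.Icc (0 : Fin 3 → ℝ) 1, h ![y 0, y 1 - y 0, y 2] =
      ∫ y in Set.Icc (0 : Fin 3 → ℝ) 1, h y := by
  have key : ∀ g : (Fin 3 → ℝ) → 𝕜, Continuous g → ∫ y in Set.Icc (0 : Fin 3 → ℝ) 1, g y =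
      ∫ z in Set.Icc (0 : Fin 2 → ℝ) 1, ∫ s in (0:ℝ)..1, g ![z 0, s, z 1] := by
    intro g hg
    let e := MeasurableEquiv.piFinSuccAbove (fun _ : Fin 3 => ℝ) 1
    have he : MeasureTheory.MeasurePreserving e.symm :=
      (MeasureTheory.volume_preserving_piFinSuccAbove (fun _ : Fin 3 => ℝ) 1).symm
    have hval : ∀ s : ℝ, ∀ z : Fin 2 → ℝ, e.symm (s, z) = ![z 0, s, z 1] := by
      intro s z
      ext i; fin_cases i <;> rfl
    rw [← he.setIntegral_preimage_emb e.symm.measurableEmbedding]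
    have hpre : e.symm ⁻¹' Set.Icc (0 : Fin 3 → ℝ) 1 = Set.Icc (0 : ℝ) 1 ×ˢ Set.Icc 0 1 := by
      ext ⟨s, z⟩
      simp only [Set.mem_preimage, hval, Set.mem_Icc, Pi.le_def, Set.mem_prod]
      simp [Fin.forall_fin_succ]
      tauto
    have hcont : Continuous fun p : ℝ × (Fin 2 → ℝ) => g (e.symm p) := by
      refine hg.comp ?_
      have : (e.symm : ℝ × (Fin 2 → ℝ) → _) = fun p => ![p.2 0, p.1, p.2 1] :=
        funext fun p => hval p.1 p.2
      rw [this]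
      fun_prop
    rw [hpre, MeasureTheory.Measure.volume_eq_prod, ← MeasureTheory.setIntegral_prod_swap,
      MeasureTheory.setIntegral_prod]
    · refine MeasureTheory.setIntegral_congr_fun measurableSet_Icc fun z _ => ?_
      simp only [hval]
      rw [intervalIntegral.integral_of_le zero_le_one, MeasureTheory.integral_Icc_eq_integral_Ioc]
      rfl
    · exact (hcont.comp continuous_swap).continuousOn.integrableOn_compact
        (isCompact_Icc.prod isCompact_Icc)
  have hc2 : Continuous fun y : Fin 3 → ℝ => ![y 0, y 1 - y 0, y 2] := by fun_prop
  refine (key _ (hc.comp hc2)).trans (Eq.trans ?_ (key _ hc).symm)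
  refine MeasureTheory.setIntegral_congr_fun measurableSet_Icc fun z _ => ?_
  simp only [Function.comp_apply, Matrix.cons_val_zero, Matrix.cons_val_one, Matrix.cons_val]
  have hper : Function.Periodic (fun s => h ![z 0, s, z 1]) 1 := fun s => by
    simpa using hp ![z 0, s, z 1]
  rw [intervalIntegral.integral_comp_sub_right (fun s => h ![z 0, s, z 1])]
  have := hper.intervalIntegral_add_eq (-z 0) 0
  simpa [sub_eq_add_neg, add_comm] using this

/-- The integral over the unit cube of a partial derivative is the difference of the integrals over
two opposite faces. -/
theorem integral_partial (v : G → 𝕜) (hv : ContDiff ℝ ∞ v) (i : Fin 4) :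
    ∫ x in Set.Icc (0 : G) 1, fderiv ℝ v x (stdVec i) =
      (∫ y in Set.Icc (0 : Fin 3 → ℝ) 1, v (i.insertNth (1 : ℝ) y)) -
        ∫ y in Set.Icc (0 : Fin 3 → ℝ) 1, v (i.insertNth (0 : ℝ) y) := by
  have hc : Continuous fun x => fderiv ℝ v x (stdVec i) :=
    (((hv.fderiv_right (m := ∞) (by simp)).clm_apply contDiff_const)).continuous
  have hs : ∀ x, ∑ j, (if j = i then fderiv ℝ v x else 0 : G →L[ℝ] 𝕜) (Pi.single j 1) =
      fderiv ℝ v x (stdVec i) := by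
    intro x
    rw [Finset.sum_eq_single i]
    · simp [stdVec]
    · intro j _ hj; simp [hj]
    · simp
  have key := MeasureTheory.integral_divergence_of_hasFDerivAt_off_countable' (n := 3) (E := 𝕜)
    (0 : Fin 4 → ℝ) 1 zero_le_one (fun j => if j = i then v else 0)
    (fun j x => if j = i then fderiv ℝ v x else 0) ∅ Set.countable_empty
    (fun j => by
      by_cases h : j = i
      · simpa [h] using hv.continuous.continuousOn
      · simp only [h, if_false]; exact continuousOn_const)
    (fun x _ j => by
      by_cases h : j = i
      · simpa [h] using (hv.differentiable (by simp) x).hasFDerivAt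
      · simp only [h, if_false]; exact hasFDerivAt_const (0 : 𝕜) x)
    (by
      simp only [hs]
      exact hc.continuousOn.integrableOn_compact isCompact_Icc)
  simp only [hs] at key
  rw [key, Finset.sum_eq_single i]
  · simp
  · intro j _ hj; simp [hj]
  · simp

/-- The divergence theorem on `X`: the fields of the frame are divergence-free. -/
@[simp] theorem integral_lieD (i : Fin 4) (u : SmoothFun 𝕜) : integral (lieD i u) = 0 := by
  have hper : ∀ (v : G → 𝕜) (j : Fin 4),
      (∀ x : G, v (Function.update x j (x j + 1)) = v x) → ∀ y : Fin 3 → ℝ,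
      v (j.insertNth (1 : ℝ) y) = v (j.insertNth (0 : ℝ) y) := by
    intro v j h y
    have := h (j.insertNth (0 : ℝ) y)
    simpa [Fin.update_insertNth] using this
  have hstd : ∀ (v : G → 𝕜) (j : Fin 4), ContDiff ℝ ∞ v →
      (∀ x : G, v (Function.update x j (x j + 1)) = v x) →
      ∫ x in Set.Icc (0 : G) 1, fderiv ℝ v x (stdVec j) = 0 := by
    intro v j hv h
    rw [integral_partial v hv j, sub_eq_zero]
    simp only [hper v j h]
  change ∫ x in Set.Icc (0 : G) 1, fderiv ℝ (u : G → 𝕜) x (frame i x) = 0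
  fin_cases i
  · change ∫ x in Set.Icc (0 : G) 1, fderiv ℝ (u : G → 𝕜) x (stdVec 0) = 0
    rw [integral_partial _ u.contDiff, sub_eq_zero]
    -- The lattice identifies the two faces up to a shear.
    have hsh : ∀ y : Fin 3 → ℝ, (u : G → 𝕜) ((0 : Fin 4).insertNth (1 : ℝ) y) =
        (u : G → 𝕜) ((0 : Fin 4).insertNth (0 : ℝ) ![y 0, y 1 - y 0, y 2]) := by
      intro y
      have ha : (Pi.single 0 1 : G) ∈ lattice := by
        intro j
        by_cases h : j = 0
        · subst h; exact ⟨1, by simp⟩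
        · exact ⟨0, by simp [h]⟩
      rw [← u.invariant ha ((0 : Fin 4).insertNth (0 : ℝ) ![y 0, y 1 - y 0, y 2])]
      refine congrArg (u : G → 𝕜) (funext fun j => ?_)
      fin_cases j <;> simp [mul] <;> rfl
    simp only [hsh]
    refine integral_shear (fun y => (u : G → 𝕜) ((0 : Fin 4).insertNth (0 : ℝ) y)) ?_ ?_
    · exact u.contDiff.continuous.comp (by fun_prop)
    · intro y
      have := periodic u ((0 : Fin 4).insertNth (0 : ℝ) y) 2 (by decide)
      refine Eq.trans ?_ this
      refine congrArg (u : G → 𝕜) (funext fun j => ?_)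
      fin_cases j <;> rfl
  · -- `E₂ = ∂₂ + x₁ ∂₃`, and `x₁` is constant along `∂₃`.
    have hv : ContDiff ℝ ∞ fun x : G => ((x 0 : ℝ) : 𝕜) * (u : G → 𝕜) x :=
      ((RCLike.ofRealCLM (K := 𝕜)).contDiff.comp (contDiff_coord 0)).mul u.contDiff
    have h1 := hstd u 1 u.contDiff fun x => periodic u x 1 (by decide)
    have h2 := hstd _ 2 hv fun x => by
      simp [periodic u x 2 (by decide)]
    have h3 : ∀ x : G, fderiv ℝ (u : G → 𝕜) x (frame 1 x) = fderiv ℝ (u : G → 𝕜) x (stdVec 1) +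
        fderiv ℝ (fun x : G => ((x 0 : ℝ) : 𝕜) * (u : G → 𝕜) x) x (stdVec 2) := by
      intro x
      have h0 : HasFDerivAt (fun y : G => ((y 0 : ℝ) : 𝕜)) (RCLike.ofRealCLM ∘L dx 0) x :=
        (RCLike.ofRealCLM ∘L dx 0).hasFDerivAt
      have h4 := h0.mul (u.differentiable x).hasFDerivAt
      have h5 : frame 1 x = stdVec 1 + x 0 • stdVec 2 := rfl
      change _ = _ + fderiv ℝ ((fun y : G => ((y 0 : ℝ) : 𝕜)) * (u : G → 𝕜)) x (stdVec 2)
      rw [h4.fderiv, h5, map_add, map_smul]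
      simp [dx, stdVec, RCLike.real_smul_eq_coe_mul]
    change ∫ x in Set.Icc (0 : G) 1, fderiv ℝ (u : G → 𝕜) x (frame 1 x) = 0
    simp only [h3]
    rw [MeasureTheory.integral_add, h1, h2, add_zero]
    · exact ((u.contDiff.fderiv_right (m := ∞) (by simp)).clm_apply
        contDiff_const).continuous.continuousOn.integrableOn_compact isCompact_Icc
    · exact ((hv.fderiv_right (m := ∞) (by simp)).clm_apply
        contDiff_const).continuous.continuousOn.integrableOn_compact isCompact_Icc
  · exact hstd u 2 u.contDiff fun x => periodic u x 2 (by decide)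
  · exact hstd u 3 u.contDiff fun x => periodic u x 3 (by decide)

end SmoothFun

end Functions

/-! ### The exterior derivative in the frame and Stokes' theorem -/

section Algebra

variable {𝕜 : Type} [RCLike 𝕜]

open SmoothFun

/-- The coefficients in the frame of the exterior derivative of the `1`-form with coefficients
`q`. -/
noncomputable def dOne (q : Fin 4 → SmoothFun 𝕜) (i j : Fin 4) : SmoothFun 𝕜 :=
  lieD i (q j) - lieD j (q i) - brk i j • q 2

/-- The coefficients in the frame of the exterior derivative of the `2`-form with coefficients
`σ`. -/
noncomputable def dTwo (σ : Fin 4 → Fin 4 → SmoothFun 𝕜) (i j k : Fin 4) : SmoothFun 𝕜 :=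
  lieD i (σ j k) - lieD j (σ i k) + lieD k (σ i j)
    - brk i j • σ 2 k + brk i k • σ 2 j - brk j k • σ 2 i

/-- The coefficients in the frame of the `J`-invariant `2`-form
`A e¹³ + B (e¹⁴ + e²³) + C (e¹² + e³⁴) + D e²⁴`; every `J`-invariant form is of this shape. -/
def jForm {R : Type} [Zero R] [Neg R] (A B C D : R) : Fin 4 → Fin 4 → R :=
  ![![0, C, A, B], ![-C, 0, B, D], ![-A, -B, 0, C], ![-B, -D, -C, 0]]

theorem dTwo_jForm (A B C D : SmoothFun 𝕜) :
    dTwo (jForm A B C D) 0 1 2 = -lieD 1 A + lieD 0 B + lieD 2 C ∧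
    dTwo (jForm A B C D) 0 1 3 = lieD 0 D - lieD 1 B + lieD 3 C - C ∧
    dTwo (jForm A B C D) 0 2 3 = lieD 3 A - lieD 2 B + lieD 0 C ∧
    dTwo (jForm A B C D) 1 2 3 = -lieD 2 D + lieD 3 B + lieD 1 C := by
  refine ⟨?_, ?_, ?_, ?_⟩ <;> simp [dTwo, jForm, brk] <;> ring

/-- Stokes' theorem `∫ dq ∧ σ = ∫ q ∧ dσ` for a `1`-form `q` and a `J`-invariant `2`-form `σ`. -/
theorem integral_dOne_wedge (q : Fin 4 → SmoothFun 𝕜) (A B C D : SmoothFun 𝕜) :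
    integral ((dOne q 0 1 + dOne q 2 3) * C + (dOne q 0 3 + dOne q 1 2) * B
        - dOne q 0 2 * D - dOne q 1 3 * A) =
      integral (q 0 * dTwo (jForm A B C D) 1 2 3 - q 1 * dTwo (jForm A B C D) 0 2 3
        + q 2 * dTwo (jForm A B C D) 0 1 3 - q 3 * dTwo (jForm A B C D) 0 1 2) := by
  obtain ⟨h1, h2, h3, h4⟩ := dTwo_jForm A B C D
  rw [h1, h2, h3, h4, ← sub_eq_zero, ← integral_sub]
  have key : (dOne q 0 1 + dOne q 2 3) * C + (dOne q 0 3 + dOne q 1 2) * B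
        - dOne q 0 2 * D - dOne q 1 3 * A
      - (q 0 * (-lieD 2 D + lieD 3 B + lieD 1 C) - q 1 * (lieD 3 A - lieD 2 B + lieD 0 C)
        + q 2 * (lieD 0 D - lieD 1 B + lieD 3 C - C)
        - q 3 * (-lieD 1 A + lieD 0 B + lieD 2 C)) =
      lieD 0 (q 1 * C - q 2 * D + q 3 * B) - lieD 1 (q 0 * C - q 2 * B + q 3 * A)
        + lieD 2 (q 0 * D - q 1 * B + q 3 * C) - lieD 3 (q 0 * B - q 1 * A + q 2 * C) := by
    simp only [dOne, lieD_add, lieD_sub, lieD_mul]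
    simp only [brk, Fin.isValue, Fin.reduceEq, and_true, and_false, if_true, if_false, zero_smul,
      one_smul]
    ring
  rw [key]
  simp only [integral_sub, integral_add, integral_lieD]
  simp

/-- A Jacobian in two directions that commute on `v`, weighted by a function that is constant in
these directions, integrates to zero. -/
theorem integral_jacobian (i j : Fin 4) (w u v : SmoothFun 𝕜) (hi : lieD i w = 0)
    (hj : lieD j w = 0) (hv : brk i j • lieD 2 v = 0) :
    integral (w * (lieD i u * lieD j v - lieD j u * lieD i v)) = 0 := by
  have h : w * (lieD i u * lieD j v - lieD j u * lieD i v) =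
      lieD i (w * u * lieD j v) - lieD j (w * u * lieD i v) := by
    simp only [lieD_mul, hi, hj, lieD_comm i j v, hv]
    ring
  rw [h, integral_sub, integral_lieD, integral_lieD, sub_zero]

/-- A function all of whose values are positive real numbers. -/
def IsPositive (w : SmoothFun 𝕜) : Prop := ∀ x, ∃ r : ℝ, 0 < r ∧ (w : G → 𝕜) x = (r : 𝕜)

theorem isPositive_one : IsPositive (1 : SmoothFun 𝕜) := fun _ => ⟨1, one_pos, by simp⟩

theorem IsPositive.conj_eq {w : SmoothFun 𝕜} (hw : IsPositive w) : conjFun w = w :=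
  SmoothFun.ext fun x => by
    obtain ⟨r, -, h⟩ := hw x
    simp [conjFun_apply, h]

/-- A weighted sum of squared absolute values with vanishing integral vanishes. -/
theorem eq_zero_of_integral_normSq {n : ℕ} (w z : Fin n → SmoothFun 𝕜)
    (hw : ∀ i, IsPositive (w i)) (h : integral (∑ i, w i * (z i * conjFun (z i))) = 0) (i : Fin n) :
    z i = 0 := by
  choose r hr hwr using hw
  have hval : ∀ x, RCLike.re (((∑ i, w i * (z i * conjFun (z i)) : SmoothFun 𝕜) : G → 𝕜) x) =
      ∑ i, r i x * ‖(z i : G → 𝕜) x‖ ^ 2 := by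
    intro x
    rw [AddSubmonoidClass.coe_finsetSum, Finset.sum_apply, map_sum]
    refine Finset.sum_congr rfl fun i _ => ?_
    simp only [MulMemClass.coe_mul, Pi.mul_apply, conjFun_apply, hwr, RCLike.mul_conj]
    norm_cast
  have hnn : ∀ x, ∀ i ∈ Finset.univ, 0 ≤ r i x * ‖(z i : G → 𝕜) x‖ ^ 2 :=
    fun x i _ => mul_nonneg (hr i x).le (sq_nonneg _)
  refine SmoothFun.ext fun x => ?_
  have h1 := re_eq_zero_of_integral_eq_zero _
    (fun x => by rw [hval]; exact Finset.sum_nonneg (hnn x)) h x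
  rw [hval] at h1
  have h2 := (Finset.sum_eq_zero_iff_of_nonneg (hnn x)).1 h1 i (Finset.mem_univ _)
  simpa [(hr i x).ne'] using h2

theorem exists_const_of_lieD_eq_zero (u : SmoothFun 𝕜) (h : ∀ i, lieD i u = 0) :
    ∃ c : 𝕜, ∀ x, (u : G → 𝕜) x = c := by
  refine ⟨(u : G → 𝕜) 0, fun x => is_const_of_fderiv_eq_zero (𝕜 := ℝ) u.differentiable ?_ x 0⟩
  intro y
  have hi : ∀ i, fderiv ℝ (u : G → 𝕜) y (frame i y) = 0 := fun i => by
    rw [← lieD_apply, h i]; rfl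
  ext v
  have hv : v = v 0 • frame 0 y + v 1 • frame 1 y + (v 2 - y 0 * v 1) • frame 2 y
      + v 3 • frame 3 y := by
    ext j
    fin_cases j <;> simp [frame_zero, frame_one, frame_two, frame_three]
    ring
  rw [hv]
  simp [hi]

/-! ### Closed anti-self-dual forms -/

theorem self_add_self_integral {S : SmoothFun 𝕜} (h : integral (S + S) = 0) : integral S = 0 := by
  rw [integral_add] at h
  exact add_self_eq_zero.1 h

/-- A closed anti-self-dual form `a (e¹³ - F e²⁴) + b (e¹⁴ + e²³) + c (e¹² + e³⁴)` has constant
coefficients, and `c = 0`. -/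
theorem closed_antiSelfDual {F a b c : SmoothFun 𝕜} (hF : IsPositive F)
    (hF0 : lieD 0 F = 0) (hF2 : lieD 2 F = 0) (hF3 : lieD 3 F = 0)
    (e012 : dTwo (jForm a b c (-(F * a))) 0 1 2 = 0)
    (e013 : dTwo (jForm a b c (-(F * a))) 0 1 3 = 0)
    (e023 : dTwo (jForm a b c (-(F * a))) 0 2 3 = 0)
    (e123 : dTwo (jForm a b c (-(F * a))) 1 2 3 = 0) :
    c = 0 ∧ (∀ i, lieD i a = 0) ∧ ∀ i, lieD i b = 0 := by
  obtain ⟨h1, h2, h3, h4⟩ := dTwo_jForm a b c (-(F * a))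
  rw [h1] at e012
  rw [h2, lieD_neg, lieD_mul, hF0, mul_zero, add_zero] at e013
  rw [h3] at e023
  rw [h4, lieD_neg, lieD_mul, hF2, mul_zero, add_zero] at e123
  have c012 := congrArg conjFun e012
  have c013 := congrArg conjFun e013
  have c023 := congrArg conjFun e023
  have c123 := congrArg conjFun e123
  simp only [map_add, map_sub, map_neg, map_mul, map_zero, hF.conj_eq] at c012 c013 c023 c123
  have jac : ∀ i j : Fin 4, brk i j = 0 → ∀ w u v : SmoothFun 𝕜, lieD i w = 0 → lieD j w = 0 →
      integral (w * (lieD i u * lieD j v - lieD j u * lieD i v)) = 0 :=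
    fun i j hb w u v hi hj => integral_jacobian i j w u v hi hj (by rw [hb, zero_smul])
  -- The form is invariant in the direction of the centre.
  have s2 : integral (F * (lieD 2 a * conjFun (lieD 2 a)) + 1 * (lieD 2 b * conjFun (lieD 2 b))
      + 1 * (lieD 2 c * conjFun (lieD 2 c))) = 0 := by
    apply self_add_self_integral
    have key : (F * (lieD 2 a * conjFun (lieD 2 a)) + 1 * (lieD 2 b * conjFun (lieD 2 b))
        + 1 * (lieD 2 c * conjFun (lieD 2 c))) + (F * (lieD 2 a * conjFun (lieD 2 a))
        + 1 * (lieD 2 b * conjFun (lieD 2 b)) + 1 * (lieD 2 c * conjFun (lieD 2 c))) =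
        1 * (lieD 3 (conjFun a) * lieD 2 b - lieD 2 (conjFun a) * lieD 3 b)
        + 1 * (lieD 3 a * lieD 2 (conjFun b) - lieD 2 a * lieD 3 (conjFun b))
        + 1 * (lieD 1 (conjFun a) * lieD 2 c - lieD 2 (conjFun a) * lieD 1 c)
        + 1 * (lieD 1 a * lieD 2 (conjFun c) - lieD 2 a * lieD 1 (conjFun c))
        + 1 * (lieD 2 (conjFun b) * lieD 0 c - lieD 0 (conjFun b) * lieD 2 c)
        + 1 * (lieD 2 b * lieD 0 (conjFun c) - lieD 0 b * lieD 2 (conjFun c)) := by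
      simp only [lieD_conjFun]
      linear_combination conjFun (lieD 2 a) * e123 + lieD 2 a * c123 - conjFun (lieD 2 b) * e023
        - lieD 2 b * c023 + conjFun (lieD 2 c) * e012 + lieD 2 c * c012
    rw [key]
    simp only [integral_add]
    rw [jac 3 2 rfl, jac 3 2 rfl, jac 1 2 rfl, jac 1 2 rfl, jac 2 0 rfl, jac 2 0 rfl] <;>
      simp
  have z2 := eq_zero_of_integral_normSq ![F, 1, 1] ![lieD 2 a, lieD 2 b, lieD 2 c]
    (fun i => by fin_cases i <;> simp [hF, isPositive_one])
    (by simpa [Fin.sum_univ_three] using s2)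
  have a2 : lieD 2 a = 0 := z2 0
  have b2 : lieD 2 b = 0 := z2 1
  have c2 : lieD 2 c = 0 := z2 2
  simp only [a2, b2, c2, map_zero, mul_zero, add_zero, sub_zero, zero_add, neg_zero]
    at e012 e023 e123 c012 c023 c123
  -- The form is invariant in the direction of the circle.
  have s3 : integral (F * (lieD 3 a * conjFun (lieD 3 a)) + 1 * (lieD 3 b * conjFun (lieD 3 b))
      + 1 * (lieD 3 c * conjFun (lieD 3 c))) = 0 := by
    apply self_add_self_integral
    have key : (F * (lieD 3 a * conjFun (lieD 3 a)) + 1 * (lieD 3 b * conjFun (lieD 3 b))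
        + 1 * (lieD 3 c * conjFun (lieD 3 c))) + (F * (lieD 3 a * conjFun (lieD 3 a))
        + 1 * (lieD 3 b * conjFun (lieD 3 b)) + 1 * (lieD 3 c * conjFun (lieD 3 c))) =
        F * (lieD 3 (conjFun c) * lieD 0 a - lieD 0 (conjFun c) * lieD 3 a)
        + F * (lieD 3 c * lieD 0 (conjFun a) - lieD 0 c * lieD 3 (conjFun a))
        + 1 * (lieD 3 (conjFun c) * lieD 1 b - lieD 1 (conjFun c) * lieD 3 b)
        + 1 * (lieD 3 c * lieD 1 (conjFun b) - lieD 1 c * lieD 3 (conjFun b))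
        + lieD 3 (c * conjFun c) := by
      simp only [lieD_conjFun, lieD_mul]
      linear_combination F * conjFun (lieD 3 a) * e023 + F * lieD 3 a * c023
        + conjFun (lieD 3 b) * e123 + lieD 3 b * c123 + conjFun (lieD 3 c) * e013 + lieD 3 c * c013
    rw [key]
    simp only [integral_add, integral_lieD]
    rw [jac 3 0 rfl, jac 3 0 rfl, jac 3 1 rfl, jac 3 1 rfl] <;> simp [hF0, hF3]
  have z3 := eq_zero_of_integral_normSq ![F, 1, 1] ![lieD 3 a, lieD 3 b, lieD 3 c]
    (fun i => by fin_cases i <;> simp [hF, isPositive_one])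
    (by simpa [Fin.sum_univ_three] using s3)
  have a3 : lieD 3 a = 0 := z3 0
  have b3 : lieD 3 b = 0 := z3 1
  have c3 : lieD 3 c = 0 := z3 2
  simp only [a3, b3, c3, map_zero, add_zero, zero_add]
    at e013 e023 e123 c013 c023 c123
  -- What is left is a system on the torus with coordinates `x₁, x₂`; integrating it gives `c = 0`.
  have s : integral (1 * (c * conjFun c)) = 0 := by
    have key : 1 * (c * conjFun c) = -lieD 0 (F * a * conjFun c) - lieD 1 (b * conjFun c) := by
      simp only [lieD_conjFun, lieD_mul, hF0, c023, c123]
      linear_combination -conjFun c * e013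
    rw [key, integral_sub, integral_neg, integral_lieD, integral_lieD, neg_zero, sub_zero]
  have hc : c = 0 := eq_zero_of_integral_normSq ![1] ![c]
    (fun i => by fin_cases i; simp [isPositive_one]) (by simpa using s) 0
  subst hc
  have s0 : integral (F * (lieD 0 a * conjFun (lieD 0 a)) + 1 * (lieD 0 b * conjFun (lieD 0 b)))
      = 0 := by
    apply self_add_self_integral
    have key : (F * (lieD 0 a * conjFun (lieD 0 a)) + 1 * (lieD 0 b * conjFun (lieD 0 b)))
        + (F * (lieD 0 a * conjFun (lieD 0 a)) + 1 * (lieD 0 b * conjFun (lieD 0 b))) =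
        1 * (lieD 1 a * lieD 0 (conjFun b) - lieD 0 a * lieD 1 (conjFun b))
        + 1 * (lieD 1 (conjFun a) * lieD 0 b - lieD 0 (conjFun a) * lieD 1 b) := by
      simp only [lieD_conjFun]
      simp only [map_zero, sub_zero] at c013 e013
      linear_combination -conjFun (lieD 0 a) * e013 - lieD 0 a * c013
        + conjFun (lieD 0 b) * e012 + lieD 0 b * c012
    rw [key, integral_add, integral_jacobian, integral_jacobian] <;> simp [b2]
  have z0 := eq_zero_of_integral_normSq ![F, 1] ![lieD 0 a, lieD 0 b]
    (fun i => by fin_cases i <;> simp [hF, isPositive_one])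
    (by simpa [Fin.sum_univ_two] using s0)
  have a0 : lieD 0 a = 0 := z0 0
  have b0 : lieD 0 b = 0 := z0 1
  have a1 : lieD 1 a = 0 := by linear_combination -e012 + b0
  have b1 : lieD 1 b = 0 := by linear_combination -e013 - F * a0
  refine ⟨rfl, fun i => ?_, fun i => ?_⟩ <;> fin_cases i <;> assumption

/-! ### Energy identities -/

theorem dTwo_conj (σ : Fin 4 → Fin 4 → SmoothFun 𝕜) (i j k : Fin 4) :
    dTwo (fun i j => conjFun (σ i j)) i j k = conjFun (dTwo σ i j k) := by
  simp [dTwo, zsmul_eq_mul]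

theorem jForm_conj (A B C D : SmoothFun 𝕜) :
    jForm (conjFun A) (conjFun B) (conjFun C) (conjFun D) =
      fun i j => conjFun (jForm A B C D i j) := by
  funext i j
  fin_cases i <;> fin_cases j <;> simp [jForm]

/-- A `1`-form `θ` with `dθ` self-dual vanishes if it is the Hodge dual of the exterior derivative
of an anti-self-dual form. -/
theorem hodge_energy {E F a b c : SmoothFun 𝕜} {θ : Fin 4 → SmoothFun 𝕜} (hF : IsPositive F)
    (hEF : E * F = 1)
    (h0 : θ 0 = dTwo (jForm a b c (-(F * a))) 1 2 3)
    (h1 : θ 1 = -(F * dTwo (jForm a b c (-(F * a))) 0 2 3))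
    (h2 : θ 2 = dTwo (jForm a b c (-(F * a))) 0 1 3)
    (h3 : θ 3 = -(F * dTwo (jForm a b c (-(F * a))) 0 1 2))
    (e02 : dOne θ 0 2 = E * dOne θ 1 3) (e01 : dOne θ 0 1 + dOne θ 2 3 = 0)
    (e03 : dOne θ 0 3 + dOne θ 1 2 = 0) :
    dTwo (jForm a b c (-(F * a))) 0 1 2 = 0 ∧ dTwo (jForm a b c (-(F * a))) 0 1 3 = 0 ∧
    dTwo (jForm a b c (-(F * a))) 0 2 3 = 0 ∧ dTwo (jForm a b c (-(F * a))) 1 2 3 = 0 := by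
  have hst := integral_dOne_wedge θ (conjFun a) (conjFun b) (conjFun c) (-(F * conjFun a))
  have hl : (dOne θ 0 1 + dOne θ 2 3) * conjFun c + (dOne θ 0 3 + dOne θ 1 2) * conjFun b
      - dOne θ 0 2 * -(F * conjFun a) - dOne θ 1 3 * conjFun a = 0 := by
    linear_combination conjFun c * e01 + conjFun b * e03 + F * conjFun a * e02
      + dOne θ 1 3 * conjFun a * hEF
  rw [hl, integral_zero, h0, h1, h2, h3] at hst
  have hD : -(F * conjFun a) = conjFun (-(F * a)) := by simp [hF.conj_eq]
  rw [hD] at hst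
  simp only [jForm_conj, dTwo_conj] at hst
  have z := eq_zero_of_integral_normSq ![F, 1, F, 1]
    ![dTwo (jForm a b c (-(F * a))) 0 1 2, dTwo (jForm a b c (-(F * a))) 0 1 3,
      dTwo (jForm a b c (-(F * a))) 0 2 3, dTwo (jForm a b c (-(F * a))) 1 2 3]
    (fun i => by fin_cases i <;> simp [hF, isPositive_one])
    (by
      rw [hst]
      congr 1
      simp [Fin.sum_univ_four]
      ring)
  exact ⟨z 0, z 1, z 2, z 3⟩

/-- The imaginary unit, as a constant function. -/
noncomputable def imUnit : SmoothFun ℂ := algebraMap ℂ _ Complex.I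

theorem imUnit_mul_self : imUnit * imUnit = -1 := by
  rw [imUnit, ← map_mul, Complex.I_mul_I, map_neg, map_one]

theorem conjFun_imUnit : conjFun imUnit = -imUnit :=
  SmoothFun.ext fun _ => Complex.conj_I

/-- The energy identity of the `∂̄`-Laplacian. The form `ψ` has coefficients `A, B, C, D`, and `⋆ψ`
has coefficients `E D, -B, -C, F A`. The `(2, 1)`-form `∂⋆ψ` is determined by its coefficients
`X`, `Y` along `e¹²³` and `e¹²⁴`, and the `(1, 2)`-form `∂̄ψ` by its coefficients `Z`, `W`; their
Hodge duals are the `1`-forms `q` and `p`. The last four hypotheses are the equation `Δψ = 0`, and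
the pairing of this equation with `ψ` is the sum of the squared norms of `∂⋆ψ` and `∂̄ψ`. -/
theorem dbar_energy {E F A B C D X Y Z W : SmoothFun ℂ} {p q : Fin 4 → SmoothFun ℂ}
    (hE : IsPositive E) (hF : IsPositive F) (hEF : E * F = 1)
    (hX : 2 * X = dTwo (jForm (E * D) (-B) (-C) (F * A)) 0 1 2
      + imUnit * dTwo (jForm (E * D) (-B) (-C) (F * A)) 0 2 3)
    (hY : 2 * Y = dTwo (jForm (E * D) (-B) (-C) (F * A)) 0 1 3
      + imUnit * dTwo (jForm (E * D) (-B) (-C) (F * A)) 1 2 3)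
    (hZ : 2 * Z = dTwo (jForm A B C D) 0 1 2 - imUnit * dTwo (jForm A B C D) 0 2 3)
    (hW : 2 * W = dTwo (jForm A B C D) 0 1 3 - imUnit * dTwo (jForm A B C D) 1 2 3)
    (q0 : q 0 = -(imUnit * Y)) (q1 : q 1 = imUnit * F * X) (q2 : q 2 = Y) (q3 : q 3 = -(F * X))
    (p0 : p 0 = imUnit * W) (p1 : p 1 = -(imUnit * F * Z)) (p2 : p 2 = W) (p3 : p 3 = -(F * Z))
    (e02 : dOne q 0 2 + E * dOne p 1 3 = 0) (e13 : dOne q 1 3 + F * dOne p 0 2 = 0)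
    (e01 : dOne q 0 1 + dOne q 2 3 = dOne p 0 1 + dOne p 2 3)
    (e03 : dOne q 0 3 + dOne q 1 2 = dOne p 0 3 + dOne p 1 2) :
    X = 0 ∧ Y = 0 ∧ Z = 0 ∧ W = 0 := by
  have hq := integral_dOne_wedge q (conjFun (E * D)) (conjFun (-B)) (conjFun (-C)) (conjFun (F * A))
  have hp := integral_dOne_wedge p (conjFun A) (conjFun B) (conjFun C) (conjFun D)
  simp only [jForm_conj, dTwo_conj] at hq hp
  have hl : ((dOne q 0 1 + dOne q 2 3) * conjFun (-C) + (dOne q 0 3 + dOne q 1 2) * conjFun (-B)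
      - dOne q 0 2 * conjFun (F * A) - dOne q 1 3 * conjFun (E * D)) +
      ((dOne p 0 1 + dOne p 2 3) * conjFun C + (dOne p 0 3 + dOne p 1 2) * conjFun B
      - dOne p 0 2 * conjFun D - dOne p 1 3 * conjFun A) = 0 := by
    simp only [map_mul, map_neg, hE.conj_eq, hF.conj_eq]
    linear_combination -conjFun C * e01 - conjFun B * e03 - F * conjFun A * e02
      - E * conjFun D * e13 + (conjFun A * dOne p 1 3 + conjFun D * dOne p 0 2) * hEF
  have hs := congrArg₂ (· + ·) hq hp
  simp only [← integral_add] at hs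
  rw [hl, integral_zero] at hs
  have cX := congrArg conjFun hX
  have cY := congrArg conjFun hY
  have cZ := congrArg conjFun hZ
  have cW := congrArg conjFun hW
  simp only [map_add, map_sub, map_mul, conjFun_imUnit, map_ofNat] at cX cY cZ cW
  have z := eq_zero_of_integral_normSq ![F, 1, F, 1] ![X, Y, Z, W]
    (fun i => by fin_cases i <;> simp [hF, isPositive_one])
    (by
      apply self_add_self_integral
      rw [hs]
      congr 1
      simp only [Fin.sum_univ_four, Matrix.cons_val_zero, Matrix.cons_val_one, Matrix.cons_val]
      rw [q0, q1, q2, q3, p0, p1, p2, p3]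
      linear_combination F * X * cX + Y * cY + F * Z * cZ + W * cW)
  exact ⟨z 0, z 1, z 2, z 3⟩

/-- If the form `ψ = A e¹³ + B (e¹⁴ + e²³) + C (e¹² + e³⁴) + F D e²⁴` satisfies `∂⋆ψ = 0` and
`∂̄ψ = 0`, then `A`, `B`, `D` are constant and `C = 0`. -/
theorem dbar_coclosed {F A B C D : SmoothFun ℂ} (hF : IsPositive F)
    (hF0 : lieD 0 F = 0) (hF2 : lieD 2 F = 0) (hF3 : lieD 3 F = 0)
    (hX : dTwo (jForm D (-B) (-C) (F * A)) 0 1 2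
      + imUnit * dTwo (jForm D (-B) (-C) (F * A)) 0 2 3 = 0)
    (hY : dTwo (jForm D (-B) (-C) (F * A)) 0 1 3
      + imUnit * dTwo (jForm D (-B) (-C) (F * A)) 1 2 3 = 0)
    (hZ : dTwo (jForm A B C (F * D)) 0 1 2 - imUnit * dTwo (jForm A B C (F * D)) 0 2 3 = 0)
    (hW : dTwo (jForm A B C (F * D)) 0 1 3 - imUnit * dTwo (jForm A B C (F * D)) 1 2 3 = 0) :
    C = 0 ∧ (∀ i, lieD i A = 0) ∧ (∀ i, lieD i B = 0) ∧ ∀ i, lieD i D = 0 := by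
  have hi := imUnit_mul_self
  -- Twice the form is `u (e¹³ + F e²⁴)` plus an anti-self-dual form.
  set u := A + D with hu
  set a := A - D with ha
  set b := B + B with hb
  set c := C + C with hc
  have h2 : ∀ v : SmoothFun ℂ, v + v = 0 → v = 0 := fun v h => by
    refine SmoothFun.ext fun x => ?_
    have := congrFun (congrArg Subtype.val h) x
    exact add_self_eq_zero.1 this
  obtain ⟨f1, f2, f3, f4⟩ := dTwo_jForm D (-B) (-C) (F * A)
  obtain ⟨g1, g2, g3, g4⟩ := dTwo_jForm A B C (F * D)
  obtain ⟨k1, k2, k3, k4⟩ := dTwo_jForm a b c (-(F * a))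
  rw [f1, f3] at hX
  rw [f2, f4] at hY
  rw [g1, g3] at hZ
  rw [g2, g4] at hW
  simp only [lieD_mul, lieD_neg, hF0, hF2, mul_zero, add_zero] at hX hY hZ hW
  have n1 : dTwo (jForm a b c (-(F * a))) 0 1 2 = imUnit * lieD 3 u := by
    rw [k1, ha, hb, hc, hu]
    simp only [lieD_add, lieD_sub]
    linear_combination hZ - hX
  have n2 : dTwo (jForm a b c (-(F * a))) 0 1 3 = -(imUnit * F * lieD 2 u) := by
    rw [k2, ha, hb, hc, hu]
    simp only [lieD_add, lieD_sub, lieD_mul, lieD_neg, hF0]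
    linear_combination hW - hY
  have n3 : dTwo (jForm a b c (-(F * a))) 0 2 3 = imUnit * lieD 1 u := by
    rw [k3, ha, hb, hc, hu]
    simp only [lieD_add, lieD_sub]
    linear_combination imUnit * hZ + imUnit * hX
      + (lieD 3 A - lieD 2 B + lieD 0 C - lieD 3 D - lieD 2 B + lieD 0 C) * hi
  have n4 : dTwo (jForm a b c (-(F * a))) 1 2 3 = -(imUnit * F * lieD 0 u) := by
    rw [k4, ha, hb, hc, hu]
    simp only [lieD_add, lieD_sub, lieD_mul, lieD_neg, hF2]
    linear_combination imUnit * hW + imUnit * hY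
      + (F * lieD 2 A - F * lieD 2 D + 2 * lieD 3 B + 2 * lieD 1 C) * hi
  -- Stokes' theorem for `d(conj u)` and the anti-self-dual part: the left-hand side vanishes, and
  -- the right-hand side is a multiple of the weighted `L²`-norm of `du`.
  have hst := integral_dOne_wedge (fun i => lieD i (conjFun u)) a b c (-(F * a))
  have hz : ∀ i j, dOne (fun i => lieD i (conjFun u)) i j = 0 := fun i j => by
    simp only [dOne]
    rw [lieD_comm i j]
    ring
  simp only [hz, n1, n2, n3, n4] at hst
  have z := eq_zero_of_integral_normSq ![F, 1, F, 1] ![lieD 0 u, lieD 1 u, lieD 2 u, lieD 3 u]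
    (fun i => by fin_cases i <;> simp [hF, isPositive_one])
    (by
      have key : ∀ v : SmoothFun ℂ, integral (imUnit * v) = Complex.I * integral v :=
        fun v => integral_smul Complex.I v
      have h3 : integral (imUnit * ∑ i, ![F, 1, F, 1] i * (![lieD 0 u, lieD 1 u, lieD 2 u,
          lieD 3 u] i * conjFun (![lieD 0 u, lieD 1 u, lieD 2 u, lieD 3 u] i))) = 0 := by
        rw [← neg_eq_zero, ← integral_neg]
        refine Eq.trans ?_ (hst.symm.trans (by simp))
        congr 1
        simp only [Fin.sum_univ_four, Matrix.cons_val_zero, Matrix.cons_val_one, Matrix.cons_val,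
          lieD_conjFun]
        ring
      rw [key] at h3
      exact (mul_eq_zero.1 h3).resolve_left Complex.I_ne_zero)
  have u0 : lieD 0 u = 0 := z 0
  have u1 : lieD 1 u = 0 := z 1
  have u2 : lieD 2 u = 0 := z 2
  have u3 : lieD 3 u = 0 := z 3
  have hui : ∀ i, lieD i u = 0 := fun i => by fin_cases i <;> assumption
  simp only [u0, u1, u2, u3, mul_zero, neg_zero] at n1 n2 n3 n4
  obtain ⟨c0, ha0, hb0⟩ := closed_antiSelfDual hF hF0 hF2 hF3 n1 n2 n3 n4
  refine ⟨h2 C c0, fun i => h2 _ ?_, fun i => h2 _ ?_, fun i => h2 _ ?_⟩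
  · have h5 := hui i
    have h6 := ha0 i
    rw [hu, lieD_add] at h5
    rw [ha, lieD_sub] at h6
    linear_combination h5 + h6
  · rw [← lieD_add, ← hb, hb0 i]
  · have h5 := hui i
    have h6 := ha0 i
    rw [hu, lieD_add] at h5
    rw [ha, lieD_sub] at h6
    linear_combination h5 - h6

end Algebra

/-! ### Forms in the frame -/

section Frame

variable {F : Type} [NormedAddCommGroup F] [NormedSpace ℝ F]

/-- The frame at a point, as a basis of the tangent space. -/
noncomputable def frameBasis (x : G) : Module.Basis (Fin 4) ℝ G :=
  Module.Basis.ofEquivFun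
    { toFun := fun v => ![v 0, v 1, v 2 - x 0 * v 1, v 3]
      map_add' := fun v w => by ext i; fin_cases i <;> simp; ring
      map_smul' := fun c v => by ext i; fin_cases i <;> simp; ring
      invFun := fun w => ![w 0, w 1, w 2 + x 0 * w 1, w 3]
      left_inv := fun v => by ext i; fin_cases i <;> simp
      right_inv := fun v => by ext i; fin_cases i <;> simp }

theorem frameBasis_apply (x : G) (i : Fin 4) : frameBasis x i = frame i x := by
  rw [frameBasis, Module.Basis.coe_ofEquivFun]
  change ![_, _, _, _] = _
  fin_cases i <;> simp [frame_zero, frame_one, frame_two, frame_three]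

theorem map_frame_eq {k : ℕ} {α β : G [⋀^Fin k]→L[ℝ] F} (x : G)
    (h : ∀ i : Fin k → Fin 4, Function.Injective i →
      α (fun j => frame (i j) x) = β (fun j => frame (i j) x)) : α = β := by
  have : α.toAlternatingMap = β.toAlternatingMap := by
    refine Module.Basis.ext_alternating (frameBasis x) fun v hv => ?_
    simp only [frameBasis_apply]
    exact h v hv
  exact ContinuousAlternatingMap.toAlternatingMap_injective this

theorem map_swap₂ (α : G [⋀^Fin 2]→L[ℝ] F) (u v : G) : α ![v, u] = -α ![u, v] := by
  have h := α.map_swap ![u, v] (show (0 : Fin 2) ≠ 1 by decide)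
  refine Eq.trans (congrArg α ?_) h
  funext i; fin_cases i <;> rfl

theorem map_self₂ (α : G [⋀^Fin 2]→L[ℝ] F) (u : G) : α ![u, u] = 0 :=
  α.map_eq_zero_of_eq ![u, u] (i := 0) (j := 1) rfl (by decide)

theorem map_swap₃ (α : G [⋀^Fin 3]→L[ℝ] F) (u v w : G) : α ![v, u, w] = -α ![u, v, w] := by
  have h := α.map_swap ![u, v, w] (show (0 : Fin 3) ≠ 1 by decide)
  refine Eq.trans (congrArg α ?_) h
  funext i; fin_cases i <;> rfl

theorem map_swap₃' (α : G [⋀^Fin 3]→L[ℝ] F) (u v w : G) : α ![u, w, v] = -α ![u, v, w] := by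
  have h := α.map_swap ![u, v, w] (show (1 : Fin 3) ≠ 2 by decide)
  refine Eq.trans (congrArg α ?_) h
  funext i; fin_cases i <;> rfl

theorem map_self₃ (α : G [⋀^Fin 3]→L[ℝ] F) (u w : G) : α ![u, u, w] = 0 :=
  α.map_eq_zero_of_eq ![u, u, w] (i := 0) (j := 1) rfl (by decide)

theorem map_self₃' (α : G [⋀^Fin 3]→L[ℝ] F) (u w : G) : α ![w, u, u] = 0 :=
  α.map_eq_zero_of_eq ![w, u, u] (i := 1) (j := 2) rfl (by decide)

theorem map_self₃'' (α : G [⋀^Fin 3]→L[ℝ] F) (u w : G) : α ![u, w, u] = 0 :=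
  α.map_eq_zero_of_eq ![u, w, u] (i := 0) (j := 2) rfl (by decide)

theorem map_add_left₂ (α : G [⋀^Fin 2]→L[ℝ] F) (u v w : G) :
    α ![u + v, w] = α ![u, w] + α ![v, w] := α.vecCons_add ![w] u v

theorem map_smul_left₂ (α : G [⋀^Fin 2]→L[ℝ] F) (c : ℝ) (u w : G) :
    α ![c • u, w] = c • α ![u, w] := α.vecCons_smul ![w] c u

theorem map_neg_left₂ (α : G [⋀^Fin 2]→L[ℝ] F) (u w : G) : α ![-u, w] = -α ![u, w] := by
  simpa using map_smul_left₂ α (-1) u w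

theorem map_neg_right₂ (α : G [⋀^Fin 2]→L[ℝ] F) (u w : G) : α ![w, -u] = -α ![w, u] := by
  rw [map_swap₂, map_neg_left₂, map_swap₂ α u w]

theorem map_neg₃ (α : G [⋀^Fin 3]→L[ℝ] F) (u v w : G) : α ![-u, v, w] = -α ![u, v, w] := by
  simpa using α.vecCons_smul ![v, w] (-1) u

theorem map_neg₃' (α : G [⋀^Fin 3]→L[ℝ] F) (u v w : G) : α ![u, -v, w] = -α ![u, v, w] := by
  rw [map_swap₃, map_neg₃, map_swap₃ α u v, neg_neg]

theorem map_neg₃'' (α : G [⋀^Fin 3]→L[ℝ] F) (u v w : G) : α ![u, v, -w] = -α ![u, v, w] := by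
  rw [map_swap₃', map_neg₃', map_swap₃' α u v, neg_neg]

theorem ext₂ {α β : G [⋀^Fin 2]→L[ℝ] F} (x : G)
    (h : ∀ i j, α ![frame i x, frame j x] = β ![frame i x, frame j x]) : α = β := by
  refine map_frame_eq x fun i _ => ?_
  have hi : (fun j => frame (i j) x) = ![frame (i 0) x, frame (i 1) x] := by
    funext j; fin_cases j <;> rfl
  rw [hi, h]

theorem ext₂' {α β : G [⋀^Fin 2]→L[ℝ] F} (x : G)
    (h01 : α ![frame 0 x, frame 1 x] = β ![frame 0 x, frame 1 x])
    (h02 : α ![frame 0 x, frame 2 x] = β ![frame 0 x, frame 2 x])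
    (h03 : α ![frame 0 x, frame 3 x] = β ![frame 0 x, frame 3 x])
    (h12 : α ![frame 1 x, frame 2 x] = β ![frame 1 x, frame 2 x])
    (h13 : α ![frame 1 x, frame 3 x] = β ![frame 1 x, frame 3 x])
    (h23 : α ![frame 2 x, frame 3 x] = β ![frame 2 x, frame 3 x]) : α = β := by
  refine ext₂ x fun i j => ?_
  wlog hij : i ≤ j generalizing i j
  · rw [map_swap₂ α (frame j x), map_swap₂ β (frame j x), this j i (le_of_not_ge hij)]
  fin_cases i <;> fin_cases j <;> first
    | assumption
    | (exfalso; revert hij; decide)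
    | rw [map_self₂, map_self₂]

theorem ext₃ {α β : G [⋀^Fin 3]→L[ℝ] F} (x : G)
    (h012 : α ![frame 0 x, frame 1 x, frame 2 x] = β ![frame 0 x, frame 1 x, frame 2 x])
    (h013 : α ![frame 0 x, frame 1 x, frame 3 x] = β ![frame 0 x, frame 1 x, frame 3 x])
    (h023 : α ![frame 0 x, frame 2 x, frame 3 x] = β ![frame 0 x, frame 2 x, frame 3 x])
    (h123 : α ![frame 1 x, frame 2 x, frame 3 x] = β ![frame 1 x, frame 2 x, frame 3 x]) :
    α = β := by
  have key : ∀ i j k : Fin 4, i < j → j < k →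
      α ![frame i x, frame j x, frame k x] = β ![frame i x, frame j x, frame k x] := by
    intro i j k hij hjk
    fin_cases i <;> fin_cases j <;> first
      | (exfalso; revert hij; decide)
      | (fin_cases k <;> first
          | assumption
          | (exfalso; revert hjk; decide))
  have key2 : ∀ i j k : Fin 4, i < j →
      α ![frame i x, frame j x, frame k x] = β ![frame i x, frame j x, frame k x] := by
    intro i j k hij
    rcases lt_trichotomy j k with h | rfl | h
    · exact key i j k hij h
    · rw [map_self₃', map_self₃']
    · rw [map_swap₃' α (frame i x) (frame k x), map_swap₃' β (frame i x) (frame k x)]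
      rcases lt_trichotomy i k with h' | rfl | h'
      · rw [key i k j h' h]
      · rw [map_self₃, map_self₃]
      · rw [map_swap₃ α (frame k x), map_swap₃ β (frame k x), key k i j h' hij]
  refine map_frame_eq x fun i _ => ?_
  have hi : (fun j => frame (i j) x) = ![frame (i 0) x, frame (i 1) x, frame (i 2) x] := by
    funext j; fin_cases j <;> rfl
  rw [hi]
  rcases lt_trichotomy (i 0) (i 1) with h | h | h
  · exact key2 _ _ _ h
  · rw [h, map_self₃, map_self₃]
  · rw [map_swap₃ α (frame (i 1) x), map_swap₃ β (frame (i 1) x), key2 _ _ _ h]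

theorem ktJ_frame (x : G) : ktJ x (frame 0 x) = frame 2 x ∧ ktJ x (frame 1 x) = frame 3 x ∧
    ktJ x (frame 2 x) = -frame 0 x ∧ ktJ x (frame 3 x) = -frame 1 x := by
  simp only [ktJ_apply, frame_zero, frame_one, frame_two, frame_three]
  simp

end Frame

/-! ### The exterior derivative -/

section ExtDeriv

variable {𝕜 : Type} [RCLike 𝕜]

open SmoothFun

theorem extDeriv_one {θ : Form 1 𝕜} (hθ : ContDiff ℝ ∞ θ) {q : Fin 4 → SmoothFun 𝕜}
    (h : ∀ i x, θ x ![frame i x] = (q i : G → 𝕜) x) (i j : Fin 4) (x : G) :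
    extDeriv θ x ![frame i x, frame j x] = (dOne q i j : G → 𝕜) x := by
  have hV : ∀ l : Fin 2, DifferentiableAt ℝ (![frame i, frame j] l) x := fun l => by
    fin_cases l <;> exact (contDiff_frame _).differentiable (by simp) x
  have key := extDeriv_apply_vectorField (hθ.differentiable (by simp) x) hV
  have hv : (fun l => ![frame i, frame j] l x) = ![frame i x, frame j x] := by
    funext l; fin_cases l <;> rfl
  rw [← hv, key]
  have hr0 : ∀ y, (Fin.removeNth 0 fun l => ![frame i, frame j] l y) = ![frame j y] := fun y => by
    funext l; fin_cases l; rfl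
  have hr1 : ∀ y, (Fin.removeNth 1 fun l => ![frame i, frame j] l y) = ![frame i y] := fun y => by
    funext l; fin_cases l; rfl
  have hb : θ x ![(brk i j : ℝ) • frame 2 x] = (brk i j : 𝕜) * (q 2 : G → 𝕜) x := by
    rw [← h 2 x]
    have := (θ x).vecCons_smul ![] (brk i j : ℝ) (frame 2 x)
    rw [RCLike.real_smul_eq_coe_mul] at this
    simpa using this
  have hs : ∀ v : Fin 0 → G, ∀ u : G, Matrix.vecCons u v = ![u] := fun v u => by
    funext l; fin_cases l; rfl
  have hI : ∑ l ∈ Finset.Ici (0 : Fin 1), (-1 : ℤ) ^ (((0 : Fin 1) : ℕ) + l : ℕ) •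
          θ x (Matrix.vecCons (VectorField.lieBracket ℝ (![frame i, frame j] (Fin.castSucc 0))
            (![frame i, frame j] l.succ) x)
            (l.removeNth <| (0 : Fin 1).castSucc.removeNth (![frame i, frame j] · x))) =
      (brk i j : 𝕜) * (q 2 : G → 𝕜) x := by
    rw [show Finset.Ici (0 : Fin 1) = {0} by decide]
    simp [hs, lieBracket_frame, hb]
  have e0 : fderiv ℝ (fun y => θ y (Fin.removeNth 0 (![frame i, frame j] · y))) x
      (![frame i, frame j] 0 x) = (lieD i (q j) : G → 𝕜) x := by
    simp only [hr0, h]; rfl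
  have e1 : fderiv ℝ (fun y => θ y (Fin.removeNth 1 (![frame i, frame j] · y))) x
      (![frame i, frame j] 1 x) = (lieD j (q i) : G → 𝕜) x := by
    simp only [hr1, h]; rfl
  rw [Fin.sum_univ_two, Fin.sum_univ_one, hI, e0, e1]
  simp [dOne, zsmul_eq_mul]
  ring

theorem extDeriv_two {α : Form 2 𝕜} (hα : ContDiff ℝ ∞ α) {σ : Fin 4 → Fin 4 → SmoothFun 𝕜}
    (h : ∀ i j x, α x ![frame i x, frame j x] = (σ i j : G → 𝕜) x) (i j k : Fin 4) (x : G) :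
    extDeriv α x ![frame i x, frame j x, frame k x] = (dTwo σ i j k : G → 𝕜) x := by
  set V := ![frame i, frame j, frame k] with hVdef
  have hV : ∀ l : Fin 3, DifferentiableAt ℝ (V l) x := fun l => by
    fin_cases l <;> exact (contDiff_frame _).differentiable (by simp) x
  have key := extDeriv_apply_vectorField (hα.differentiable (by simp) x) hV
  have hv : (fun l => V l x) = ![frame i x, frame j x, frame k x] := by
    funext l; fin_cases l <;> rfl
  rw [← hv, key]
  have hr0 : ∀ y, (Fin.removeNth 0 fun l => V l y) = ![frame j y, frame k y] := fun y => by
    funext l; fin_cases l <;> rfl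
  have hr1 : ∀ y, (Fin.removeNth 1 fun l => V l y) = ![frame i y, frame k y] := fun y => by
    funext l; fin_cases l <;> rfl
  have hr2 : ∀ y, (Fin.removeNth 2 fun l => V l y) = ![frame i y, frame j y] := fun y => by
    funext l; fin_cases l <;> rfl
  have hb : ∀ l m n : Fin 4, α x ![(brk l m : ℝ) • frame 2 x, frame n x] =
      (brk l m : 𝕜) * (σ 2 n : G → 𝕜) x := by
    intro l m n
    rw [← h 2 n x, map_smul_left₂, RCLike.real_smul_eq_coe_mul]
    simp
  have hI : ∑ l : Fin 2, ∑ m ≥ l, (-1 : ℤ) ^ ((l : ℕ) + m : ℕ) •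
          α x (Matrix.vecCons (VectorField.lieBracket ℝ (V l.castSucc) (V m.succ) x)
            (m.removeNth <| l.castSucc.removeNth (V · x))) =
      (brk i j : 𝕜) * (σ 2 k : G → 𝕜) x - (brk i k : 𝕜) * (σ 2 j : G → 𝕜) x
        + (brk j k : 𝕜) * (σ 2 i : G → 𝕜) x := by
    have s0 : Finset.Ici (0 : Fin 2) = {0, 1} := by decide
    have s1 : Finset.Ici (1 : Fin 2) = {1} := by decide
    rw [Fin.sum_univ_two, s0, s1, Finset.sum_pair (by decide), Finset.sum_singleton]
    have t0 : (Fin.removeNth 0 <| (Fin.castSucc (0 : Fin 2)).removeNth (V · x)) = ![frame k x] := by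
      funext l; fin_cases l; rfl
    have t1 : (Fin.removeNth 1 <| (Fin.castSucc (0 : Fin 2)).removeNth (V · x)) = ![frame j x] := by
      funext l; fin_cases l; rfl
    have t2 : (Fin.removeNth 1 <| (Fin.castSucc (1 : Fin 2)).removeNth (V · x)) = ![frame i x] := by
      funext l; fin_cases l; rfl
    have b0 : VectorField.lieBracket ℝ (V (Fin.castSucc 0)) (V (Fin.succ (0 : Fin 2))) x =
        (brk i j : ℝ) • frame 2 x := lieBracket_frame i j x
    have b1 : VectorField.lieBracket ℝ (V (Fin.castSucc 0)) (V (Fin.succ (1 : Fin 2))) x =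
        (brk i k : ℝ) • frame 2 x := lieBracket_frame i k x
    have b2 : VectorField.lieBracket ℝ (V (Fin.castSucc 1)) (V (Fin.succ (1 : Fin 2))) x =
        (brk j k : ℝ) • frame 2 x := lieBracket_frame j k x
    rw [t0, t1, t2, b0, b1, b2, hb, hb, hb]
    simp
    ring
  have e0 : fderiv ℝ (fun y => α y (Fin.removeNth 0 (V · y))) x (V 0 x) =
      (lieD i (σ j k) : G → 𝕜) x := by
    simp only [hr0, h]; rfl
  have e1 : fderiv ℝ (fun y => α y (Fin.removeNth 1 (V · y))) x (V 1 x) =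
      (lieD j (σ i k) : G → 𝕜) x := by
    simp only [hr1, h]; rfl
  have e2 : fderiv ℝ (fun y => α y (Fin.removeNth 2 (V · y))) x (V 2 x) =
      (lieD k (σ i j) : G → 𝕜) x := by
    simp only [hr2, h]; rfl
  rw [hI, Fin.sum_univ_three, e0, e1, e2]
  simp [dTwo, zsmul_eq_mul]
  ring

end ExtDeriv

/-! ### Projections onto types -/

section Types

theorem jDer_two (J : G →L[ℝ] G) (α : G [⋀^Fin 2]→L[ℝ] ℂ) (u v : G) :
    jDer J 2 α ![u, v] = α ![J u, v] + α ![u, J v] := by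
  have h0 : Function.update ![u, v] 0 (J (![u, v] 0)) = ![J u, v] := by
    funext i; fin_cases i <;> rfl
  have h1 : Function.update ![u, v] 1 (J (![u, v] 1)) = ![u, J v] := by
    funext i; fin_cases i <;> rfl
  rw [jDer_apply, Fin.sum_univ_two, h0, h1]

theorem jDer_three (J : G →L[ℝ] G) (α : G [⋀^Fin 3]→L[ℝ] ℂ) (u v w : G) :
    jDer J 3 α ![u, v, w] = α ![J u, v, w] + α ![u, J v, w] + α ![u, v, J w] := by
  have h0 : Function.update ![u, v, w] 0 (J (![u, v, w] 0)) = ![J u, v, w] := by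
    funext i; fin_cases i <;> rfl
  have h1 : Function.update ![u, v, w] 1 (J (![u, v, w] 1)) = ![u, J v, w] := by
    funext i; fin_cases i <;> rfl
  have h2 : Function.update ![u, v, w] 2 (J (![u, v, w] 2)) = ![u, v, J w] := by
    funext i; fin_cases i <;> rfl
  rw [jDer_apply, Fin.sum_univ_three, h0, h1, h2]

/-- The action of `𝒥` on a `3`-form, in the frame. -/
theorem jDer_three_frame (x : G) (α : G [⋀^Fin 3]→L[ℝ] ℂ) :
    jDer (ktJ x) 3 α ![frame 0 x, frame 1 x, frame 2 x] =
      -α ![frame 0 x, frame 2 x, frame 3 x] ∧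
    jDer (ktJ x) 3 α ![frame 0 x, frame 1 x, frame 3 x] =
      -α ![frame 1 x, frame 2 x, frame 3 x] ∧
    jDer (ktJ x) 3 α ![frame 0 x, frame 2 x, frame 3 x] =
      α ![frame 0 x, frame 1 x, frame 2 x] ∧
    jDer (ktJ x) 3 α ![frame 1 x, frame 2 x, frame 3 x] =
      α ![frame 0 x, frame 1 x, frame 3 x] := by
  obtain ⟨h0, h1, h2, h3⟩ := ktJ_frame x
  simp only [jDer_three, h0, h1, h2, h3, map_neg₃', map_neg₃'', map_self₃, map_self₃',
    map_self₃'']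
  refine ⟨?_, ?_, ?_, ?_⟩
  · rw [map_swap₃' α (frame 0 x) (frame 2 x)]; simp
  · rw [map_swap₃ α (frame 1 x) (frame 2 x)]; simp
  · rw [map_swap₃' α (frame 0 x) (frame 1 x)]; simp
  · rw [map_swap₃ α (frame 0 x) (frame 1 x)]; simp

/-- In complex dimension two, a `3`-form only has components of types `(2, 1)` and `(1, 2)`, on
which `𝒥` acts as `i` and `-i`. -/
theorem jDer_three_sq (x : G) (α : G [⋀^Fin 3]→L[ℝ] ℂ) :
    jDer (ktJ x) 3 (jDer (ktJ x) 3 α) = -α := by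
  obtain ⟨h0, h1, h2, h3⟩ := jDer_three_frame x α
  obtain ⟨k0, k1, k2, k3⟩ := jDer_three_frame x (jDer (ktJ x) 3 α)
  refine ext₃ x ?_ ?_ ?_ ?_
  · rw [k0, h2]; rfl
  · rw [k1, h3]; rfl
  · rw [k2, h0]; rfl
  · rw [k3, h1]; rfl

theorem typeProj_three_two (x : G) (α : G [⋀^Fin 3]→L[ℝ] ℂ) :
    typeProj (ktJ x) 3 2 α = (1 / 2 : ℂ) • (α - Complex.I • jDer (ktJ x) 3 α) := by
  have hs := jDer_three_sq x α
  have he : (Finset.range 4).erase 2 = {0, 1, 3} := by decide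
  simp only [typeProj, Lagrange.basis, he]
  rw [Finset.prod_insert (by decide), Finset.prod_insert (by decide), Finset.prod_singleton]
  simp only [Lagrange.basisDivisor, map_mul, map_sub, Polynomial.aeval_C, Polynomial.aeval_X,
    Module.End.mul_apply, LinearMap.sub_apply, Module.algebraMap_end_apply, map_smul, hs, map_neg,
    smul_sub, smul_neg, smul_smul, typeEigenvalue]
  match_scalars <;> field_simp <;> ring_nf <;> simp <;> ring_nf

theorem typeProj_three_one (x : G) (α : G [⋀^Fin 3]→L[ℝ] ℂ) :
    typeProj (ktJ x) 3 1 α = (1 / 2 : ℂ) • (α + Complex.I • jDer (ktJ x) 3 α) := by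
  have hs := jDer_three_sq x α
  have he : (Finset.range 4).erase 1 = {0, 2, 3} := by decide
  simp only [typeProj, Lagrange.basis, he]
  rw [Finset.prod_insert (by decide), Finset.prod_insert (by decide), Finset.prod_singleton]
  simp only [Lagrange.basisDivisor, map_mul, map_sub, Polynomial.aeval_C, Polynomial.aeval_X,
    Module.End.mul_apply, LinearMap.sub_apply, Module.algebraMap_end_apply, map_smul, hs, map_neg,
    smul_sub, smul_neg, smul_smul, typeEigenvalue]
  match_scalars <;> field_simp <;> ring_nf <;> simp <;> ring_nf

theorem typeProj_two_one (J : G →L[ℝ] G) (α : G [⋀^Fin 2]→L[ℝ] ℂ) :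
    typeProj J 2 1 α = (1 / 4 : ℂ) • jDer J 2 (jDer J 2 α) + α := by
  have he : (Finset.range 3).erase 1 = {0, 2} := by decide
  simp only [typeProj, Lagrange.basis, he]
  rw [Finset.prod_insert (by decide), Finset.prod_singleton]
  simp only [Lagrange.basisDivisor, map_mul, map_sub, Polynomial.aeval_C, Polynomial.aeval_X,
    Module.End.mul_apply, LinearMap.sub_apply, Module.algebraMap_end_apply, map_smul,
    smul_sub, smul_smul, typeEigenvalue]
  match_scalars <;> field_simp <;> ring_nf
  simp

theorem jDer_two_frame (x : G) (α : G [⋀^Fin 2]→L[ℝ] ℂ) :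
    jDer (ktJ x) 2 α ![frame 0 x, frame 1 x] =
      α ![frame 0 x, frame 3 x] - α ![frame 1 x, frame 2 x] ∧
    jDer (ktJ x) 2 α ![frame 0 x, frame 2 x] = 0 ∧
    jDer (ktJ x) 2 α ![frame 0 x, frame 3 x] =
      α ![frame 2 x, frame 3 x] - α ![frame 0 x, frame 1 x] ∧
    jDer (ktJ x) 2 α ![frame 1 x, frame 2 x] =
      α ![frame 0 x, frame 1 x] - α ![frame 2 x, frame 3 x] ∧
    jDer (ktJ x) 2 α ![frame 1 x, frame 3 x] = 0 ∧
    jDer (ktJ x) 2 α ![frame 2 x, frame 3 x] =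
      α ![frame 1 x, frame 2 x] - α ![frame 0 x, frame 3 x] := by
  obtain ⟨h0, h1, h2, h3⟩ := ktJ_frame x
  simp only [jDer_two, h0, h1, h2, h3, map_neg_left₂, map_neg_right₂, map_self₂]
  rw [map_swap₂ α (frame 1 x) (frame 2 x), map_swap₂ α (frame 0 x) (frame 1 x),
    map_swap₂ α (frame 2 x) (frame 3 x)]
  refine ⟨?_, ?_, ?_, ?_, ?_, ?_⟩ <;> ring

theorem typeProj_two_one_frame (x : G) (α : G [⋀^Fin 2]→L[ℝ] ℂ) :
    typeProj (ktJ x) 2 1 α ![frame 0 x, frame 1 x] =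
      (α ![frame 0 x, frame 1 x] + α ![frame 2 x, frame 3 x]) / 2 ∧
    typeProj (ktJ x) 2 1 α ![frame 0 x, frame 2 x] = α ![frame 0 x, frame 2 x] ∧
    typeProj (ktJ x) 2 1 α ![frame 0 x, frame 3 x] =
      (α ![frame 0 x, frame 3 x] + α ![frame 1 x, frame 2 x]) / 2 ∧
    typeProj (ktJ x) 2 1 α ![frame 1 x, frame 2 x] =
      (α ![frame 0 x, frame 3 x] + α ![frame 1 x, frame 2 x]) / 2 ∧
    typeProj (ktJ x) 2 1 α ![frame 1 x, frame 3 x] = α ![frame 1 x, frame 3 x] ∧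
    typeProj (ktJ x) 2 1 α ![frame 2 x, frame 3 x] =
      (α ![frame 0 x, frame 1 x] + α ![frame 2 x, frame 3 x]) / 2 := by
  obtain ⟨h01, h02, h03, h12, h13, h23⟩ := jDer_two_frame x α
  obtain ⟨k01, k02, k03, k12, k13, k23⟩ := jDer_two_frame x (jDer (ktJ x) 2 α)
  simp only [typeProj_two_one, ContinuousAlternatingMap.add_apply,
    ContinuousAlternatingMap.smul_apply, smul_eq_mul, k01, k02, k03, k12, k13, k23, h01, h03, h12,
    h23]
  refine ⟨?_, ?_, ?_, ?_, ?_, ?_⟩ <;> ring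

/-- Forms of type `(1, 1)` are the `J`-invariant ones. -/
theorem hasType_one_one_iff (x : G) (α : G [⋀^Fin 2]→L[ℝ] ℂ) :
    HasType (ktJ x) 1 α ↔ α ![frame 1 x, frame 2 x] = α ![frame 0 x, frame 3 x] ∧
      α ![frame 2 x, frame 3 x] = α ![frame 0 x, frame 1 x] := by
  obtain ⟨h01, h02, h03, h12, h13, h23⟩ := jDer_two_frame x α
  have he : typeEigenvalue 2 1 • α = 0 := by
    ext v
    simp [typeEigenvalue]
  rw [HasType, he]
  constructor
  · intro h
    rw [h] at h01 h03
    exact ⟨(sub_eq_zero.1 h01.symm).symm, sub_eq_zero.1 h03.symm⟩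
  · rintro ⟨h1, h2⟩
    refine ext₂' x ?_ ?_ ?_ ?_ ?_ ?_ <;>
      simp only [h01, h02, h03, h12, h13, h23, h1, h2, sub_self] <;> rfl

end Types

/-! ### The Hodge star -/

section Star

variable {F : Type} [NormedAddCommGroup F] [NormedSpace ℝ F]

theorem contract_two (η : G [⋀^Fin (2 + 2)]→L[ℝ] ℝ) (v : Fin 2 → G) (w : Fin 2 → G) :
    contract v η w = η ![v 0, v 1, w 0, w 1] := by
  change η (Matrix.vecCons (v 0) (Matrix.vecCons (v 1) w)) = _
  congr 1
  funext i; fin_cases i <;> rfl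

theorem contract_three (η : G [⋀^Fin (1 + 3)]→L[ℝ] ℝ) (v : Fin 3 → G) (w : Fin 1 → G) :
    contract v η w = η ![v 0, v 1, v 2, w 0] := by
  change η (Matrix.vecCons (v 0) (Matrix.vecCons (v 1) (Matrix.vecCons (v 2) w))) = _
  congr 1
  funext i; fin_cases i <;> rfl

/-- A symmetric sum without diagonal terms, as in the definition of the Hodge star, in terms of
increasing indices. -/
theorem sum_symm_two (g : Fin 4 → Fin 4 → F) (h0 : ∀ a, g a a = 0) (h1 : ∀ a b, g b a = g a b) :
    (2 : ℝ)⁻¹ • ∑ a, ∑ b, g a b = g 0 1 + g 0 2 + g 0 3 + g 1 2 + g 1 3 + g 2 3 := by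
  simp only [Fin.sum_univ_four, h0, h1 0 1, h1 0 2, h1 0 3, h1 1 2, h1 1 3, h1 2 3]
  module

theorem sum_symm_three (g : Fin 4 → Fin 4 → Fin 4 → F) (h0 : ∀ a b, g a a b = 0)
    (h1 : ∀ a b c, g b a c = g a b c) (h2 : ∀ a b c, g a c b = g a b c) :
    (6 : ℝ)⁻¹ • ∑ a, ∑ b, ∑ c, g a b c = g 0 1 2 + g 0 1 3 + g 0 2 3 + g 1 2 3 := by
  have h3 : ∀ a b, g a b b = 0 := fun a b => by rw [h1 b a, h2 b b a, h0]
  have h4 : ∀ a b, g a b a = 0 := fun a b => by rw [h2 a a b, h0]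
  have p : ∀ a b c, g a c b = g a b c ∧ g b a c = g a b c ∧ g b c a = g a b c ∧ g c a b = g a b c ∧
      g c b a = g a b c := fun a b c =>
    ⟨h2 a b c, h1 a b c, by rw [h2 b a c, h1], by rw [h1 a c b, h2], by rw [h1 b c a, h2 b a c, h1]⟩
  simp only [Fin.sum_univ_four, h0, h3, h4, p 0 1 2, p 0 1 3, p 0 2 3, p 1 2 3]
  module

theorem inv_metricMatrix (f : ℝ → ℝ) (t : ℝ) (x : G) :
    (metricMatrix (ktJ x) (ktΩ f t x))⁻¹ =
      !![Real.exp (-2 * t * f (x 1)), 0, 0, 0; 0, 1, x 0, 0;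
        0, x 0, x 0 ^ 2 + Real.exp (-2 * t * f (x 1)), 0; 0, 0, 0, 1] := by
  have he : Real.exp (2 * t * f (x 1)) * Real.exp (-2 * t * f (x 1)) = 1 := by
    rw [← Real.exp_add]; simp
  refine Matrix.inv_eq_right_inv ?_
  have hm : metricMatrix (ktJ x) (ktΩ f t x) =
      !![Real.exp (2 * t * f (x 1)), 0, 0, 0;
        0, 1 + Real.exp (2 * t * f (x 1)) * x 0 ^ 2, -(Real.exp (2 * t * f (x 1)) * x 0), 0;
        0, -(Real.exp (2 * t * f (x 1)) * x 0), Real.exp (2 * t * f (x 1)), 0; 0, 0, 0, 1] := by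
    ext i j
    fin_cases i <;> fin_cases j <;> simp [metricMatrix, ktΩ_apply, ktJ_apply, stdVec]
    ring
  rw [hm]
  set E := Real.exp (2 * t * f (x 1))
  set F := Real.exp (-2 * t * f (x 1))
  ext i j
  fin_cases i <;> fin_cases j <;> simp [Matrix.mul_apply, Fin.sum_univ_four] <;>
    first
      | ring1
      | linear_combination he
      | linear_combination -x 0 * he

/-- The sign comes from `e¹³ ∧ e²⁴ = -e¹²³⁴`: the orientation given by `J` is opposite to that of
the coordinates. -/
theorem volumeForm_apply (f : ℝ → ℝ) (t : ℝ) (x : G) (v : Fin 4 → G) :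
    volumeForm (ktΩ f t x) v = -Real.exp (2 * t * f (x 1)) * (Matrix.of v).det := by
  have : pfaffian (ktΩ f t x) = -Real.exp (2 * t * f (x 1)) := by
    simp [pfaffian, ktΩ_apply, stdVec]
  simp only [volumeForm, this, ContinuousAlternatingMap.smul_apply, smul_eq_mul]
  rfl

theorem inv_metricMatrix_row (f : ℝ → ℝ) (t : ℝ) (x : G) :
    (metricMatrix (ktJ x) (ktΩ f t x))⁻¹ 0 = ![Real.exp (-2 * t * f (x 1)), 0, 0, 0] ∧
    (metricMatrix (ktJ x) (ktΩ f t x))⁻¹ 1 = ![0, 1, x 0, 0] ∧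
    (metricMatrix (ktJ x) (ktΩ f t x))⁻¹ 2 =
      ![0, x 0, x 0 ^ 2 + Real.exp (-2 * t * f (x 1)), 0] ∧
    (metricMatrix (ktJ x) (ktΩ f t x))⁻¹ 3 = ![0, 0, 0, 1] := by
  rw [inv_metricMatrix]
  exact ⟨rfl, rfl, rfl, rfl⟩

theorem map_swap₄ (η : G [⋀^Fin 4]→L[ℝ] F) (u v w z : G) :
    η ![v, u, w, z] = -η ![u, v, w, z] := by
  have h := η.map_swap ![u, v, w, z] (show (0 : Fin 4) ≠ 1 by decide)
  refine Eq.trans (congrArg η ?_) h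
  funext i; fin_cases i <;> rfl

theorem map_swap₄' (η : G [⋀^Fin 4]→L[ℝ] F) (u v w z : G) :
    η ![u, w, v, z] = -η ![u, v, w, z] := by
  have h := η.map_swap ![u, v, w, z] (show (1 : Fin 4) ≠ 2 by decide)
  refine Eq.trans (congrArg η ?_) h
  funext i; fin_cases i <;> rfl

theorem frame_eq_stdVec (x : G) : frame 0 x = stdVec 0 ∧ frame 1 x = stdVec 1 + x 0 • stdVec 2 ∧
    frame 2 x = stdVec 2 ∧ frame 3 x = stdVec 3 := ⟨rfl, rfl, rfl, rfl⟩

theorem map_add_right₂ (α : G [⋀^Fin 2]→L[ℝ] F) (u v w : G) :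
    α ![w, u + v] = α ![w, u] + α ![w, v] := by
  rw [map_swap₂ α (u + v), map_add_left₂, map_swap₂ α w u, map_swap₂ α w v]
  abel

theorem map_smul_right₂ (α : G [⋀^Fin 2]→L[ℝ] F) (c : ℝ) (u w : G) :
    α ![w, c • u] = c • α ![w, u] := by
  rw [map_swap₂ α (c • u), map_smul_left₂, map_swap₂ α w u, smul_neg, neg_neg]

theorem frame_coeff₂ (x : G) (α : G [⋀^Fin 2]→L[ℝ] F) :
    α ![frame 0 x, frame 1 x] = α ![stdVec 0, stdVec 1] + x 0 • α ![stdVec 0, stdVec 2] ∧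
    α ![frame 0 x, frame 2 x] = α ![stdVec 0, stdVec 2] ∧
    α ![frame 0 x, frame 3 x] = α ![stdVec 0, stdVec 3] ∧
    α ![frame 1 x, frame 2 x] = α ![stdVec 1, stdVec 2] ∧
    α ![frame 1 x, frame 3 x] = α ![stdVec 1, stdVec 3] + x 0 • α ![stdVec 2, stdVec 3] ∧
    α ![frame 2 x, frame 3 x] = α ![stdVec 2, stdVec 3] := by
  obtain ⟨h0, h1, h2, h3⟩ := frame_eq_stdVec x
  simp only [h0, h1, h2, h3, map_add_left₂, map_add_right₂, map_smul_left₂, map_smul_right₂,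
    map_self₂, smul_zero, add_zero, and_self]

/-- Laplace's expansion of a determinant along its first two rows. -/
theorem det_four (u v w z : Fin 4 → ℝ) : (Matrix.of ![u, v, w, z]).det =
    (u 0 * v 1 - u 1 * v 0) * (w 2 * z 3 - w 3 * z 2)
      - (u 0 * v 2 - u 2 * v 0) * (w 1 * z 3 - w 3 * z 1)
      + (u 0 * v 3 - u 3 * v 0) * (w 1 * z 2 - w 2 * z 1)
      + (u 1 * v 2 - u 2 * v 1) * (w 0 * z 3 - w 3 * z 0)
      - (u 1 * v 3 - u 3 * v 1) * (w 0 * z 2 - w 2 * z 0)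
      + (u 2 * v 3 - u 3 * v 2) * (w 0 * z 1 - w 1 * z 0) := by
  simp [Matrix.det_succ_row_zero, Fin.sum_univ_succ, Fin.succAbove]
  ring

theorem star₂_eq (f : ℝ → ℝ) (t : ℝ) (x : G) (α : G [⋀^Fin 2]→L[ℝ] F) (w : Fin 2 → G) :
    star₂ (ktJ x) (ktΩ f t x) α w = (2 : ℝ)⁻¹ • ∑ a, ∑ b,
      volumeForm (ktΩ f t x) ![(metricMatrix (ktJ x) (ktΩ f t x))⁻¹ a,
        (metricMatrix (ktJ x) (ktΩ f t x))⁻¹ b, w 0, w 1] • α ![stdVec a, stdVec b] := by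
  simp only [star₂, hodgeStar, ContinuousAlternatingMap.smul_apply,
    ContinuousAlternatingMap.sum_apply, ContinuousAlternatingMap.smulRight_apply, contract_two]
  congr 1
  rw [← Fintype.sum_prod_type', ← (finTwoArrowEquiv (Fin 4)).sum_comp]
  refine Finset.sum_congr rfl fun a _ => ?_
  congr 2
  funext i; fin_cases i <;> rfl

/-- The Hodge star on `2`-forms. The frame is orthogonal, with `|E₁|² = |E₃|² = e^{2tf(x₂)}` and
`|E₂| = |E₄| = 1`, and `e¹³²⁴` is positive. -/
theorem star₂_frame (f : ℝ → ℝ) (t : ℝ) (x : G) (α : G [⋀^Fin 2]→L[ℝ] F) :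
    star₂ (ktJ x) (ktΩ f t x) α ![frame 0 x, frame 1 x] = -α ![frame 2 x, frame 3 x] ∧
    star₂ (ktJ x) (ktΩ f t x) α ![frame 0 x, frame 2 x] =
      Real.exp (2 * t * f (x 1)) • α ![frame 1 x, frame 3 x] ∧
    star₂ (ktJ x) (ktΩ f t x) α ![frame 0 x, frame 3 x] = -α ![frame 1 x, frame 2 x] ∧
    star₂ (ktJ x) (ktΩ f t x) α ![frame 1 x, frame 2 x] = -α ![frame 0 x, frame 3 x] ∧
    star₂ (ktJ x) (ktΩ f t x) α ![frame 1 x, frame 3 x] =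
      Real.exp (-2 * t * f (x 1)) • α ![frame 0 x, frame 2 x] ∧
    star₂ (ktJ x) (ktΩ f t x) α ![frame 2 x, frame 3 x] = -α ![frame 0 x, frame 1 x] := by
  have he : Real.exp (2 * t * f (x 1)) * Real.exp (-2 * t * f (x 1)) = 1 := by
    rw [← Real.exp_add]; simp
  have hw : ∀ w : Fin 2 → G, star₂ (ktJ x) (ktΩ f t x) α w = _ := fun w =>
    (star₂_eq f t x α w).trans (sum_symm_two _
      (fun a => by rw [map_self₂, smul_zero])
      (fun a b => by
        rw [map_swap₂ α (stdVec a), map_swap₄, smul_neg, neg_smul, neg_neg]))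
  obtain ⟨B0, B1, B2, B3⟩ := inv_metricMatrix_row f t x
  obtain ⟨h01, h02, h03, h12, h13, h23⟩ := frame_coeff₂ x α
  rw [h01, h02, h03, h12, h13, h23]
  simp only [hw, B0, B1, B2, B3, volumeForm_apply]
  simp only [frame_zero, frame_one, frame_two, frame_three]
  generalize Real.exp (2 * t * f (x 1)) = E at *
  generalize Real.exp (-2 * t * f (x 1)) = F' at *
  have hF' : F' ≠ 0 := right_ne_zero_of_mul_eq_one he
  obtain rfl : E = F'⁻¹ := eq_inv_of_mul_eq_one_left he
  simp only [det_four, Matrix.cons_val_zero, Matrix.cons_val_one, Matrix.cons_val]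
  refine ⟨?_, ?_, ?_, ?_, ?_, ?_⟩ <;> match_scalars <;> field_simp <;> ring1

theorem star₃_eq (f : ℝ → ℝ) (t : ℝ) (x : G) (α : G [⋀^Fin 3]→L[ℝ] F) (w : G) :
    star₃ (ktJ x) (ktΩ f t x) α ![w] = (6 : ℝ)⁻¹ • ∑ a, ∑ b, ∑ c,
      volumeForm (ktΩ f t x) ![(metricMatrix (ktJ x) (ktΩ f t x))⁻¹ a,
        (metricMatrix (ktJ x) (ktΩ f t x))⁻¹ b, (metricMatrix (ktJ x) (ktΩ f t x))⁻¹ c, w] •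
        α ![stdVec a, stdVec b, stdVec c] := by
  simp only [star₃, hodgeStar, ContinuousAlternatingMap.smul_apply,
    ContinuousAlternatingMap.sum_apply, ContinuousAlternatingMap.smulRight_apply, contract_three]
  have h6 : ((Nat.factorial 3 : ℕ) : ℝ) = 6 := by norm_num [Nat.factorial]
  rw [h6]
  congr 1
  rw [← (Fin.consEquiv fun _ : Fin 3 => Fin 4).sum_comp, Fintype.sum_prod_type]
  refine Finset.sum_congr rfl fun a _ => ?_
  rw [← Fintype.sum_prod_type', ← (finTwoArrowEquiv (Fin 4)).sum_comp]
  refine Finset.sum_congr rfl fun b _ => ?_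
  have hv : (fun i => stdVec ((Fin.consEquiv fun _ : Fin 3 => Fin 4) (a, b) i)) =
      ![stdVec a, stdVec (b 0), stdVec (b 1)] := by
    funext i; fin_cases i <;> rfl
  rw [hv]
  rfl

theorem map_add₃ (α : G [⋀^Fin 3]→L[ℝ] F) (u u' v w : G) :
    α ![u + u', v, w] = α ![u, v, w] + α ![u', v, w] := α.vecCons_add ![v, w] u u'

theorem map_smul₃ (α : G [⋀^Fin 3]→L[ℝ] F) (c : ℝ) (u v w : G) :
    α ![c • u, v, w] = c • α ![u, v, w] := α.vecCons_smul ![v, w] c u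

theorem frame_coeff₃ (x : G) (α : G [⋀^Fin 3]→L[ℝ] F) :
    α ![frame 0 x, frame 1 x, frame 2 x] = α ![stdVec 0, stdVec 1, stdVec 2] ∧
    α ![frame 0 x, frame 1 x, frame 3 x] = α ![stdVec 0, stdVec 1, stdVec 3] +
      x 0 • α ![stdVec 0, stdVec 2, stdVec 3] ∧
    α ![frame 0 x, frame 2 x, frame 3 x] = α ![stdVec 0, stdVec 2, stdVec 3] ∧
    α ![frame 1 x, frame 2 x, frame 3 x] = α ![stdVec 1, stdVec 2, stdVec 3] := by
  obtain ⟨h0, h1, h2, h3⟩ := frame_eq_stdVec x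
  have hm : ∀ u v w : G, α ![u, stdVec 1 + x 0 • v, w] =
      α ![u, stdVec 1, w] + x 0 • α ![u, v, w] := fun u v w => by
    rw [map_swap₃, map_add₃, map_smul₃, map_swap₃ α u (stdVec 1), map_swap₃ α u v]
    module
  simp only [h0, h1, h2, h3, hm, map_add₃, map_smul₃, map_self₃, map_self₃', smul_zero, add_zero,
    and_self]

theorem star₃_frame (f : ℝ → ℝ) (t : ℝ) (x : G) (α : G [⋀^Fin 3]→L[ℝ] F) :
    star₃ (ktJ x) (ktΩ f t x) α ![frame 0 x] = α ![frame 1 x, frame 2 x, frame 3 x] ∧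
    star₃ (ktJ x) (ktΩ f t x) α ![frame 1 x] =
      -(Real.exp (-2 * t * f (x 1)) • α ![frame 0 x, frame 2 x, frame 3 x]) ∧
    star₃ (ktJ x) (ktΩ f t x) α ![frame 2 x] = α ![frame 0 x, frame 1 x, frame 3 x] ∧
    star₃ (ktJ x) (ktΩ f t x) α ![frame 3 x] =
      -(Real.exp (-2 * t * f (x 1)) • α ![frame 0 x, frame 1 x, frame 2 x]) := by
  have he : Real.exp (2 * t * f (x 1)) * Real.exp (-2 * t * f (x 1)) = 1 := by
    rw [← Real.exp_add]; simp
  have hw : ∀ w : G, star₃ (ktJ x) (ktΩ f t x) α ![w] = _ := fun w =>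
    (star₃_eq f t x α w).trans (sum_symm_three _
      (fun a b => by rw [map_self₃, smul_zero])
      (fun a b c => by
        rw [map_swap₃ α (stdVec a), map_swap₄, smul_neg, neg_smul, neg_neg])
      (fun a b c => by
        rw [map_swap₃' α (stdVec a), map_swap₄', smul_neg, neg_smul, neg_neg]))
  obtain ⟨B0, B1, B2, B3⟩ := inv_metricMatrix_row f t x
  obtain ⟨h012, h013, h023, h123⟩ := frame_coeff₃ x α
  rw [h012, h013, h023, h123]
  simp only [hw, B0, B1, B2, B3, volumeForm_apply]
  simp only [frame_zero, frame_one, frame_two, frame_three]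
  generalize Real.exp (2 * t * f (x 1)) = E at *
  generalize Real.exp (-2 * t * f (x 1)) = F' at *
  have hF' : F' ≠ 0 := right_ne_zero_of_mul_eq_one he
  obtain rfl : E = F'⁻¹ := eq_inv_of_mul_eq_one_left he
  simp only [det_four, Matrix.cons_val_zero, Matrix.cons_val_one, Matrix.cons_val]
  refine ⟨?_, ?_, ?_, ?_⟩ <;> match_scalars <;> field_simp <;> ring1

end Star

/-! ### Forms with invariant coefficients on the manifold -/

section Coefficients

variable {𝕜 : Type} [RCLike 𝕜]

open SmoothFun

theorem contDiff_frame_coeff {α : Form 2 𝕜} (h : ContDiff ℝ ∞ α) (i j : Fin 4) :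
    ContDiff ℝ ∞ (fun x => α x ![frame i x, frame j x]) := by
  have h1 := contDiff_contract (m := 0) (k := 2) (η := α) h
    (v := fun x => ![frame i x, frame j x]) (by
    intro l; fin_cases l
    · exact contDiff_frame i
    · exact contDiff_frame j)
  have h2 := contDiff_eval h1 ![]
  have h3 : (fun x => α x ![frame i x, frame j x]) =
      fun x => contract (m := 0) (k := 2) ![frame i x, frame j x] (α x) ![] :=
    funext fun x => congrArg (α x) (by ext l : 1; fin_cases l <;> rfl)
  rw [h3]
  exact h2

/-- The coefficients in the frame of a `2`-form on `X`, as functions on `X`. -/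
noncomputable def coeff (α : Form 2 𝕜) (h : IsFormOnX α) (i j : Fin 4) : SmoothFun 𝕜 :=
  ⟨fun x => α x ![frame i x, frame j x], contDiff_frame_coeff h.1 i j, by
    intro a ha x
    change α (mul a x) ![frame i (mul a x), frame j (mul a x)] = α x ![frame i x, frame j x]
    rw [← h.2 a ha x, ContinuousAlternatingMap.compContinuousLinearMap_apply]
    refine congrArg (α (mul a x)) ?_
    funext l
    fin_cases l
    · exact (fderiv_mul_frame a x i).symm
    · exact (fderiv_mul_frame a x j).symm⟩

/-- The `2`-form `α` is the `J`-invariant form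
`A e¹³ + B (e¹⁴ + e²³) + C (e¹² + e³⁴) + D e²⁴` on `X`. -/
def IsJForm (α : Form 2 𝕜) (A B C D : SmoothFun 𝕜) : Prop :=
  ∀ i j x, α x ![frame i x, frame j x] = ((jForm A B C D i j : SmoothFun 𝕜) : G → 𝕜) x

theorem isJForm_of {α : Form 2 𝕜} {A B C D : SmoothFun 𝕜}
    (h02 : ∀ x, α x ![frame 0 x, frame 2 x] = (A : G → 𝕜) x)
    (h03 : ∀ x, α x ![frame 0 x, frame 3 x] = (B : G → 𝕜) x)
    (h12 : ∀ x, α x ![frame 1 x, frame 2 x] = (B : G → 𝕜) x)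
    (h01 : ∀ x, α x ![frame 0 x, frame 1 x] = (C : G → 𝕜) x)
    (h23 : ∀ x, α x ![frame 2 x, frame 3 x] = (C : G → 𝕜) x)
    (h13 : ∀ x, α x ![frame 1 x, frame 3 x] = (D : G → 𝕜) x) : IsJForm α A B C D := by
  intro i j x
  wlog hij : i ≤ j generalizing i j
  · rw [map_swap₂, this j i (le_of_not_ge hij)]
    fin_cases i <;> fin_cases j <;> simp [jForm]
  fin_cases i <;> fin_cases j <;> first
    | (exfalso; revert hij; decide)
    | (change _ = (0 : 𝕜); exact map_self₂ _ _)
    | exact h01 x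
    | exact h02 x
    | exact h03 x
    | exact h12 x
    | exact h13 x
    | exact h23 x

namespace IsJForm

variable {α β : Form 2 𝕜} {A B C D : SmoothFun 𝕜}

theorem unique (hα : IsJForm α A B C D) (hβ : IsJForm β A B C D) : α = β :=
  funext fun x => ext₂ x fun i j => by rw [hα, hβ]

theorem isFormOnX (hα : IsJForm α A B C D) (h : ContDiff ℝ ∞ α) : IsFormOnX α := by
  refine ⟨h, fun a ha x => ext₂ x fun i j => ?_⟩
  rw [ContinuousAlternatingMap.compContinuousLinearMap_apply, hα, ← SmoothFun.invariant _ ha, ← hα]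
  refine congrArg (α (mul a x)) ?_
  funext l
  fin_cases l
  · exact fderiv_mul_frame a x i
  · exact fderiv_mul_frame a x j

theorem extDeriv_eq_zero (hα : IsJForm α A B C D) (h : ContDiff ℝ ∞ α)
    (h0 : dTwo (jForm A B C D) 0 1 2 = 0) (h1 : dTwo (jForm A B C D) 0 1 3 = 0)
    (h2 : dTwo (jForm A B C D) 0 2 3 = 0) (h3 : dTwo (jForm A B C D) 1 2 3 = 0) :
    extDeriv α = 0 := by
  funext x
  refine ext₃ x ?_ ?_ ?_ ?_ <;> rw [extDeriv_two h hα]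
  · rw [h0]; rfl
  · rw [h1]; rfl
  · rw [h2]; rfl
  · rw [h3]; rfl

end IsJForm

/-- The function `e^{s f(x₂)}` on `X`. -/
noncomputable def expFun (f : ℝ → ℝ) (hf : ContDiff ℝ ∞ f) (hper : ∀ s, f (s + 1) = f s) (s : ℝ) :
    SmoothFun 𝕜 :=
  ⟨fun x => (Real.exp (s * f (x 1)) : ℝ),
    (RCLike.ofRealCLM (K := 𝕜)).contDiff.comp
      (contDiff_const.mul (hf.comp (contDiff_coord 1))).exp, by
    intro a ha x
    obtain ⟨n, hn⟩ := ha 1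
    have hfn : f (a 1 + x 1) = f (x 1) := by
      have hP : Function.Periodic f 1 := hper
      rw [hn, add_comm]
      simpa using hP.int_mul n (x 1)
    simp [mul, hfn]⟩

variable {f : ℝ → ℝ} {hf : ContDiff ℝ ∞ f} {hper : ∀ s, f (s + 1) = f s}

theorem expFun_apply (s : ℝ) (x : G) :
    ((expFun f hf hper s : SmoothFun 𝕜) : G → 𝕜) x = (Real.exp (s * f (x 1)) : ℝ) := rfl

theorem isPositive_expFun (s : ℝ) : IsPositive (expFun f hf hper s : SmoothFun 𝕜) :=
  fun _ => ⟨_, Real.exp_pos _, rfl⟩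

theorem expFun_mul_expFun_neg (t : ℝ) :
    (expFun f hf hper (2 * t) * expFun f hf hper (-2 * t) : SmoothFun 𝕜) = 1 := by
  refine SmoothFun.ext fun x => ?_
  simp only [MulMemClass.coe_mul, Pi.mul_apply, expFun_apply]
  rw [← RCLike.ofReal_mul, ← Real.exp_add]
  simp

theorem lieD_expFun (s : ℝ) {i : Fin 4} (hi : i ≠ 1) :
    lieD i (expFun f hf hper s : SmoothFun 𝕜) = 0 := by
  refine SmoothFun.ext fun x => ?_
  have h1 : HasFDerivAt (fun y : G => y 1) (dx 1) x :=
    (ContinuousLinearMap.proj (R := ℝ) (φ := fun _ : Fin 4 => ℝ) 1).hasFDerivAt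
  have hg : HasDerivAt (fun r : ℝ => ((Real.exp (s * f r) : ℝ) : 𝕜))
      (deriv (fun r : ℝ => ((Real.exp (s * f r) : ℝ) : 𝕜)) (x 1)) (x 1) := by
    have : ContDiff ℝ ∞ (fun r : ℝ => ((Real.exp (s * f r) : ℝ) : 𝕜)) :=
      (RCLike.ofRealCLM (K := 𝕜)).contDiff.comp (contDiff_const.mul hf).exp
    exact (this.differentiable (by simp) _).hasDerivAt
  have h2 := hg.hasFDerivAt.comp x h1
  rw [lieD_apply]
  change fderiv ℝ ((fun r : ℝ => ((Real.exp (s * f r) : ℝ) : 𝕜)) ∘ fun y : G => y 1) x _ = 0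
  rw [h2.fderiv]
  fin_cases i <;> simp [frame_zero, frame_two, frame_three, dx] at hi ⊢

variable {t : ℝ}

theorem IsJForm.star2 {α : Form 2 𝕜} {A B C D : SmoothFun 𝕜} (hα : IsJForm α A B C D) :
    IsJForm ((ktStructure f hf hper t).star2 α) (expFun f hf hper (2 * t) * D) (-B) (-C)
      (expFun f hf hper (-2 * t) * A) := by
  have hs := fun x => star₂_frame f t x (α x)
  refine isJForm_of (fun x => ?_) (fun x => ?_) (fun x => ?_) (fun x => ?_) (fun x => ?_)
    (fun x => ?_) <;> obtain ⟨h01, h02, h03, h12, h13, h23⟩ := hs x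
  · refine h02.trans ?_
    rw [hα, RCLike.real_smul_eq_coe_mul]; rfl
  · refine h03.trans ?_
    rw [hα]; rfl
  · refine h12.trans ?_
    rw [hα]; rfl
  · refine h01.trans ?_
    rw [hα]; rfl
  · refine h23.trans ?_
    rw [hα]; rfl
  · refine h13.trans ?_
    rw [hα, RCLike.real_smul_eq_coe_mul]; rfl

theorem star3_apply (η : Form 3 𝕜) (x : G) :
    (ktStructure f hf hper t).star3 η x = star₃ (ktJ x) (ktΩ f t x) (η x) := rfl

/-- The coefficients of the Hodge star of a `3`-form on `X`. -/
theorem star3_coeff {η : Form 3 𝕜} {a b c d : SmoothFun 𝕜}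
    (h012 : ∀ x, η x ![frame 0 x, frame 1 x, frame 2 x] = (a : G → 𝕜) x)
    (h013 : ∀ x, η x ![frame 0 x, frame 1 x, frame 3 x] = (b : G → 𝕜) x)
    (h023 : ∀ x, η x ![frame 0 x, frame 2 x, frame 3 x] = (c : G → 𝕜) x)
    (h123 : ∀ x, η x ![frame 1 x, frame 2 x, frame 3 x] = (d : G → 𝕜) x) :
    ∃ q : Fin 4 → SmoothFun 𝕜,
      (q 0 = d ∧ q 1 = -(expFun f hf hper (-2 * t) * c) ∧ q 2 = b ∧
        q 3 = -(expFun f hf hper (-2 * t) * a)) ∧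
      ∀ i x, (ktStructure f hf hper t).star3 η x ![frame i x] = (q i : G → 𝕜) x := by
  obtain ⟨q, h0, h1, h2, h3⟩ : ∃ q : Fin 4 → SmoothFun 𝕜, q 0 = d ∧
      q 1 = -(expFun f hf hper (-2 * t) * c) ∧ q 2 = b ∧
      q 3 = -(expFun f hf hper (-2 * t) * a) := ⟨![_, _, _, _], rfl, rfl, rfl, rfl⟩
  refine ⟨q, ⟨h0, h1, h2, h3⟩, fun i x => ?_⟩
  obtain ⟨k0, k1, k2, k3⟩ := star₃_frame f t x (η x)
  rw [h123, ← h0] at k0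
  rw [h023, RCLike.real_smul_eq_coe_mul] at k1
  rw [h013, ← h2] at k2
  rw [h012, RCLike.real_smul_eq_coe_mul] at k3
  have l1 : (q 1 : G → 𝕜) x =
      -((Real.exp (-2 * t * f (x 1)) : ℝ) * (c : G → 𝕜) x) := by rw [h1]; rfl
  have l3 : (q 3 : G → 𝕜) x =
      -((Real.exp (-2 * t * f (x 1)) : ℝ) * (a : G → 𝕜) x) := by rw [h3]; rfl
  rw [← l1] at k1
  rw [← l3] at k3
  rw [star3_apply]
  -- Otherwise unification unfolds the Hodge star.
  generalize star₃ (ktJ x) (ktΩ f t x) (η x) = θ at k0 k1 k2 k3 ⊢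
  fin_cases i
  · exact k0
  · exact k1
  · exact k2
  · exact k3

end Coefficients

/-! ### Anti-self-dual harmonic forms -/

section AntiSelfDual

open SmoothFun AlmostHermitian

variable {f : ℝ → ℝ} {hf : ContDiff ℝ ∞ f} {hper : ∀ s, f (s + 1) = f s} {t : ℝ}

theorem star3_zero {𝕜 : Type} [RCLike 𝕜] (S : AlmostHermitian) : S.star3 (0 : Form 3 𝕜) = 0 := by
  simpa using S.star3_smul (0 : 𝕜) 0

theorem star2_zero {𝕜 : Type} [RCLike 𝕜] (S : AlmostHermitian) : S.star2 (0 : Form 2 𝕜) = 0 := by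
  simpa using S.star2_smul (0 : 𝕜) 0

theorem neg_one_smul_form {𝕜 : Type} [RCLike 𝕜] {k : ℕ} (α : Form k 𝕜) : (-1 : 𝕜) • α = -α := by
  funext x
  ext v
  simp

theorem star3_neg {𝕜 : Type} [RCLike 𝕜] (S : AlmostHermitian) (η : Form 3 𝕜) :
    S.star3 (-η) = -S.star3 η := by
  have := S.star3_smul (-1 : 𝕜) η
  rwa [neg_one_smul_form, neg_one_smul_form] at this

theorem extDeriv_neg' {𝕜 : Type} [RCLike 𝕜] {k : ℕ} {α : Form k 𝕜} (h : ContDiff ℝ ∞ α) :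
    extDeriv (-α) = -extDeriv α := by
  have := extDeriv_smul' h (-1 : 𝕜)
  rwa [neg_one_smul_form, neg_one_smul_form] at this

theorem extDeriv_zero' {𝕜 : Type} [RCLike 𝕜] {k : ℕ} : extDeriv (0 : Form k 𝕜) = 0 := by
  have := extDeriv_smul' (α := (0 : Form k 𝕜)) contDiff_const (0 : 𝕜)
  rwa [zero_smul, zero_smul] at this

/-- Anti-self-dual forms are `J`-invariant. -/
theorem isJForm_of_antiSelfDual {γ : Form 2 ℝ} (h : IsFormOnX γ)
    (hs : (ktStructure f hf hper t).star2 γ = -γ) :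
    ∃ a b c, IsJForm γ a b c (-(expFun f hf hper (-2 * t) * a)) := by
  refine ⟨coeff γ h 0 2, coeff γ h 0 3, coeff γ h 0 1, ?_⟩
  have hx : ∀ x, star₂ (ktJ x) (ktΩ f t x) (γ x) = -γ x := fun x => congrFun hs x
  have key := fun x => star₂_frame f t x (γ x)
  simp only [hx, ContinuousAlternatingMap.neg_apply, neg_inj] at key
  refine isJForm_of (fun x => rfl) (fun x => rfl) (fun x => (key x).2.2.2.1) (fun x => rfl)
    (fun x => (key x).2.2.2.2.2) (fun x => ?_)
  have := (key x).2.2.2.2.1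
  rw [neg_eq_iff_eq_neg] at this
  exact this

/-- An anti-self-dual harmonic form is closed, and hence has constant coefficients. -/
theorem coeff_of_antiSelfDualHarmonic {γ : Form 2 ℝ}
    (h : γ ∈ (ktStructure f hf hper t).antiSelfDualHarmonic) {a b c : SmoothFun ℝ}
    (hγ : IsJForm γ a b c (-(expFun f hf hper (-2 * t) * a))) :
    c = 0 ∧ (∀ i, lieD i a = 0) ∧ ∀ i, lieD i b = 0 := by
  obtain ⟨⟨hsm, hinv⟩, hs, hl⟩ := h
  set F : SmoothFun ℝ := expFun f hf hper (-2 * t) with hF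
  set E : SmoothFun ℝ := expFun f hf hper (2 * t) with hE
  have hθ := (ktStructure f hf hper t).contDiff_star3 (contDiff_extDeriv hsm)
  obtain ⟨q, ⟨hq0, hq1, hq2, hq3⟩, hq⟩ := star3_coeff (f := f) (hf := hf) (hper := hper) (t := t)
    (η := extDeriv γ)
    (fun x => extDeriv_two hsm hγ 0 1 2 x) (fun x => extDeriv_two hsm hγ 0 1 3 x)
    (fun x => extDeriv_two hsm hγ 0 2 3 x) (fun x => extDeriv_two hsm hγ 1 2 3 x)
  have hn : (ktStructure f hf hper t).star3 (extDeriv ((ktStructure f hf hper t).star2 γ)) =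
      -(ktStructure f hf hper t).star3 (extDeriv γ) := by
    rw [hs]
    exact (congrArg _ (extDeriv_neg' (𝕜 := ℝ) hsm)).trans (star3_neg _ _)
  rw [hodgeLaplacian2, hn] at hl
  generalize (ktStructure f hf hper t).star3 (extDeriv γ) = θ at hθ hq hl
  rw [neg_neg, ← sub_eq_add_neg, sub_eq_zero] at hl
  have hd := extDeriv_one hθ hq
  have key := fun x => star₂_frame f t x (extDeriv θ x)
  have hx : ∀ x, star₂ (ktJ x) (ktΩ f t x) (extDeriv θ x) = extDeriv θ x :=
    fun x => (congrFun hl x).symm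
  simp only [hx, hd] at key
  obtain ⟨h0, h1, h2, h3⟩ := hodge_energy (E := E) (θ := q) (isPositive_expFun _)
    (expFun_mul_expFun_neg t) hq0 hq1 hq2 hq3
    (SmoothFun.ext fun x => (key x).2.1)
    (SmoothFun.ext fun x => by
      have := (key x).1
      change (dOne q 0 1 : G → ℝ) x + (dOne q 2 3 : G → ℝ) x = 0
      rw [this]; ring)
    (SmoothFun.ext fun x => by
      have := (key x).2.2.1
      change (dOne q 0 3 : G → ℝ) x + (dOne q 1 2 : G → ℝ) x = 0
      rw [this]; ring)
  exact closed_antiSelfDual (isPositive_expFun _) (lieD_expFun _ (by decide))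
    (lieD_expFun _ (by decide)) (lieD_expFun _ (by decide)) h0 h1 h2 h3

end AntiSelfDual

/-! ### Closed forms with constant coefficients -/

section Closed

variable {𝕜 : Type} [RCLike 𝕜]

open SmoothFun

theorem coframe_frame (x : G) (i : Fin 4) :
    e₁ x (frame i x) = ![1, 0, 0, 0] i ∧ e₂ x (frame i x) = ![0, 1, 0, 0] i ∧
    e₃ x (frame i x) = ![0, 0, 1, 0] i ∧ e₄ x (frame i x) = ![0, 0, 0, 1] i := by
  fin_cases i <;>
    simp [frame_zero, frame_one, frame_two, frame_three, e₁, e₂, e₃, e₄, dx]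

namespace IsJForm

variable {α β : Form 2 𝕜} {A B C D A' B' C' D' : SmoothFun 𝕜}

theorem add (hα : IsJForm α A B C D) (hβ : IsJForm β A' B' C' D') :
    IsJForm (α + β) (A + A') (B + B') (C + C') (D + D') := by
  have h := fun i j x => congrArg₂ (· + ·) (hα i j x) (hβ i j x)
  exact isJForm_of (h 0 2) (h 0 3) (h 1 2) (h 0 1) (h 2 3) (h 1 3)

theorem smul (hα : IsJForm α A B C D) (c : 𝕜) :
    IsJForm (c • α) (c • A) (c • B) (c • C) (c • D) := by
  have h := fun i j x => congrArg (c • ·) (hα i j x)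
  exact isJForm_of (h 0 2) (h 0 3) (h 1 2) (h 0 1) (h 2 3) (h 1 3)

theorem neg (hα : IsJForm α A B C D) : IsJForm (-α) (-A) (-B) (-C) (-D) := by
  have h := fun i j x => congrArg Neg.neg (hα i j x)
  exact isJForm_of (h 0 2) (h 0 3) (h 1 2) (h 0 1) (h 2 3) (h 1 3)

/-- The form `A e¹³ + B (e¹⁴ + e²³) + D e²⁴` is closed if `A`, `B` are constant and `D` is constant
along `E₁` and `E₃`. -/
theorem extDeriv_eq_zero_of_const (hα : IsJForm α A B 0 D) (h : ContDiff ℝ ∞ α)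
    (hA : ∀ i, lieD i A = 0) (hB : ∀ i, lieD i B = 0) (hD0 : lieD 0 D = 0) (hD2 : lieD 2 D = 0) :
    extDeriv α = 0 := by
  obtain ⟨h1, h2, h3, h4⟩ := dTwo_jForm A B 0 D
  refine hα.extDeriv_eq_zero h ?_ ?_ ?_ ?_
  · rw [h1, hA, hB]; simp
  · rw [h2, hD0, hB]; simp
  · rw [h3, hA, hB]; simp
  · rw [h4, hD2, hB]; simp

end IsJForm

theorem exists_eq_smul_one (u : SmoothFun 𝕜) (h : ∀ i, lieD i u = 0) : ∃ c : 𝕜, u = c • 1 := by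
  obtain ⟨c, hc⟩ := exists_const_of_lieD_eq_zero u h
  exact ⟨c, SmoothFun.ext fun x => by simp [hc x]⟩

end Closed

/-! ### A basis of the anti-self-dual harmonic forms -/

section AntiSelfDualBasis

open SmoothFun AlmostHermitian

variable (f : ℝ → ℝ) (hf : ContDiff ℝ ∞ f) (hper : ∀ s, f (s + 1) = f s) (t : ℝ)

/-- The anti-self-dual forms `e¹³ - e^{-2tf(x₂)} e²⁴` and `e¹⁴ + e²³`. -/
noncomputable def antiSelfDualBasis : Fin 2 → Form 2 ℝ :=
  ![fun x => wedge₁₁ (e₁ x) (e₃ x) - Real.exp (-2 * t * f (x 1)) • wedge₁₁ (e₂ x) (e₄ x),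
    fun x => wedge₁₁ (e₁ x) (e₄ x) + wedge₁₁ (e₂ x) (e₃ x)]

theorem contDiff_antiSelfDualBasis {f : ℝ → ℝ} (hf : ContDiff ℝ ∞ f) (t : ℝ) (l : Fin 2) :
    ContDiff ℝ ∞ (antiSelfDualBasis f t l) := by
  have h : ContDiff ℝ ∞ (fun x : G => Real.exp (-2 * t * f (x 1))) :=
    (contDiff_const.mul (hf.comp (contDiff_coord 1))).exp
  fin_cases l
  · exact (contDiff_wedge₁₁ contDiff_const contDiff_e₃).sub
      (h.smul (contDiff_wedge₁₁ contDiff_const contDiff_const))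
  · exact (contDiff_wedge₁₁ contDiff_const contDiff_const).add
      (contDiff_wedge₁₁ contDiff_const contDiff_e₃)

theorem isJForm_antiSelfDualBasis :
    IsJForm (antiSelfDualBasis f t 0) 1 0 0 (-expFun f hf hper (-2 * t)) ∧
    IsJForm (antiSelfDualBasis f t 1) 0 1 0 0 := by
  constructor <;> refine isJForm_of ?_ ?_ ?_ ?_ ?_ ?_ <;> intro x <;>
    simp [antiSelfDualBasis, wedge₁₁_apply, coframe_frame, expFun_apply]

variable {f hf hper t} in
theorem mem_antiSelfDualHarmonic_of_isJForm {γ : Form 2 ℝ} (hsm : ContDiff ℝ ∞ γ)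
    {a b : SmoothFun ℝ} (hγ : IsJForm γ a b 0 (-(expFun f hf hper (-2 * t) * a)))
    (ha : ∀ i, lieD i a = 0) (hb : ∀ i, lieD i b = 0) :
    γ ∈ (ktStructure f hf hper t).antiSelfDualHarmonic := by
  have hs : (ktStructure f hf hper t).star2 γ = -γ := by
    refine (hγ.star2 (f := f) (hf := hf) (hper := hper) (t := t)).unique ?_
    convert hγ.neg using 1
    · linear_combination -a * expFun_mul_expFun_neg (𝕜 := ℝ) (f := f) (hf := hf) (hper := hper) t
    · ring
  have hd : extDeriv γ = 0 := hγ.extDeriv_eq_zero_of_const hsm ha hb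
    (by simp [ha, lieD_expFun]) (by simp [ha, lieD_expFun])
  have hd' : extDeriv (-γ) = 0 := (extDeriv_neg' (𝕜 := ℝ) hsm).trans (by rw [hd, neg_zero])
  refine ⟨hγ.isFormOnX hsm, hs, ?_⟩
  rw [hodgeLaplacian2, hs, hd, hd', star3_zero, neg_zero, extDeriv_zero', star2_zero, neg_zero,
    add_zero]

theorem antiSelfDualHarmonic_eq_span : (ktStructure f hf hper t).antiSelfDualHarmonic =
    Submodule.span ℝ (Set.range (antiSelfDualBasis f t)) := by
  obtain ⟨h0, h1⟩ := isJForm_antiSelfDualBasis f hf hper t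
  refine le_antisymm (fun γ h => ?_) (Submodule.span_le.2 ?_)
  · obtain ⟨a, b, c, hγ⟩ := isJForm_of_antiSelfDual h.1 h.2.1
    obtain ⟨rfl, ha, hb⟩ := coeff_of_antiSelfDualHarmonic h hγ
    obtain ⟨r, rfl⟩ := exists_eq_smul_one a ha
    obtain ⟨s, rfl⟩ := exists_eq_smul_one b hb
    have : γ = r • antiSelfDualBasis f t 0 + s • antiSelfDualBasis f t 1 := by
      refine hγ.unique ?_
      convert (h0.smul r).add (h1.smul s) using 1 <;> simp
    rw [this]
    exact add_mem (Submodule.smul_mem _ _ (Submodule.subset_span ⟨0, rfl⟩))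
      (Submodule.smul_mem _ _ (Submodule.subset_span ⟨1, rfl⟩))
  · rintro _ ⟨l, rfl⟩
    have hsm := contDiff_antiSelfDualBasis hf t l
    fin_cases l
    · exact mem_antiSelfDualHarmonic_of_isJForm hsm (a := 1) (by simpa using h0) lieD_one
        (fun i => by simp)
    · exact mem_antiSelfDualHarmonic_of_isJForm hsm (a := 0) (by simpa using h1) (fun i => by simp)
        lieD_one

theorem linearIndependent_antiSelfDualBasis : LinearIndependent ℝ (antiSelfDualBasis f t) := by
  rw [Fintype.linearIndependent_iff]
  intro c hc
  have h : ∀ i j, (∑ l, c l • antiSelfDualBasis f t l) 0 ![frame i 0, frame j 0] = 0 := by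
    intro i j; rw [hc]; rfl
  have h02 := h 0 2
  have h03 := h 0 3
  simp [Fin.sum_univ_two, antiSelfDualBasis, wedge₁₁_apply, coframe_frame] at h02 h03
  intro l
  fin_cases l
  · exact h02
  · exact h03

theorem bMinus_eq_two : (ktStructure f hf hper t).bMinus = 2 := by
  rw [bMinus, antiSelfDualHarmonic_eq_span,
    finrank_span_eq_card (linearIndependent_antiSelfDualBasis f t), Fintype.card_fin]

end AntiSelfDualBasis

/-! ### The `∂̄`-Laplacian on `(1, 1)`-forms -/

section DbarHarmonic

open SmoothFun AlmostHermitian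

theorem dbarLaplacian11_apply (S : AlmostHermitian) {ψ : Form 2 ℂ} (hψ : ContDiff ℝ ∞ ψ) (x : G) :
    S.dbarLaplacian11 ψ x =
      -(typeProj (S.J x) 2 1 (extDeriv (S.star3 (del S.J 1 (S.star2 ψ))) x)
        + star₂ (S.J x) (S.Ω x)
          (typeProj (S.J x) 2 1 (extDeriv (S.star3 (dbar S.J 1 ψ)) x))) := by
  have h1 := S.contDiff_star3 (contDiff_del S.J_smooth (S.contDiff_star2 hψ) 1)
  have h2 : dbar S.J 1 (S.dbarStar11 ψ) x =
      -typeProj (S.J x) 2 1 (extDeriv (S.star3 (del S.J 1 (S.star2 ψ))) x) := by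
    rw [dbarStar11, dbar, extDeriv_neg' h1, Pi.neg_apply, map_neg]
  rw [dbarLaplacian11, Pi.add_apply, h2, neg_add]
  rfl

/-- The component of type `(2, 1)` of a `3`-form, in the frame; it is determined by its values on
`E₁, E₂, E₃` and `E₁, E₂, E₄`. -/
theorem typeProj_three_two_frame (x : G) (α : G [⋀^Fin 3]→L[ℝ] ℂ) :
    typeProj (ktJ x) 3 2 α ![frame 0 x, frame 1 x, frame 2 x] =
      (α ![frame 0 x, frame 1 x, frame 2 x]
        + Complex.I * α ![frame 0 x, frame 2 x, frame 3 x]) / 2 ∧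
    typeProj (ktJ x) 3 2 α ![frame 0 x, frame 1 x, frame 3 x] =
      (α ![frame 0 x, frame 1 x, frame 3 x]
        + Complex.I * α ![frame 1 x, frame 2 x, frame 3 x]) / 2 ∧
    typeProj (ktJ x) 3 2 α ![frame 0 x, frame 2 x, frame 3 x] =
      -Complex.I * ((α ![frame 0 x, frame 1 x, frame 2 x]
        + Complex.I * α ![frame 0 x, frame 2 x, frame 3 x]) / 2) ∧
    typeProj (ktJ x) 3 2 α ![frame 1 x, frame 2 x, frame 3 x] =
      -Complex.I * ((α ![frame 0 x, frame 1 x, frame 3 x]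
        + Complex.I * α ![frame 1 x, frame 2 x, frame 3 x]) / 2) := by
  obtain ⟨h0, h1, h2, h3⟩ := jDer_three_frame x α
  have hI := Complex.I_mul_I
  simp only [typeProj_three_two, ContinuousAlternatingMap.smul_apply,
    ContinuousAlternatingMap.sub_apply, smul_eq_mul, h0, h1, h2, h3]
  refine ⟨by ring, by ring, ?_, ?_⟩
  · linear_combination (α ![frame 0 x, frame 2 x, frame 3 x] / 2) * hI
  · linear_combination (α ![frame 1 x, frame 2 x, frame 3 x] / 2) * hI

/-- The component of type `(1, 2)` of a `3`-form, in the frame. -/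
theorem typeProj_three_one_frame (x : G) (α : G [⋀^Fin 3]→L[ℝ] ℂ) :
    typeProj (ktJ x) 3 1 α ![frame 0 x, frame 1 x, frame 2 x] =
      (α ![frame 0 x, frame 1 x, frame 2 x]
        - Complex.I * α ![frame 0 x, frame 2 x, frame 3 x]) / 2 ∧
    typeProj (ktJ x) 3 1 α ![frame 0 x, frame 1 x, frame 3 x] =
      (α ![frame 0 x, frame 1 x, frame 3 x]
        - Complex.I * α ![frame 1 x, frame 2 x, frame 3 x]) / 2 ∧
    typeProj (ktJ x) 3 1 α ![frame 0 x, frame 2 x, frame 3 x] =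
      Complex.I * ((α ![frame 0 x, frame 1 x, frame 2 x]
        - Complex.I * α ![frame 0 x, frame 2 x, frame 3 x]) / 2) ∧
    typeProj (ktJ x) 3 1 α ![frame 1 x, frame 2 x, frame 3 x] =
      Complex.I * ((α ![frame 0 x, frame 1 x, frame 3 x]
        - Complex.I * α ![frame 1 x, frame 2 x, frame 3 x]) / 2) := by
  obtain ⟨h0, h1, h2, h3⟩ := jDer_three_frame x α
  have hI := Complex.I_mul_I
  simp only [typeProj_three_one, ContinuousAlternatingMap.smul_apply,
    ContinuousAlternatingMap.add_apply, smul_eq_mul, h0, h1, h2, h3]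
  refine ⟨by ring, by ring, ?_, ?_⟩
  · linear_combination (α ![frame 0 x, frame 2 x, frame 3 x] / 2) * hI
  · linear_combination (α ![frame 1 x, frame 2 x, frame 3 x] / 2) * hI

variable {f : ℝ → ℝ} {hf : ContDiff ℝ ∞ f} {hper : ∀ s, f (s + 1) = f s} {t : ℝ}

theorem isJForm_of_hasType {ψ : Form 2 ℂ} (h : IsFormOnX ψ) (ht : ∀ x, HasType (ktJ x) 1 (ψ x)) :
    ∃ A B C D, IsJForm ψ A B C D :=
  ⟨coeff ψ h 0 2, coeff ψ h 0 3, coeff ψ h 0 1, coeff ψ h 1 3, isJForm_of (fun _ => rfl)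
    (fun _ => rfl) (fun x => ((hasType_one_one_iff x _).1 (ht x)).1) (fun _ => rfl)
    (fun x => ((hasType_one_one_iff x _).1 (ht x)).2) (fun _ => rfl)⟩

theorem IsJForm.hasType {ψ : Form 2 ℂ} {A B C D : SmoothFun ℂ} (h : IsJForm ψ A B C D) (x : G) :
    HasType (ktJ x) 1 (ψ x) :=
  (hasType_one_one_iff x _).2 ⟨(h 1 2 x).trans (h 0 3 x).symm, (h 2 3 x).trans (h 0 1 x).symm⟩

theorem exists_half (u : SmoothFun ℂ) :
    ∃ X : SmoothFun ℂ, 2 * X = u ∧ ∀ x, (X : G → ℂ) x = (u : G → ℂ) x / 2 :=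
  ⟨(1 / 2 : ℂ) • u, by
    rw [two_mul, ← add_smul, add_halves, one_smul],
    fun x => by
      change (1 / 2 : ℂ) * (u : G → ℂ) x = _
      ring⟩

/-- The coefficients of `⋆∂α` for a `(1, 1)`-form `α`; `X` and `Y` are the coefficients of `∂α`
along `e¹²³` and `e¹²⁴`. -/
theorem star3_del_coeff {α : Form 2 ℂ} {A B C D : SmoothFun ℂ} (hsm : ContDiff ℝ ∞ α)
    (hα : IsJForm α A B C D) : ∃ (X Y : SmoothFun ℂ) (q : Fin 4 → SmoothFun ℂ),
      (2 * X = dTwo (jForm A B C D) 0 1 2 + imUnit * dTwo (jForm A B C D) 0 2 3 ∧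
        2 * Y = dTwo (jForm A B C D) 0 1 3 + imUnit * dTwo (jForm A B C D) 1 2 3) ∧
      (q 0 = -(imUnit * Y) ∧ q 1 = imUnit * expFun f hf hper (-2 * t) * X ∧ q 2 = Y ∧
        q 3 = -(expFun f hf hper (-2 * t) * X)) ∧
      ∀ i x, (ktStructure f hf hper t).star3 (del ktJ 1 α) x ![frame i x] = (q i : G → ℂ) x := by
  have hd := fun i j k x => extDeriv_two hsm hα i j k x
  have key := fun x => typeProj_three_two_frame x (extDeriv α x)
  simp only [hd] at key
  obtain ⟨X, hX, hXx⟩ := exists_half (dTwo (jForm A B C D) 0 1 2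
    + imUnit * dTwo (jForm A B C D) 0 2 3)
  obtain ⟨Y, hY, hYx⟩ := exists_half (dTwo (jForm A B C D) 0 1 3
    + imUnit * dTwo (jForm A B C D) 1 2 3)
  have hXx : ∀ x, (X : G → ℂ) x = ((dTwo (jForm A B C D) 0 1 2 : G → ℂ) x
      + Complex.I * (dTwo (jForm A B C D) 0 2 3 : G → ℂ) x) / 2 := hXx
  have hYx : ∀ x, (Y : G → ℂ) x = ((dTwo (jForm A B C D) 0 1 3 : G → ℂ) x
      + Complex.I * (dTwo (jForm A B C D) 1 2 3 : G → ℂ) x) / 2 := hYx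
  simp only [← hXx, ← hYx] at key
  obtain ⟨q, ⟨q0, q1, q2, q3⟩, hq⟩ := star3_coeff (f := f) (hf := hf) (hper := hper) (t := t)
    (η := del ktJ 1 α) (a := X) (b := Y) (c := -imUnit * X) (d := -imUnit * Y)
    (fun x => (key x).1) (fun x => (key x).2.1) (fun x => (key x).2.2.1) (fun x => (key x).2.2.2)
  exact ⟨X, Y, q, ⟨hX, hY⟩, ⟨by rw [q0]; ring, by rw [q1]; ring, q2, q3⟩, hq⟩

/-- The coefficients of `⋆∂̄α` for a `(1, 1)`-form `α`; `Z` and `W` are the coefficients of `∂̄α`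
along `e¹²³` and `e¹²⁴`. -/
theorem star3_dbar_coeff {α : Form 2 ℂ} {A B C D : SmoothFun ℂ} (hsm : ContDiff ℝ ∞ α)
    (hα : IsJForm α A B C D) : ∃ (Z W : SmoothFun ℂ) (p : Fin 4 → SmoothFun ℂ),
      (2 * Z = dTwo (jForm A B C D) 0 1 2 - imUnit * dTwo (jForm A B C D) 0 2 3 ∧
        2 * W = dTwo (jForm A B C D) 0 1 3 - imUnit * dTwo (jForm A B C D) 1 2 3) ∧
      (p 0 = imUnit * W ∧ p 1 = -(imUnit * expFun f hf hper (-2 * t) * Z) ∧ p 2 = W ∧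
        p 3 = -(expFun f hf hper (-2 * t) * Z)) ∧
      ∀ i x, (ktStructure f hf hper t).star3 (dbar ktJ 1 α) x ![frame i x] = (p i : G → ℂ) x := by
  have hd := fun i j k x => extDeriv_two hsm hα i j k x
  have key := fun x => typeProj_three_one_frame x (extDeriv α x)
  simp only [hd] at key
  obtain ⟨Z, hZ, hZx⟩ := exists_half (dTwo (jForm A B C D) 0 1 2
    - imUnit * dTwo (jForm A B C D) 0 2 3)
  obtain ⟨W, hW, hWx⟩ := exists_half (dTwo (jForm A B C D) 0 1 3
    - imUnit * dTwo (jForm A B C D) 1 2 3)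
  have hZx : ∀ x, (Z : G → ℂ) x = ((dTwo (jForm A B C D) 0 1 2 : G → ℂ) x
      - Complex.I * (dTwo (jForm A B C D) 0 2 3 : G → ℂ) x) / 2 := hZx
  have hWx : ∀ x, (W : G → ℂ) x = ((dTwo (jForm A B C D) 0 1 3 : G → ℂ) x
      - Complex.I * (dTwo (jForm A B C D) 1 2 3 : G → ℂ) x) / 2 := hWx
  simp only [← hZx, ← hWx] at key
  obtain ⟨p, ⟨p0, p1, p2, p3⟩, hp⟩ := star3_coeff (f := f) (hf := hf) (hper := hper) (t := t)
    (η := dbar ktJ 1 α) (a := Z) (b := W) (c := imUnit * Z) (d := imUnit * W)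
    (fun x => (key x).1) (fun x => (key x).2.1) (fun x => (key x).2.2.1) (fun x => (key x).2.2.2)
  exact ⟨Z, W, p, ⟨hZ, hW⟩, ⟨p0, by rw [p1]; ring, p2, p3⟩, hp⟩

/-- The coefficients of a `∂̄`-harmonic `(1, 1)`-form are constants, up to the factor `e^{2tf(x₂)}`
for the last one. -/
theorem coeff_of_harmonic11 {ψ : Form 2 ℂ} (h : ψ ∈ (ktStructure f hf hper t).harmonic11)
    {A B C D : SmoothFun ℂ} (hψ : IsJForm ψ A B C D) :
    C = 0 ∧ (∀ i, lieD i A = 0) ∧ (∀ i, lieD i B = 0) ∧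
      ∀ i, lieD i (expFun f hf hper (2 * t) * D) = 0 := by
  obtain ⟨⟨hsm, hinv⟩, -, hl⟩ := h
  have hss := (ktStructure f hf hper t).contDiff_star2 hsm
  have hsq := (ktStructure f hf hper t).contDiff_star3 (contDiff_del contDiff_ktJ hss 1)
  have hsp := (ktStructure f hf hper t).contDiff_star3 (contDiff_dbar contDiff_ktJ hsm 1)
  obtain ⟨X, Y, q, ⟨hX, hY⟩, ⟨q0, q1, q2, q3⟩, hq⟩ := star3_del_coeff (f := f) (hf := hf)
    (hper := hper) (t := t) hss (hψ.star2 (f := f) (hf := hf) (hper := hper) (t := t))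
  obtain ⟨Z, W, p, ⟨hZ, hW⟩, ⟨p0, p1, p2, p3⟩, hp⟩ := star3_dbar_coeff (f := f) (hf := hf)
    (hper := hper) (t := t) hsm hψ
  have hl' : ∀ x, typeProj (ktJ x) 2 1
      (extDeriv ((ktStructure f hf hper t).star3 (del ktJ 1 ((ktStructure f hf hper t).star2 ψ))) x)
      + star₂ (ktJ x) (ktΩ f t x) (typeProj (ktJ x) 2 1
        (extDeriv ((ktStructure f hf hper t).star3 (dbar ktJ 1 ψ)) x)) = 0 := fun x => by
    have := (dbarLaplacian11_apply _ hsm x).symm.trans (congrFun hl x)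
    exact neg_eq_zero.1 this
  -- From here on only the coefficients `q` and `p` of these two `1`-forms matter.
  generalize (ktStructure f hf hper t).star3
    (del ktJ 1 ((ktStructure f hf hper t).star2 ψ)) = θ at hsq hq hl'
  generalize (ktStructure f hf hper t).star3 (dbar ktJ 1 ψ) = χ at hsp hp hl'
  have hdq := extDeriv_one hsq hq
  have hdp := extDeriv_one hsp hp
  have hE : IsPositive (expFun f hf hper (2 * t) : SmoothFun ℂ) := isPositive_expFun _
  have hF : IsPositive (expFun f hf hper (-2 * t) : SmoothFun ℂ) := isPositive_expFun _
  have hEF := expFun_mul_expFun_neg (𝕜 := ℂ) (f := f) (hf := hf) (hper := hper) t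
  have hEx := fun x => expFun_apply (𝕜 := ℂ) (f := f) (hf := hf) (hper := hper) (2 * t) x
  have hFx := fun x => expFun_apply (𝕜 := ℂ) (f := f) (hf := hf) (hper := hper) (-2 * t) x
  have key : ∀ i j x, typeProj (ktJ x) 2 1 (extDeriv θ x) ![frame i x, frame j x]
      + star₂ (ktJ x) (ktΩ f t x) (typeProj (ktJ x) 2 1 (extDeriv χ x)) ![frame i x, frame j x]
        = 0 := fun i j x => by
    rw [← ContinuousAlternatingMap.add_apply, hl']; rfl
  have kq := fun x => typeProj_two_one_frame x (extDeriv θ x)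
  have kp := fun x => typeProj_two_one_frame x (extDeriv χ x)
  have ks := fun x => star₂_frame f t x (typeProj (ktJ x) 2 1 (extDeriv χ x))
  simp only [hdq] at kq
  simp only [hdp] at kp
  have e02 : dOne q 0 2 + expFun f hf hper (2 * t) * dOne p 1 3 = 0 := SmoothFun.ext fun x => by
    have := key 0 2 x
    rw [(kq x).2.1, (ks x).2.1, (kp x).2.2.2.2.1, Complex.real_smul] at this
    exact this
  have e13 : dOne q 1 3 + expFun f hf hper (-2 * t) * dOne p 0 2 = 0 := SmoothFun.ext fun x => by
    have := key 1 3 x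
    rw [(kq x).2.2.2.2.1, (ks x).2.2.2.2.1, (kp x).2.1, Complex.real_smul] at this
    exact this
  have e01 : dOne q 0 1 + dOne q 2 3 = dOne p 0 1 + dOne p 2 3 := SmoothFun.ext fun x => by
    have := key 0 1 x
    rw [(kq x).1, (ks x).1, (kp x).2.2.2.2.2] at this
    change (dOne q 0 1 : G → ℂ) x + (dOne q 2 3 : G → ℂ) x =
      (dOne p 0 1 : G → ℂ) x + (dOne p 2 3 : G → ℂ) x
    linear_combination 2 * this
  have e03 : dOne q 0 3 + dOne q 1 2 = dOne p 0 3 + dOne p 1 2 := SmoothFun.ext fun x => by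
    have := key 0 3 x
    rw [(kq x).2.2.1, (ks x).2.2.1, (kp x).2.2.2.1] at this
    change (dOne q 0 3 : G → ℂ) x + (dOne q 1 2 : G → ℂ) x =
      (dOne p 0 3 : G → ℂ) x + (dOne p 1 2 : G → ℂ) x
    linear_combination 2 * this
  obtain ⟨rfl, rfl, rfl, rfl⟩ := dbar_energy hE hF hEF hX hY hZ hW q0 q1 q2 q3 p0 p1 p2 p3
    e02 e13 e01 e03
  rw [mul_zero] at hX hY hZ hW
  have hD : expFun f hf hper (-2 * t) * (expFun f hf hper (2 * t) * D) = D := by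
    linear_combination D * hEF
  refine dbar_coclosed hF (lieD_expFun _ (by decide)) (lieD_expFun _ (by decide))
    (lieD_expFun _ (by decide)) hX.symm hY.symm ?_ ?_
  · rw [hD]; exact hZ.symm
  · rw [hD]; exact hW.symm

end DbarHarmonic

/-! ### A basis of the `∂̄`-harmonic `(1, 1)`-forms -/

section DbarHarmonicBasis

open SmoothFun AlmostHermitian

variable {f : ℝ → ℝ} {hf : ContDiff ℝ ∞ f} {hper : ∀ s, f (s + 1) = f s} {t : ℝ}

/-- A form with constant coefficients, up to the factor `e^{-2tf(x₂)}` for the last one, is closed,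
and so is its Hodge dual. -/
theorem mem_harmonic11_of_isJForm {ψ : Form 2 ℂ} (hsm : ContDiff ℝ ∞ ψ) {A B D : SmoothFun ℂ}
    (hψ : IsJForm ψ A B 0 (expFun f hf hper (-2 * t) * D)) (hA : ∀ i, lieD i A = 0)
    (hB : ∀ i, lieD i B = 0) (hD : ∀ i, lieD i D = 0) :
    ψ ∈ (ktStructure f hf hper t).harmonic11 := by
  have hss := (ktStructure f hf hper t).contDiff_star2 hsm
  have hEF := expFun_mul_expFun_neg (𝕜 := ℂ) (f := f) (hf := hf) (hper := hper) t
  have hs : IsJForm ((ktStructure f hf hper t).star2 ψ) D (-B) 0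
      (expFun f hf hper (-2 * t) * A) := by
    convert hψ.star2 (f := f) (hf := hf) (hper := hper) (t := t) using 1
    · linear_combination -D * hEF
    · simp
  have hd : extDeriv ψ = 0 := hψ.extDeriv_eq_zero_of_const hsm hA hB
    (by simp [hD, lieD_expFun]) (by simp [hD, lieD_expFun])
  have hds : extDeriv ((ktStructure f hf hper t).star2 ψ) = 0 :=
    hs.extDeriv_eq_zero_of_const hss hD (fun i => by simp [hB])
      (by simp [hA, lieD_expFun]) (by simp [hA, lieD_expFun])
  have h1 : dbar (ktStructure f hf hper t).J 1 ψ = 0 := by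
    funext x; rw [dbar, hd, Pi.zero_apply, map_zero]
  have h2 : del (ktStructure f hf hper t).J 1 ((ktStructure f hf hper t).star2 ψ) = 0 := by
    funext x; rw [del, hds, Pi.zero_apply, map_zero]
  refine ⟨hψ.isFormOnX hsm, hψ.hasType, funext fun x => ?_⟩
  rw [dbarLaplacian11_apply _ hsm, h1, h2, star3_zero, extDeriv_zero', Pi.zero_apply, map_zero,
    zero_add]
  exact neg_eq_zero.2 (congrFun (star2_zero (𝕜 := ℂ) (ktStructure f hf hper t)) x)

variable (f hf hper t)

/-- The `(1, 1)`-forms `φ^{1\bar 1}`, `φ^{1\bar 2} + φ^{2\bar 1}` and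
`e^{-2tf(x₂)} φ^{2\bar 2}`. -/
noncomputable def dbarHarmonicBasis : Fin 3 → Form 2 ℂ :=
  ![fun x => wedge₁₁ (φ₁ x) (conj (φ₁ x)),
    fun x => wedge₁₁ (φ₁ x) (conj (φ₂ x)) + wedge₁₁ (φ₂ x) (conj (φ₁ x)),
    fun x => (Real.exp (-2 * t * f (x 1)) : ℂ) • wedge₁₁ (φ₂ x) (conj (φ₂ x))]

theorem contDiff_dbarHarmonicBasis {f : ℝ → ℝ} (hf : ContDiff ℝ ∞ f) (t : ℝ) (l : Fin 3) :
    ContDiff ℝ ∞ (dbarHarmonicBasis f t l) := by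
  have h : ContDiff ℝ ∞ (fun x : G => ((Real.exp (-2 * t * f (x 1)) : ℝ) : ℂ)) :=
    Complex.ofRealCLM.contDiff.comp (contDiff_const.mul (hf.comp (contDiff_coord 1))).exp
  -- Each of the forms is a complex multiple of a real form.
  have h0 : dbarHarmonicBasis f t 0 =
      fun x => (wedge₁₁ (e₁ x) (e₃ x)).smulRight (-2 * Complex.I) := by
    funext x; ext v
    simp [dbarHarmonicBasis, wedge₁₁_apply, φ₁, conj]; ring
  have h1 : dbarHarmonicBasis f t 1 = fun x =>
      (wedge₁₁ (e₁ x) (e₄ x) + wedge₁₁ (e₂ x) (e₃ x)).smulRight (-2 * Complex.I) := by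
    funext x; ext v
    simp [dbarHarmonicBasis, wedge₁₁_apply, φ₁, φ₂, conj]
    linear_combination (-(e₃ x (v 0) : ℂ) * e₄ x (v 1) + e₃ x (v 1) * e₄ x (v 0)
      - e₄ x (v 0) * e₃ x (v 1) + e₄ x (v 1) * e₃ x (v 0)) * Complex.I_mul_I
  have h2 : dbarHarmonicBasis f t 2 = fun x => (wedge₁₁ (e₂ x) (e₄ x)).smulRight
      ((Real.exp (-2 * t * f (x 1)) : ℂ) * (-2 * Complex.I)) := by
    funext x; ext v
    simp [dbarHarmonicBasis, wedge₁₁_apply, φ₂, conj]; ring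
  fin_cases l
  · exact h0 ▸ contDiff_smulRight (contDiff_wedge₁₁ contDiff_const contDiff_e₃) contDiff_const
  · exact h1 ▸ contDiff_smulRight ((contDiff_wedge₁₁ contDiff_const contDiff_const).add
      (contDiff_wedge₁₁ contDiff_const contDiff_e₃)) contDiff_const
  · exact h2 ▸ contDiff_smulRight (contDiff_wedge₁₁ contDiff_const contDiff_const)
      (h.mul contDiff_const)

theorem isJForm_dbarHarmonicBasis :
    IsJForm (dbarHarmonicBasis f t 0) ((-2 * Complex.I) • 1) 0 0 0 ∧
    IsJForm (dbarHarmonicBasis f t 1) 0 ((-2 * Complex.I) • 1) 0 0 ∧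
    IsJForm (dbarHarmonicBasis f t 2) 0 0 0
      (expFun f hf hper (-2 * t) * (-2 * Complex.I) • 1) := by
  refine ⟨?_, ?_, ?_⟩ <;> refine isJForm_of ?_ ?_ ?_ ?_ ?_ ?_ <;> intro x <;>
    simp [dbarHarmonicBasis, wedge₁₁_apply, coframe_frame, expFun_apply, φ₁, φ₂, conj] <;>
    ring

theorem harmonic11_eq_span : (ktStructure f hf hper t).harmonic11 =
    Submodule.span ℂ (Set.range (dbarHarmonicBasis f t)) := by
  obtain ⟨h0, h1, h2⟩ := isJForm_dbarHarmonicBasis f hf hper t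
  refine le_antisymm (fun ψ h => ?_) (Submodule.span_le.2 ?_)
  · obtain ⟨A, B, C, D, hψ⟩ := isJForm_of_hasType h.1 h.2.1
    obtain ⟨rfl, hA, hB, hD⟩ := coeff_of_harmonic11 h hψ
    obtain ⟨r, rfl⟩ := exists_eq_smul_one A hA
    obtain ⟨s, rfl⟩ := exists_eq_smul_one B hB
    obtain ⟨u, hu⟩ := exists_eq_smul_one _ hD
    have hD' : D = expFun f hf hper (-2 * t) * u • 1 := by
      rw [← hu]
      linear_combination
        -D * expFun_mul_expFun_neg (𝕜 := ℂ) (f := f) (hf := hf) (hper := hper) t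
    -- The coefficients of the basis are multiples of `-2i`, and `(i/2) (-2i) = 1`.
    have hI : ∀ z : ℂ, z * (Complex.I / 2) * (-2 * Complex.I) = z := fun z => by
      linear_combination -z * Complex.I_mul_I
    have : ψ = (r * (Complex.I / 2)) • dbarHarmonicBasis f t 0
        + (s * (Complex.I / 2)) • dbarHarmonicBasis f t 1
        + (u * (Complex.I / 2)) • dbarHarmonicBasis f t 2 := by
      refine hψ.unique ?_
      convert ((h0.smul _).add (h1.smul _)).add (h2.smul _) using 1
      · rw [smul_smul, hI]; simp
      · rw [smul_smul, hI]; simp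
      · simp
      · rw [hD', mul_smul_comm, mul_smul_comm, smul_smul, hI]; simp
    rw [this]
    exact add_mem (add_mem (Submodule.smul_mem _ _ (Submodule.subset_span ⟨0, rfl⟩))
      (Submodule.smul_mem _ _ (Submodule.subset_span ⟨1, rfl⟩)))
      (Submodule.smul_mem _ _ (Submodule.subset_span ⟨2, rfl⟩))
  · rintro _ ⟨l, rfl⟩
    have hsm := contDiff_dbarHarmonicBasis hf t l
    fin_cases l
    · exact mem_harmonic11_of_isJForm hsm (D := 0) (by rwa [mul_zero])
        (fun i => lieD_smul_one i _) (fun i => by simp) (fun i => by simp)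
    · exact mem_harmonic11_of_isJForm hsm (D := 0) (by rwa [mul_zero]) (fun i => by simp)
        (fun i => lieD_smul_one i _) (fun i => by simp)
    · exact mem_harmonic11_of_isJForm hsm h2 (fun i => by simp) (fun i => by simp)
        (fun i => lieD_smul_one i _)

theorem linearIndependent_dbarHarmonicBasis : LinearIndependent ℂ (dbarHarmonicBasis f t) := by
  rw [Fintype.linearIndependent_iff]
  intro c hc
  have h : ∀ i j, (∑ l, c l • dbarHarmonicBasis f t l) 0 ![frame i 0, frame j 0] = 0 := by
    intro i j; rw [hc]; rfl
  have h02 := h 0 2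
  have h03 := h 0 3
  have h13 := h 1 3
  simp [Fin.sum_univ_three, dbarHarmonicBasis, wedge₁₁_apply, coframe_frame, φ₁, φ₂, conj,
    ← two_mul, ← neg_add', ← sub_eq_add_neg] at h02 h03 h13
  intro l
  fin_cases l
  · exact h02
  · exact h03
  · exact h13

theorem h11_eq_three : (ktStructure f hf hper t).h11 = 3 := by
  rw [h11, harmonic11_eq_span,
    finrank_span_eq_card (linearIndependent_dbarHarmonicBasis f t), Fintype.card_fin]

end DbarHarmonicBasis

/-! ### The structure equations, and the fundamental forms -/

section Structure

open SmoothFun AlmostHermitian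

theorem φ_comp_ktJ (x v : G) :
    φ₁ x (ktJ x v) = Complex.I * φ₁ x v ∧ φ₂ x (ktJ x v) = Complex.I * φ₂ x v := by
  have hI := Complex.I_mul_I
  constructor
  · simp [φ₁, ktJ_apply, e₁, e₃, dx]
    linear_combination (-(v 2 : ℂ) + x 0 * v 1) * hI
  · simp [φ₂, ktJ_apply, e₂, e₄, dx]
    linear_combination (-(v 3 : ℂ)) * hI

theorem extDeriv_φ₁ (x : G) : extDeriv (oneForm φ₁) x =
    -(Complex.I / 4) • wedge₁₁ (φ₁ x) (φ₂ x)
      - (Complex.I / 4) • wedge₁₁ (φ₁ x) (conj (φ₂ x))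
      + (Complex.I / 4) • wedge₁₁ (φ₂ x) (conj (φ₁ x))
      - (Complex.I / 4) • wedge₁₁ (conj (φ₁ x)) (conj (φ₂ x)) := by
  have hφ : ContDiff ℝ ∞ φ₁ :=
    (contDiff_const (c := Complex.ofRealCLM ∘L dx 0)).add
      (((contDiff_const (c := Complex.ofRealCLM)).clm_comp contDiff_e₃).const_smul Complex.I)
  have hsm : ContDiff ℝ ∞ (oneForm φ₁) :=
    (ContinuousAlternatingMap.ofSubsingletonLIE (𝕜 := ℝ) (E := G) (F := ℂ)
      (0 : Fin 1)).contDiff.comp hφ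
  obtain ⟨q, hq⟩ : ∃ q : Fin 4 → SmoothFun ℂ,
      q = fun i => algebraMap ℂ _ (![1, 0, Complex.I, 0] i) := ⟨_, rfl⟩
  have h : ∀ i x, oneForm φ₁ x ![frame i x] = (q i : G → ℂ) x := fun i x => by
    rw [hq]
    change φ₁ x (frame i x) = ![1, 0, Complex.I, 0] i
    fin_cases i <;> simp [φ₁, coframe_frame]
  have hd := fun i j => extDeriv_one hsm h i j x
  have hb : ∀ i j, (dOne q i j : G → ℂ) x = -((brk i j : ℂ) * Complex.I) := fun i j => by
    have : dOne q i j = -(brk i j • algebraMap ℂ (SmoothFun ℂ) Complex.I) := by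
      simp [dOne, hq]
    rw [this]
    change -(brk i j • Complex.I) = _
    rw [zsmul_eq_mul]
  refine ext₂' x ?_ ?_ ?_ ?_ ?_ ?_ <;> rw [hd, hb] <;>
    simp [brk, wedge₁₁_apply, coframe_frame, φ₁, φ₂, conj]
  ring

theorem extDeriv_φ₂ : extDeriv (oneForm φ₂) = 0 := by
  funext x
  have : oneForm φ₂ = fun _ => oneForm φ₂ 0 := rfl
  rw [this, extDeriv, fderiv_const_apply]
  ext v
  simp [ContinuousAlternatingMap.alternatizeUncurryFin_apply]

/-- The Nijenhuis tensor of `J` on `E₁, E₂` is `-[E₁, E₂] = -E₃`. -/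
theorem not_isIntegrable_ktJ : ¬ IsIntegrable ktJ := by
  intro h
  have h0 := h (frame 0) (frame 1) (contDiff_frame 0) (contDiff_frame 1) 0
  have hJ := ktJ_frame
  simp only [nijenhuis, hJ, lieBracket_frame] at h0
  have h2 := congrFun h0 2
  simp [brk, frame_two] at h2

theorem wedge_apply_three {A : Type} [RCLike A] (θ : G →L[ℝ] A) (β : G [⋀^Fin 2]→L[ℝ] A)
    (u v w : G) :
    wedge θ β ![u, v, w] = θ u * β ![v, w] - θ v * β ![u, w] + θ w * β ![u, v] := by
  rw [wedge, ContinuousAlternatingMap.alternatizeUncurryFin_apply]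
  have h0 : (0 : Fin 3).removeNth ![u, v, w] = ![v, w] := by
    funext i; fin_cases i <;> rfl
  have h1 : (1 : Fin 3).removeNth ![u, v, w] = ![u, w] := by
    funext i; fin_cases i <;> rfl
  have h2 : (2 : Fin 3).removeNth ![u, v, w] = ![u, v] := by
    funext i; fin_cases i <;> rfl
  simp [Fin.sum_univ_three, h0, h1, h2, sub_eq_add_neg]

variable {f : ℝ → ℝ} (hf : ContDiff ℝ ∞ f) (hper : ∀ s, f (s + 1) = f s) (t : ℝ)

theorem isJForm_ktΩ : IsJForm (ktΩ f t) (expFun f hf hper (2 * t)) 0 0 1 := by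
  refine isJForm_of ?_ ?_ ?_ ?_ ?_ ?_ <;> intro x <;>
    simp [ktΩ, wedge₁₁_apply, coframe_frame, expFun_apply]

theorem hasFDerivAt_comp_coord {f : ℝ → ℝ} (hf : ContDiff ℝ ∞ f) (x : G) :
    HasFDerivAt (fun y : G => f (y 1)) (deriv f (x 1) • dx 1) x := by
  have h1 : HasFDerivAt (fun y : G => y 1) (dx 1) x :=
    (ContinuousLinearMap.proj (R := ℝ) (φ := fun _ : Fin 4 => ℝ) 1).hasFDerivAt
  exact (hf.differentiable (by simp) (x 1)).hasDerivAt.comp_hasFDerivAt x h1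

theorem lieD_one_expFun (s : ℝ) (x : G) : (lieD 1 (expFun f hf hper s : SmoothFun ℝ) : G → ℝ) x =
    s * Real.exp (s * f (x 1)) * deriv f (x 1) := by
  have h := (((hasFDerivAt_comp_coord hf x).const_mul s).exp).fderiv
  rw [lieD_apply]
  change fderiv ℝ (fun y : G => Real.exp (s * f (y 1))) x (frame 1 x) = _
  rw [h]
  simp [frame_one, dx]
  ring

theorem extDeriv_ktΩ {f : ℝ → ℝ} (hf : ContDiff ℝ ∞ f) (hper : ∀ s, f (s + 1) = f s) (t : ℝ)
    (x : G) : extDeriv (ktΩ f t) x =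
    (-2 * t * Real.exp (2 * t * f (x 1)) * deriv f (x 1)) • wedge₁₁₁ (e₁ x) (e₂ x) (e₃ x) := by
  have hd := fun i j k => extDeriv_two (ktStructure f hf hper t).Ω_form.1
    (isJForm_ktΩ hf hper t) i j k x
  obtain ⟨h1, h2, h3, h4⟩ := dTwo_jForm (expFun f hf hper (2 * t) : SmoothFun ℝ) 0 0 1
  refine ext₃ x ?_ ?_ ?_ ?_ <;> refine (hd _ _ _).trans ?_
  · have : dTwo (jForm (expFun f hf hper (2 * t) : SmoothFun ℝ) 0 0 1) 0 1 2 =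
        -lieD 1 (expFun f hf hper (2 * t)) := by rw [h1]; simp
    rw [this]
    change -((lieD 1 (expFun f hf hper (2 * t) : SmoothFun ℝ) : G → ℝ) x) = _
    rw [lieD_one_expFun]
    simp [wedge₁₁₁, wedge_apply_three, wedge₁₁_apply, coframe_frame]
  · rw [h2]; simp [lieD_one, wedge₁₁₁, wedge_apply_three, wedge₁₁_apply, coframe_frame]
  · rw [h3]; simp [lieD_expFun, wedge₁₁₁, wedge_apply_three, wedge₁₁_apply, coframe_frame]
  · rw [h4]; simp [lieD_one, wedge₁₁₁, wedge_apply_three, wedge₁₁_apply, coframe_frame]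

theorem extDeriv_ktΩ_eq_wedge {f : ℝ → ℝ} (hf : ContDiff ℝ ∞ f) (hper : ∀ s, f (s + 1) = f s)
    (t : ℝ) (x : G) : extDeriv (ktΩ f t) x =
    wedge (fderiv ℝ (fun y : G => 2 * t * f (y 1)) x) (ktΩ f t x) := by
  have he : dx 1 = e₂ x := rfl
  rw [extDeriv_ktΩ hf hper, ((hasFDerivAt_comp_coord hf x).const_mul (2 * t)).fderiv, he]
  refine ext₃ x ?_ ?_ ?_ ?_ <;>
    simp [wedge₁₁₁, wedge_apply_three, wedge₁₁_apply, coframe_frame, ktΩ]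
  ring

theorem isGloballyConformallyKahler_ktStructure :
    (ktStructure f hf hper t).IsGloballyConformallyKahler := by
  refine ⟨Quotient.lift (fun y : G => 2 * t * f (y 1)) ?_, ?_, fun x =>
    extDeriv_ktΩ_eq_wedge hf hper t x⟩
  · rintro x _ ⟨γ, hγ, rfl⟩
    obtain ⟨n, hn⟩ := hγ 1
    have hP : Function.Periodic f 1 := hper
    have : f (γ 1 + x 1) = f (x 1) := by
      rw [hn, add_comm]; simpa using hP.int_mul n (x 1)
    simp [mul, this]
  · exact contDiff_const.mul (hf.comp (contDiff_coord 1))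

theorem invariantForm_ktΩ_iff (hne : ∃ s, deriv f s ≠ 0) :
    InvariantForm Set.univ (ktΩ f t) ↔ t = 0 := by
  constructor
  · intro h
    by_contra ht
    -- Invariance under the translation by `(0, s, 0, 0)` forces `f s = f 0`.
    have hc : ∀ s, f s = f 0 := fun s => by
      have h1 := congrArg (fun α : G [⋀^Fin 2]→L[ℝ] ℝ => α ![stdVec 0, stdVec 2])
        (h ![0, s, 0, 0] (Set.mem_univ _) 0)
      simp [ktΩ_apply, fderiv_mul, stdVec, mul, ht] at h1
      exact h1
    obtain ⟨s, hs⟩ := hne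
    exact hs (by rw [show f = fun _ => f 0 from funext hc]; simp)
  · rintro rfl a - x
    ext v
    simp only [ContinuousAlternatingMap.compContinuousLinearMap_apply, ktΩ_apply,
      Function.comp_apply, fderiv_mul]
    simp [mul]
    ring

theorem isAlmostKahler_ktStructure_iff (hne : ∃ s, deriv f s ≠ 0) :
    (ktStructure f hf hper t).IsAlmostKahler ↔ t = 0 := by
  constructor
  · intro h
    obtain ⟨s, hs⟩ := hne
    have h1 := congrArg (fun α : G [⋀^Fin 3]→L[ℝ] ℝ => α ![stdVec 0, stdVec 1, stdVec 2])
      ((extDeriv_ktΩ hf hper t ![0, s, 0, 0]).symm.trans (congrFun h _))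
    simp [wedge₁₁₁, wedge_apply_three, wedge₁₁_apply, e₁, e₂, e₃, dx, stdVec, hs] at h1
    exact h1
  · rintro rfl
    funext x
    refine (extDeriv_ktΩ hf hper 0 x).trans ?_
    simp

/-- The conformally equivalent metric with fundamental form
`e^{-2tf(x₂)} ω_{tf} = e¹³ + e^{-2tf(x₂)} e²⁴` is almost-Kähler. -/
theorem exists_almostKahler_conformal : ∃ S : AlmostHermitian, S.J = ktJ ∧
    (∀ x, S.Ω x = Real.exp (-2 * t * f (x 1)) • (ktStructure f hf hper t).Ω x) ∧
    S.IsAlmostKahler := by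
  obtain ⟨Ω', hΩ'⟩ : ∃ Ω' : Form 2 ℝ,
    Ω' = fun x => Real.exp (-2 * t * f (x 1)) • ktΩ f t x := ⟨_, rfl⟩
  have hv : ∀ x v, Ω' x v = Real.exp (-2 * t * f (x 1)) * ktΩ f t x v := fun x v => by
    rw [hΩ']; rfl
  have hsm : ContDiff ℝ ∞ Ω' := by
    rw [hΩ']
    exact (contDiff_const.mul (hf.comp (contDiff_coord 1))).exp.smul
      (ktStructure f hf hper t).Ω_form.1
  have hEF : ∀ x : G, Real.exp (-2 * t * f (x 1)) * Real.exp (2 * t * f (x 1)) = 1 := fun x => by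
    rw [← Real.exp_add]; simp
  have hJ : IsJForm Ω' 1 0 0 (expFun f hf hper (-2 * t)) := by
    refine isJForm_of ?_ ?_ ?_ ?_ ?_ ?_ <;> intro x <;> rw [hv] <;>
      simp [ktΩ, wedge₁₁_apply, coframe_frame, expFun_apply]
    simpa using hEF x
  refine ⟨{ ktStructure f hf hper t with
    Ω := Ω'
    Ω_form := hJ.isFormOnX hsm
    Ω_compat := fun x u v => ?_
    Ω_pos := fun x u hu => ?_ }, rfl, fun x => ?_, ?_⟩
  · rw [hv, hv]
    exact congrArg _ ((ktStructure f hf hper t).Ω_compat x u v)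
  · rw [hv]
    exact mul_pos (Real.exp_pos _) ((ktStructure f hf hper t).Ω_pos x u hu)
  · exact congrFun hΩ' x
  · exact hJ.extDeriv_eq_zero_of_const hsm lieD_one (fun i => by simp)
      (lieD_expFun _ (by decide)) (lieD_expFun _ (by decide))

end Structure

end KodairaThurston

theorem mainTheorem8 (f : ℝ → ℝ) (hf : ContDiff ℝ ∞ f) (hper : ∀ s, f (s + 1) = f s)
    (hne : ∃ s, deriv f s ≠ 0) :
    -- the almost-complex structure `J`: left-invariant, with `(1,0)`-coframe `φ¹, φ²`, the stated
    -- structure equations, and not integrable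
    (InvariantEndo Set.univ ktJ ∧
      (∀ x v, φ₁ x (ktJ x v) = Complex.I * φ₁ x v ∧ φ₂ x (ktJ x v) = Complex.I * φ₂ x v) ∧
      (∀ x, extDeriv (oneForm φ₁) x =
        -(Complex.I / 4) • wedge₁₁ (φ₁ x) (φ₂ x)
          - (Complex.I / 4) • wedge₁₁ (φ₁ x) (conj (φ₂ x))
          + (Complex.I / 4) • wedge₁₁ (φ₂ x) (conj (φ₁ x))
          - (Complex.I / 4) • wedge₁₁ (conj (φ₁ x)) (conj (φ₂ x))) ∧
      extDeriv (oneForm φ₂) = 0 ∧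
      ¬ IsIntegrable ktJ) ∧
    ∀ t : ℝ,
      -- the Hermitian metrics `ω_{tf}`
      (ktStructure f hf hper t).J = ktJ ∧
      (∀ x, (ktStructure f hf hper t).Ω x =
        Real.exp (2 * t * f (x 1)) • wedge₁₁ (e₁ x) (e₃ x) + wedge₁₁ (e₂ x) (e₄ x)) ∧
      (InvariantForm Set.univ (ktStructure f hf hper t).Ω ↔ t = 0) ∧
      ((ktStructure f hf hper t).IsAlmostKahler ↔ t = 0) ∧
      -- `dω_{tf} = -2 t e^{2 t f} f' e¹²³ = 2 t df ∧ ω_{tf}`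
      (∀ x, extDeriv (ktStructure f hf hper t).Ω x =
        (-2 * t * Real.exp (2 * t * f (x 1)) * deriv f (x 1)) •
          wedge₁₁₁ (e₁ x) (e₂ x) (e₃ x)) ∧
      (∀ x, extDeriv (ktStructure f hf hper t).Ω x =
        wedge (fderiv ℝ (fun y : G => 2 * t * f (y 1)) x) ((ktStructure f hf hper t).Ω x)) ∧
      (ktStructure f hf hper t).IsGloballyConformallyKahler ∧
      (∃ S : AlmostHermitian, S.J = ktJ ∧
        (∀ x, S.Ω x = Real.exp (-2 * t * f (x 1)) • (ktStructure f hf hper t).Ω x) ∧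
        S.IsAlmostKahler) ∧
      -- the Hodge number
      (ktStructure f hf hper t).bMinus = 2 ∧
      (ktStructure f hf hper t).h11 = (ktStructure f hf hper t).bMinus + 1 ∧
      (ktStructure f hf hper t).h11 = 3 ∧
      -- the explicit basis of the space of harmonic `(1,1)`-forms
      LinearIndependent ℂ (![fun x => wedge₁₁ (φ₁ x) (conj (φ₁ x)),
        fun x => wedge₁₁ (φ₁ x) (conj (φ₂ x)) + wedge₁₁ (φ₂ x) (conj (φ₁ x)),
        fun x => (Real.exp (-2 * t * f (x 1)) : ℂ) • wedge₁₁ (φ₂ x) (conj (φ₂ x))] :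
          Fin 3 → Form 2 ℂ) ∧
      (ktStructure f hf hper t).harmonic11 = Submodule.span ℂ
        (Set.range (![fun x => wedge₁₁ (φ₁ x) (conj (φ₁ x)),
          fun x => wedge₁₁ (φ₁ x) (conj (φ₂ x)) + wedge₁₁ (φ₂ x) (conj (φ₁ x)),
          fun x => (Real.exp (-2 * t * f (x 1)) : ℂ) • wedge₁₁ (φ₂ x) (conj (φ₂ x))] :
            Fin 3 → Form 2 ℂ)) := by
  exact ⟨⟨invariant_ktJ _, φ_comp_ktJ, extDeriv_φ₁, extDeriv_φ₂, not_isIntegrable_ktJ⟩, fun t =>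
    ⟨rfl, fun _ => rfl, invariantForm_ktΩ_iff t hne, isAlmostKahler_ktStructure_iff hf hper t hne,
      extDeriv_ktΩ hf hper t, extDeriv_ktΩ_eq_wedge hf hper t,
      isGloballyConformallyKahler_ktStructure hf hper t, exists_almostKahler_conformal hf hper t,
      bMinus_eq_two f hf hper t, by rw [h11_eq_three, bMinus_eq_two], h11_eq_three f hf hper t,
      linearIndependent_dbarHarmonicBasis f t, harmonic11_eq_span f hf hper t⟩⟩
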